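/- Consider an $N$-stage reducible Lagrangian field theory of even and odd fields on a composite bundle $F\to Y\to X$, $n=\dim X$, written in a local basis over a fibred coordinate domain $V$ of $Y\to X$ with coordinates $(x^\lambda,y^i)$ ($V$ is an arbitrary open subset of $\mathbb R^n\times\mathbb R^m$; all identities below are local, so over a manifold the statement applies on each coordinate domain). The fields are $s^A=(y^i,c^a)$ ($y^i$ even, $c^a$ odd) with antifields $\bar s_A$ of antifield number $1$. For $0\le k\le N$ there are finitely many $k$-stage antifields $\bar c_{r_k}$, of antifield number $k+2$, and $k$-stage ghosts $c^{r_k}$, of ghost number $k+1$. The parities are $[\bar s_A]=[s^A]+1$ and $[c^{r_k}]=[\bar c_{r_k}]+1$. Graded functions are polynomials in the jets of $c^a$, of the ghosts and of the antifields, with coefficients that are smooth functions of $(x^\lambda,y^i)\in V$ and of finitely many jets $y^i_\Lambda$. Let $d_\Lambda$ be the total derivatives for multi-indices $\Lambda$, $\mathcal L$ an even Lagrangian depending on the fields only, and $\mathcal E_A=\sum_\Lambda(-1)^{|\Lambda|}d_\Lambda(\partial\mathcal L/\partial s^A_\Lambda)$. Let $$\Delta_{r_k}=G_{r_k}+h_{r_k},\qquad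 G_{r_k}=\sum_\Lambda\Delta_{r_k}^{r_{k-1},\Lambda}\,\bar c_{\Lambda r_{k-1}},\qquad \bar c_{r_{-1}}:=\bar s_A,$$ where the coefficients $\Delta_{r_k}^{r_{k-1},\Lambda}$ depend on the fields only, and $h_{r_k}$ is ghost-free and consists of terms of polynomial degree at least $2$ in antifields; $\Delta_{r_k}$ has antifield number $k+1$ and parity $[\bar c_{r_k}]+1$. Let $\delta_{KT}$ be the right graded derivation that commutes with the total derivatives, sends $\bar s_A\mapsto\mathcal E_A$ and $\bar c_{r_k}\mapsto\Delta_{r_k}$ and annihilates fields and ghosts. It is assumed to be nilpotent (the Koszul–Tate operator). Let $\delta_k$ be its restriction to ghost-free elements with antifields of stages $\le k$ only, with $\delta_{-1}=\bar\delta$ (only $\bar s_A$ occur). The gauge operator is the left graded derivation $$\mathbf u=\sum_{k=0}^N u^{(k)},\qquad u^{(0)}=u=u^A\frac{\partial}{\partial s^A},\qquad u^{(k)}=u^{r_{k-1}}\frac{\partial}{\partial c^{r_{k-1}}}\ (k\ge1),$$ $$u^A=\sum_\Lambda c^r_\Lambda\,\eta(\Delta_r^A)^\Lambda,\qquad u^{r_{k-1}}=\sum_\Lambda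 c^{r_k}_\Lambda\,\eta(\Delta^{r_{k-1}}_{r_k})^\Lambda,\qquad \eta(f)^\Lambda=\sum_\Sigma(-1)^{|\Sigma+\Lambda|}\binom{\Sigma+\Lambda}{\Lambda}d_\Sigma f^{\Sigma+\Lambda},$$ all derivations being prolonged to jets. Suppose that $\mathbf u$ admits a nilpotent BRST extension $\mathbf b=\mathbf u+\gamma$, $\gamma=\sum_{k=1}^{N+1}\gamma^{r_{k-1}}\partial/\partial c^{r_{k-1}}$. This means that each $\gamma^{r_{k-1}}$ is antifield-free, consists of terms of polynomial degree at least $2$ in the ghosts, and has ghost number $k+1$ and parity $[c^{r_{k-1}}]+1$, and that $\mathbf b(\mathbf b f)=0$ for all antifield-free $f$. Then the following hold. 1. The higher-stage gauge symmetry conditions hold off-shell: $u^{(k+1)}(u^{(k)})=0$ for $0\le k\le N-1$, i.e. $u^{(k+1)}$ annihilates every component of $u^{(k)}$. 2. The higher-stage Noether identities hold off-shell: for $1\le k\le N$, $$\sum_\Lambda\Delta_{r_k}^{r_{k-1},\Lambda}\,d_\Lambda\Big(\sum_\Sigma\Delta_{r_{k-1}}^{r_{k-2},\Sigma}\,\bar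 c_{\Sigma r_{k-2}}\Big)=0,\qquad \bar\delta\big(h^{(2)}_{r_k}\big)=0,$$ where $h^{(2)}_{r_k}$ is the part of $h_{r_k}$ quadratic in antifields and $\bar\delta$ sends $\bar s_A\mapsto\mathcal E_A$ and annihilates the other generators. 3. Suppose that the homology condition holds: for $-1\le k<N$, every $\delta_k$-cycle of antifield number $k+3$ with antifields of stages $\le k$ is the $\delta_{k+1}$-boundary of an element of antifield number $k+4$. Then each $\Delta_{r_k}$ reduces to its part linear in antifields by a change of the antifields. Namely, there are ghost-free $\psi_{r_k}$ (with $\psi_{r_0}=0$), of the parity and antifield number of $\bar c_{r_k}$ and with antifields of stages $<k$ only, such that for $\bar c'_{r_k}=\bar c_{r_k}-\psi_{r_k}$, $\bar c'_{r_{-1}}=\bar s_A$, one has $\delta_{KT}\bar c'_{r_k}=\sum_\Lambda\Delta_{r_k}^{r_{k-1},\Lambda}d_\Lambda\bar c'_{r_{k-1}}$ for all $0\le k\le N$. Moreover, if the homology condition is only assumed for cycles whose support projects into a compact subset of $V$, then for each compact $K\subset V$ there are such $\psi_{r_k}$ for which these equalities hold over $K$. -/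

import Mathlib

noncomputable section

namespace GaugeTheory

open scoped ContDiff

/-! ### Local bases, jets and graded functions -/

/-- A coordinate domain of a composite bundle `F → Y → X` with the local basis of even fields,
odd fields, ghosts and antifields over it.
* `n = dim X`; `V` is the (arbitrary open) coordinate image of a domain of fibred coordinates
  `(x^l, y^i)` of `Y → X`, and `m` is the number of even fields `y^i`;
* `p` is the number of odd fields `c^a` (fibre coordinates of `F → Y`);
* `q` is the number of the antifields `c̄_r` of all stages `0, …, N` taken together (local frames
  of the density-duals of the graded vector bundles `E_0, …, E_N`); `stage r` is the stage of the
  index `r` and `par r` the Grassmann parity of `c̄_r`. -/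
structure LocalBasis where
  n : ℕ
  m : ℕ
  p : ℕ
  q : ℕ
  N : ℕ
  stage : Fin q → ℕ
  stage_le : ∀ r, stage r ≤ N
  par : Fin q → ZMod 2
  V : TopologicalSpace.Opens ((Fin n → ℝ) × (Fin m → ℝ))

/-- Symmetric multi-indices `Λ`: `Λ l` is the number of occurrences of the index `l`. -/
abbrev MIdx (B : LocalBasis) : Type := Fin B.n →₀ ℕ

/-- Even coordinates of the infinite order jet space: `x^l` and `y^i_Λ`. -/
abbrev Coord (B : LocalBasis) : Type := Fin B.n ⊕ (Fin B.m × MIdx B)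

/-- The projection `(x^l, y^i_Λ) ↦ (x^l, y^i)`. -/
def base (B : LocalBasis) (z : Coord B → ℝ) : (Fin B.n → ℝ) × (Fin B.m → ℝ) :=
  (fun l => z (Sum.inl l), fun i => z (Sum.inr (i, 0)))

/-- The part of the infinite order jet space over the coordinate domain. -/
abbrev Jet (B : LocalBasis) : Type := {z : Coord B → ℝ // base B z ∈ B.V}

/-- Smooth functions of finite jet order: smooth functions of finitely many coordinates. -/
def IsSmooth (B : LocalBasis) (f : Jet B → ℝ) : Prop :=
  ∃ (S : Finset (Coord B)) (g : (S → ℝ) → ℝ), (∀ z : Jet B, f z = g (S.restrict z.1)) ∧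
    ContDiffOn ℝ ∞ g {w | ∃ z : Jet B, S.restrict z.1 = w}

variable {B : LocalBasis}

theorem continuous_base : Continuous (base B) := by
  unfold base; fun_prop

theorem isOpen_proj (S : Finset (Coord B)) :
    IsOpen {w : S → ℝ | ∃ z : Jet B, S.restrict z.1 = w} := by
  classical
  rw [isOpen_iff_mem_nhds]
  rintro _ ⟨z, rfl⟩
  let e : (S → ℝ) → (Coord B → ℝ) := fun w c => if h : c ∈ S then w ⟨c, h⟩ else z.1 c
  have he : Continuous e := by
    refine continuous_pi fun c => ?_
    by_cases h : c ∈ S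
    · simpa [e, h] using continuous_apply (⟨c, h⟩ : S)
    · simpa [e, h] using continuous_const
  have hz : e (S.restrict z.1) = z.1 := by
    funext c; simp [e]
  have ho : IsOpen ((base B ∘ e) ⁻¹' (B.V : Set _)) :=
    B.V.isOpen.preimage (continuous_base.comp he)
  refine Filter.mem_of_superset (ho.mem_nhds ?_) ?_
  · simpa [hz] using z.2
  · intro w hw
    refine ⟨⟨e w, hw⟩, ?_⟩
    funext c; simp [e]

theorem IsSmooth.mono {f : Jet B → ℝ} {S T : Finset (Coord B)} (h : S ⊆ T)
    {g : (S → ℝ) → ℝ} (hf : ∀ z : Jet B, f z = g (S.restrict z.1))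
    (hg : ContDiffOn ℝ ∞ g {w | ∃ z : Jet B, S.restrict z.1 = w}) :
    ∃ g' : (T → ℝ) → ℝ, (∀ z : Jet B, f z = g' (T.restrict z.1)) ∧
      ContDiffOn ℝ ∞ g' {w | ∃ z : Jet B, T.restrict z.1 = w} := by
  refine ⟨fun w => g (fun c => w ⟨c.1, h c.2⟩), fun z => hf z, ?_⟩
  refine hg.comp (by fun_prop) ?_
  rintro _ ⟨z, rfl⟩
  exact ⟨z, rfl⟩

theorem IsSmooth.comp₂ {f₁ f₂ : Jet B → ℝ} (h₁ : IsSmooth B f₁) (h₂ : IsSmooth B f₂)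
    {F : ℝ × ℝ → ℝ} (hF : ContDiff ℝ ∞ F) : IsSmooth B fun z => F (f₁ z, f₂ z) := by
  classical
  obtain ⟨S₁, g₁, e₁, c₁⟩ := h₁
  obtain ⟨S₂, g₂, e₂, c₂⟩ := h₂
  obtain ⟨g₁', e₁', c₁'⟩ := IsSmooth.mono (Finset.subset_union_left (s₁ := S₁) (s₂ := S₂)) e₁ c₁
  obtain ⟨g₂', e₂', c₂'⟩ := IsSmooth.mono (Finset.subset_union_right (s₁ := S₁) (s₂ := S₂)) e₂ c₂
  refine ⟨S₁ ∪ S₂, fun w => F (g₁' w, g₂' w), fun z => by simp only [e₁', e₂'], ?_⟩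
  exact hF.comp_contDiffOn (c₁'.prodMk c₂')

variable (B) in
/-- The ring of smooth functions of finite jet order over the coordinate domain. -/
def smoothFunctions : Subalgebra ℝ (Jet B → ℝ) where
  carrier := {f | IsSmooth B f}
  mul_mem' h₁ h₂ := IsSmooth.comp₂ h₁ h₂ (F := fun x => x.1 * x.2) (by fun_prop)
  add_mem' h₁ h₂ := IsSmooth.comp₂ h₁ h₂ (F := fun x => x.1 + x.2) (by fun_prop)
  algebraMap_mem' r := ⟨∅, fun _ => r, fun _ => rfl, contDiffOn_const⟩

/-- Smooth functions of finite jet order, as a ring. -/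
abbrev Coef (B : LocalBasis) : Type := smoothFunctions B

/-- The partial derivative of a function on the jet space with respect to a coordinate. -/
def pdFun (c : Coord B) (f : Jet B → ℝ) (z : Jet B) : ℝ :=
  deriv (fun t => Function.extend Subtype.val f 0 (Function.update z.1 c t)) (z.1 c)

open Classical in
theorem pdFun_eq (c : Coord B) {f : Jet B → ℝ} {S : Finset (Coord B)} {g : (S → ℝ) → ℝ}
    (hf : ∀ z : Jet B, f z = g (S.restrict z.1))
    (hg : ContDiffOn ℝ ∞ g {w | ∃ z : Jet B, S.restrict z.1 = w}) (z : Jet B) :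
    pdFun c f z = fderiv ℝ g (S.restrict z.1) (fun s => if s.1 = c then 1 else 0) := by
  have hu : Continuous fun t : ℝ => Function.update z.1 c t :=
    continuous_const.update c continuous_id
  have hopen : IsOpen ((fun t : ℝ => base B (Function.update z.1 c t)) ⁻¹' (B.V : Set _)) :=
    B.V.isOpen.preimage (continuous_base.comp hu)
  have hmem : z.1 c ∈ (fun t : ℝ => base B (Function.update z.1 c t)) ⁻¹' (B.V : Set _) := by
    simpa using z.2
  have hev : (fun t => Function.extend Subtype.val f 0 (Function.update z.1 c t)) =ᶠ[nhds (z.1 c)]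
      fun t => g (S.restrict (Function.update z.1 c t)) := by
    filter_upwards [hopen.mem_nhds hmem] with t ht
    have := Subtype.val_injective.extend_apply f 0 (⟨Function.update z.1 c t, ht⟩ : Jet B)
    rw [this, hf]
  have hd : HasDerivAt (fun t : ℝ => S.restrict (Function.update z.1 c t))
      (fun s : S => if s.1 = c then (1 : ℝ) else 0) (z.1 c) := by
    rw [hasDerivAt_pi]
    intro s
    by_cases h : s.1 = c
    · simpa [h, Finset.restrict] using hasDerivAt_id' (z.1 c)
    · simpa [h, Finset.restrict] using hasDerivAt_const (z.1 c) (z.1 s.1)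
  have hgd : DifferentiableAt ℝ g (S.restrict (Function.update z.1 c (z.1 c))) := by
    rw [Function.update_eq_self]
    exact (hg.contDiffAt ((isOpen_proj S).mem_nhds ⟨z, rfl⟩)).differentiableAt (by simp)
  have h2 := (hgd.hasFDerivAt.comp_hasDerivAt (z.1 c) hd).deriv
  rw [pdFun, hev.deriv_eq]
  rw [Function.update_eq_self] at h2
  exact h2

theorem IsSmooth.pdFun (c : Coord B) {f : Jet B → ℝ} (h : IsSmooth B f) :
    IsSmooth B (pdFun c f) := by
  classical
  obtain ⟨S, g, hf, hg⟩ := h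
  refine ⟨S, fun w => fderiv ℝ g w (fun s => if s.1 = c then 1 else 0),
    fun z => pdFun_eq c hf hg z, ?_⟩
  exact (hg.fderiv_of_isOpen (isOpen_proj S) (by simp)).clm_apply contDiffOn_const

/-- Partial derivatives on the ring of smooth functions of finite jet order. -/
def pdCoef (c : Coord B) (f : Coef B) : Coef B := ⟨pdFun c f.1, IsSmooth.pdFun c f.2⟩

/-- The coordinate functions `x^l` and `y^i_Λ`. -/
def coordFun (c : Coord B) : Coef B :=
  ⟨fun z => z.1 c, {c}, fun w => w ⟨c, by simp⟩, fun _ => rfl, by fun_prop⟩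

/-- Indices `A` of the fields `s^A`: even fields `y^i` and odd fields `c^a`. -/
abbrev SIdx (B : LocalBasis) : Type := Fin B.m ⊕ Fin B.p

/-- Indices of the fields `s^A` and of the ghosts `c^r` of all stages. They also enumerate the
antifields: `s̄_A` and `c̄_r`. -/
abbrev Fld (B : LocalBasis) : Type := SIdx B ⊕ Fin B.q

/-- `0` for a field `s^A` and `k + 1` for a `k`-stage ghost. This is the ghost number of the field
or ghost; the antifield number of the corresponding antifield is larger by one. -/
def level : Fld B → ℕ
  | .inl _ => 0
  | .inr r => B.stage r + 1

/-- The Grassmann parity of fields and ghosts, `[c^r] = [c̄_r] + 1`. -/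
def fldPar : Fld B → ZMod 2
  | .inl (.inl _) => 0
  | .inl (.inr _) => 1
  | .inr r => B.par r + 1

/-- The generators other than `x^l` and `y^i_Λ` (up to jets): odd fields `c^a`, ghosts `c^r`,
antifields `s̄_A` and `c̄_r`. -/
inductive GKind (B : LocalBasis) : Type
  | odd (a : Fin B.p)
  | ghost (r : Fin B.q)
  | anti (w : Fld B)

/-- The Grassmann parity of generators; `[s̄_A] = [s^A] + 1`, `[c̄_r] = [c^r] + 1`. -/
def GKind.par : GKind B → ZMod 2
  | .odd _ => 1
  | .ghost r => fldPar (.inr r)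
  | .anti w => fldPar w + 1

/-- The jets of generators `c^a_Λ`, `c^r_Λ`, `s̄_{ΛA}`, `c̄_{Λr}`. -/
abbrev Gen (B : LocalBasis) : Type := GKind B × MIdx B

/-- Odd generators. -/
def IsOddGen (g : Gen B) : Prop := g.1.par = 1

/-- Exponents of monomials in generators: odd generators occur at most once. -/
abbrev Mon (B : LocalBasis) : Type := {α : Gen B →₀ ℕ // ∀ g, IsOddGen g → α g ≤ 1}

open Classical in
/-- The number of transpositions of odd generators that bring the product of the monomials `α` and
`β` to its ordered form. -/
def inversions (α β : Gen B →₀ ℕ) : ℕ :=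
  α.sum fun g a => β.sum fun h b =>
    if IsOddGen g ∧ IsOddGen h ∧ WellOrderingRel h g then a * b else 0

theorem inversions_add_left (α β γ : Gen B →₀ ℕ) :
    inversions (α + β) γ = inversions α γ + inversions β γ := by
  classical
  unfold inversions
  refine Finsupp.sum_add_index' (by simp) fun g a b => ?_
  rw [← Finsupp.sum_add]
  refine Finsupp.sum_congr fun h _ => ?_
  split_ifs <;> ring

theorem inversions_add_right (α β γ : Gen B →₀ ℕ) :
    inversions α (β + γ) = inversions α β + inversions α γ := by
  classical
  unfold inversions
  rw [← Finsupp.sum_add]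
  refine Finsupp.sum_congr fun g _ => ?_
  refine Finsupp.sum_add_index' (by simp) fun h a b => ?_
  split_ifs <;> ring

open Classical in
/-- The term `a · e_α`, where `e_α` is the ordered monomial with exponents `α`; it is zero if an
odd generator is repeated. -/
def rawTerm (α : Gen B →₀ ℕ) (a : Coef B) : Mon B →₀ Coef B :=
  if h : ∀ g, IsOddGen g → α g ≤ 1 then Finsupp.single ⟨α, h⟩ a else 0

theorem rawTerm_zero (α : Gen B →₀ ℕ) : rawTerm α (0 : Coef B) = 0 := by
  unfold rawTerm; split_ifs <;> simp

theorem rawTerm_add (α : Gen B →₀ ℕ) (a b : Coef B) :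
    rawTerm α (a + b) = rawTerm α a + rawTerm α b := by
  unfold rawTerm; split_ifs <;> simp

theorem rawTerm_mon (α : Mon B) (a : Coef B) : rawTerm α.1 a = Finsupp.single α a := by
  unfold rawTerm; rw [dif_pos α.2]

theorem rawTerm_eq_zero {α : Gen B →₀ ℕ} (h : ¬ ∀ g, IsOddGen g → α g ≤ 1) (a : Coef B) :
    rawTerm α a = 0 := by
  unfold rawTerm; rw [dif_neg h]

/-- The graded commutative product of linear combinations of monomials. -/
def rawMul (f g : Mon B →₀ Coef B) : Mon B →₀ Coef B :=
  f.sum fun α a => g.sum fun β b =>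
    rawTerm (α.1 + β.1) ((-1) ^ inversions α.1 β.1 * (a * b))

theorem rawMul_add_left (f g h : Mon B →₀ Coef B) :
    rawMul (f + g) h = rawMul f h + rawMul g h := by
  classical
  unfold rawMul
  refine Finsupp.sum_add_index' (fun α => ?_) fun α a b => ?_
  · simp [rawTerm_zero]
  · rw [← Finsupp.sum_add]
    refine Finsupp.sum_congr fun β _ => ?_
    rw [← rawTerm_add]; congr 1; ring

theorem rawMul_add_right (f g h : Mon B →₀ Coef B) :
    rawMul f (g + h) = rawMul f g + rawMul f h := by
  classical
  unfold rawMul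
  rw [← Finsupp.sum_add]
  refine Finsupp.sum_congr fun α _ => ?_
  refine Finsupp.sum_add_index' (fun β => ?_) fun β a b => ?_
  · simp [rawTerm_zero]
  · rw [← rawTerm_add]; congr 1; ring

theorem rawMul_zero_left (f : Mon B →₀ Coef B) : rawMul 0 f = 0 := by simp [rawMul]

theorem rawMul_zero_right (f : Mon B →₀ Coef B) : rawMul f 0 = 0 := by simp [rawMul]

theorem rawMul_term (α β : Gen B →₀ ℕ) (a b : Coef B) :
    rawMul (rawTerm α a) (rawTerm β b) =
      rawTerm (α + β) ((-1) ^ inversions α β * (a * b)) := by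
  by_cases hα : ∀ g, IsOddGen g → α g ≤ 1
  · by_cases hβ : ∀ g, IsOddGen g → β g ≤ 1
    · have e1 := rawTerm_mon ⟨α, hα⟩ a
      have e2 := rawTerm_mon ⟨β, hβ⟩ b
      simp only at e1 e2
      rw [e1, e2, rawMul, Finsupp.sum_single_index, Finsupp.sum_single_index]
      · simp [rawTerm_zero]
      · simp [rawTerm_zero]
    · rw [rawTerm_eq_zero hβ, rawMul_zero_right, rawTerm_eq_zero]
      exact fun h => hβ fun g hg => le_trans (by simp) (h g hg)
  · rw [rawTerm_eq_zero hα, rawMul_zero_left, rawTerm_eq_zero]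
    exact fun h => hα fun g hg => le_trans (by simp) (h g hg)

theorem raw_induction {P : (Mon B →₀ Coef B) → Prop} (f : Mon B →₀ Coef B) (h0 : P 0)
    (hadd : ∀ f g, P f → P g → P (f + g))
    (hterm : ∀ (α : Mon B) (a : Coef B), P (rawTerm α.1 a)) : P f :=
  Finsupp.induction_linear f h0 hadd fun α a => rawTerm_mon α a ▸ hterm α a

theorem rawMul_assoc (f g h : Mon B →₀ Coef B) :
    rawMul (rawMul f g) h = rawMul f (rawMul g h) := by
  induction f using raw_induction with
  | h0 => simp only [rawMul_zero_left]
  | hadd f f' hf hf' => simp only [rawMul_add_left, hf, hf']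
  | hterm α a =>
    induction g using raw_induction with
    | h0 => simp only [rawMul_zero_left, rawMul_zero_right]
    | hadd f f' hf hf' => simp only [rawMul_add_left, rawMul_add_right, hf, hf']
    | hterm β b =>
      induction h using raw_induction with
      | h0 => simp only [rawMul_zero_right]
      | hadd f f' hf hf' => simp only [rawMul_add_right, hf, hf']
      | hterm γ c =>
        simp only [rawMul_term, inversions_add_left, inversions_add_right, pow_add, add_assoc]
        congr 1; ring

theorem rawMul_one_left (f : Mon B →₀ Coef B) : rawMul (rawTerm 0 1) f = f := by
  induction f using raw_induction with
  | h0 => exact rawMul_zero_right _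
  | hadd f f' hf hf' => simp only [rawMul_add_right, hf, hf']
  | hterm α a => rw [rawMul_term]; simp [inversions]

theorem rawMul_one_right (f : Mon B →₀ Coef B) : rawMul f (rawTerm 0 1) = f := by
  induction f using raw_induction with
  | h0 => exact rawMul_zero_left _
  | hadd f f' hf hf' => simp only [rawMul_add_left, hf, hf']
  | hterm α a => rw [rawMul_term]; simp [inversions]

variable (B) in
/-- The graded commutative algebra with the local basis `(s^A, s̄_A, c^r, c̄_r)` (all stages):
polynomials in the jets of odd fields, ghosts and antifields whose coefficients are smooth
functions of finite jet order. A horizontal density `f d^n x` is represented by `f`. -/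
def Alg : Type := Mon B →₀ Coef B

instance : AddCommGroup (Alg B) := inferInstanceAs (AddCommGroup (Mon B →₀ Coef B))

/-- The coefficients of an element of the graded algebra, and back. -/
def Alg.raw : Alg B ≃+ (Mon B →₀ Coef B) := AddEquiv.refl _

instance : Mul (Alg B) := ⟨fun f g => Alg.raw.symm (rawMul f.raw g.raw)⟩

instance : One (Alg B) := ⟨Alg.raw.symm (rawTerm 0 1)⟩

instance : Ring (Alg B) :=
  { (inferInstance : AddCommGroup (Alg B)) with
    mul := (· * ·)
    one := 1
    left_distrib := rawMul_add_right (B := B)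
    right_distrib := rawMul_add_left (B := B)
    zero_mul := rawMul_zero_left (B := B)
    mul_zero := rawMul_zero_right (B := B)
    mul_assoc := rawMul_assoc (B := B)
    one_mul := rawMul_one_left (B := B)
    mul_one := rawMul_one_right (B := B) }

/-- The term `a · e_α` of the graded algebra. -/
def term (α : Gen B →₀ ℕ) (a : Coef B) : Alg B := Alg.raw.symm (rawTerm α a)

/-- A generator of the graded algebra. -/
def gen (g : Gen B) : Alg B := term (Finsupp.single g 1) 1

/-! ### Derivations -/

/-- The left derivative with respect to a generator. -/
def pdL (g : Gen B) (f : Alg B) : Alg B :=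
  f.raw.sum fun α a => term (α.1 - Finsupp.single g 1)
    ((α.1 g : Coef B) *
      ((-1) ^ inversions (Finsupp.single g 1) (α.1 - Finsupp.single g 1) * a))

/-- The right derivative with respect to a generator. -/
def pdR (g : Gen B) (f : Alg B) : Alg B :=
  f.raw.sum fun α a => term (α.1 - Finsupp.single g 1)
    ((α.1 g : Coef B) *
      ((-1) ^ inversions (α.1 - Finsupp.single g 1) (Finsupp.single g 1) * a))

/-- The left derivative with respect to the jet `w_Λ` of a field or of a ghost `w`. -/
def pdFld (w : Fld B) (Λ : MIdx B) (f : Alg B) : Alg B :=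
  match w with
  | .inl (.inl i) => f.raw.sum fun α a => term α.1 (pdCoef (.inr (i, Λ)) a)
  | .inl (.inr a) => pdL (.odd a, Λ) f
  | .inr r => pdL (.ghost r, Λ) f

/-- The total derivative `d_l` of smooth functions of finite jet order. -/
def totalCoef (l : Fin B.n) (a : Coef B) : Coef B :=
  pdCoef (.inl l) a + ∑ᶠ c : Fin B.m × MIdx B,
    coordFun (.inr (c.1, c.2 + Finsupp.single l 1)) * pdCoef (.inr c) a

/-- The total derivative `d_l = ∂_l + ∑ z_{l+Λ} ∂/∂z_Λ`, the sum being over all fields, ghosts and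
antifields `z`. -/
def total (l : Fin B.n) (f : Alg B) : Alg B :=
  f.raw.sum fun α a => term α.1 (totalCoef l a) +
    ∑ g ∈ α.1.support, gen (g.1, g.2 + Finsupp.single l 1) * pdL g (term α.1 a)

/-- `d_Λ`, the composite of the total derivatives `d_l`, each taken `Λ l` times. -/
def dMulti (Λ : MIdx B) (f : Alg B) : Alg B :=
  (List.finRange B.n).foldr (fun l h => (total l)^[Λ l] h) f

/-- The (jet prolongation of the) left graded derivation `v = v^w ∂/∂w` acting on fields and
ghosts: `v(f) = ∑ d_Λ(v^w) ∂f/∂w_Λ`. -/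
def leftDer (v : Fld B → Alg B) (f : Alg B) : Alg B :=
  ∑ᶠ x : Fld B × MIdx B, dMulti x.2 (v x.1) * pdFld x.1 x.2 f

/-- The (jet prolongation of the) right graded derivation that acts on antifields `w̄ ↦ v_w`:
`v(f) = ∑ (f ←∂/∂w̄_Λ) d_Λ(v_w)`. -/
def rightDer (v : Fld B → Alg B) (f : Alg B) : Alg B :=
  ∑ᶠ x : Fld B × MIdx B, pdR (.anti x.1, x.2) f * dMulti x.2 (v x.1)

/-- For a tuple `(f^Λ)` with finitely many nonzero members,
`η(f)^Λ = ∑_Σ (-1)^{|Σ+Λ|} (Σ+Λ choose Λ) d_Σ f^{Σ+Λ}` (with the binomial coefficient of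
multi-indices and the sum written over `Ξ = Σ + Λ`), so that
`∑_Λ (-1)^{|Λ|} d_Λ(f^Λ φ) = ∑_Λ η(f)^Λ d_Λ φ`. -/
def eta (f : MIdx B →₀ Alg B) (Λ : MIdx B) : Alg B :=
  f.sum fun Ξ a => if Λ ≤ Ξ then
    ((-1) ^ Ξ.degree * ((∏ l, (Ξ l).choose (Λ l) : ℕ) : ℤ)) • dMulti (Ξ - Λ) a else 0

/-! ### Gradings -/

/-- The total weight of a monomial if a generator of kind `g` has weight `wt g`. -/
def weight {R : Type} [Semiring R] (wt : GKind B → R) (α : Mon B) : R :=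
  α.1.sum fun g k => (k : R) * wt g.1

/-- All terms of `f` have weight `d`. -/
def HasWeight {R : Type} [Semiring R] (wt : GKind B → R) (d : R) (f : Alg B) : Prop :=
  ∀ α, f.raw α ≠ 0 → weight wt α = d

/-- Polynomial degree in ghosts. -/
def ghostDeg : GKind B → ℕ
  | .ghost _ => 1
  | _ => 0

/-- Ghost number: `k + 1` for `k`-stage ghosts. -/
def ghostNum : GKind B → ℕ
  | .ghost r => B.stage r + 1
  | _ => 0

/-- Polynomial degree in antifields. -/
def antiDeg : GKind B → ℕ
  | .anti _ => 1
  | _ => 0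

/-- Antifield number on antifields: `1` for `s̄_A` and `k + 2` for `k`-stage antifields. It is only
used for elements without ghosts. -/
def antiNum : GKind B → ℕ
  | .anti w => level w + 1
  | _ => 0

/-- No ghosts occur in `f`. -/
def GhostFree (f : Alg B) : Prop := HasWeight ghostDeg 0 f

/-- No antifields occur in `f`. -/
def AntifieldFree (f : Alg B) : Prop := HasWeight antiDeg 0 f

/-- The part of `f` of polynomial degree `d` in antifields. -/
def antiPart (d : ℕ) (f : Alg B) : Alg B :=
  Alg.raw.symm (f.raw.filter fun α => weight antiDeg α = d)

/-- `f` has no ghosts, its antifields are among `s̄_A` and the `c̄_r` of stages `< j`, and its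
antifield number is `d`. -/
def IsChain (j d : ℕ) (f : Alg B) : Prop :=
  GhostFree f ∧ HasWeight antiNum d f ∧
    ∀ α, f.raw α ≠ 0 → ∀ (w : Fld B) (Λ : MIdx B), α.1 (.anti w, Λ) ≠ 0 → level w ≤ j

/-- The restriction of `f` to the part of the jet space over `Z` vanishes. -/
def VanishesOver (Z : Set ((Fin B.n → ℝ) × (Fin B.m → ℝ))) (f : Alg B) : Prop :=
  ∀ (α : Mon B) (z : Jet B), base B z.1 ∈ Z → (f.raw α).1 z = 0

/-! ### Reducible Lagrangian field theory, its Koszul–Tate and gauge operators -/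

/-- The data of an `N`-stage reducible Lagrangian field theory over a coordinate domain: an even
Lagrangian `L` and the characteristics of complete Noether and higher-stage Noether identities,
`Δ_r = ∑ D_r^{w,Λ} w̄_Λ + h_r`. Here `w̄` runs over the antifields `s̄_A` if the stage of `r` is
`0`, and over the `(k-1)`-stage antifields if it is `k ≥ 1`; the remainder `h_r` collects the terms
of polynomial degree at least two in antifields. -/
structure PreTheory (B : LocalBasis) where
  L : Alg B
  L_ghostFree : GhostFree L
  L_antifieldFree : AntifieldFree L
  L_even : HasWeight GKind.par 0 L
  D : Fin B.q → Fld B → (MIdx B →₀ Alg B)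
  D_ghostFree : ∀ r w Λ, GhostFree (D r w Λ)
  D_antifieldFree : ∀ r w Λ, AntifieldFree (D r w Λ)
  D_level : ∀ r w, D r w ≠ 0 → level w = B.stage r
  D_par : ∀ r w Λ, HasWeight GKind.par ((B.par r + 1) + (fldPar w + 1)) (D r w Λ)
  h : Fin B.q → Alg B
  h_ghostFree : ∀ r, GhostFree (h r)
  h_degree : ∀ r α, (h r).raw α ≠ 0 → 2 ≤ weight antiDeg α
  h_antiNum : ∀ r, HasWeight antiNum (B.stage r + 1) (h r)
  h_par : ∀ r, HasWeight GKind.par (B.par r + 1) (h r)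

namespace PreTheory

variable (T : PreTheory B)

/-- The variational derivatives `E_A = ∑ (-1)^{|Λ|} d_Λ(∂L/∂s^A_Λ)`. -/
def EL (A : SIdx B) : Alg B :=
  ∑ᶠ Λ : MIdx B, ((-1 : ℤ) ^ Λ.degree) • dMulti Λ (pdFld (.inl A) Λ T.L)

/-- The linear differential operator `φ ↦ ∑ D_r^{w,Λ} d_Λ φ_w`. -/
def linOp (r : Fin B.q) (φ : Fld B → Alg B) : Alg B :=
  ∑ w, (T.D r w).sum fun Λ a => a * dMulti Λ (φ w)

/-- The part `G_r = ∑ D_r^{w,Λ} w̄_Λ` of `Δ_r` that is linear in antifields. -/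
def lin (r : Fin B.q) : Alg B :=
  ∑ w, (T.D r w).sum fun Λ a => a * gen (.anti w, Λ)

/-- `Δ_r`. -/
def Del (r : Fin B.q) : Alg B := T.lin r + T.h r

/-- The operator `δ̄`: `s̄_A ↦ E_A`. -/
def deltaBar : Alg B → Alg B :=
  rightDer (Sum.elim T.EL fun _ => 0)

/-- The Koszul–Tate operator `δ_KT`: `s̄_A ↦ E_A`, `c̄_r ↦ Δ_r`. On elements with antifields of
stages at most `k` it is `δ_k`. -/
def deltaKT : Alg B → Alg B :=
  rightDer (Sum.elim T.EL T.Del)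

/-- The components `u^w = ∑ c^r_Λ η(D_r^w)^Λ` of the gauge operator `𝐮 = ∑ u^w ∂/∂w`. Only ghosts
`c^r` with `level (c^r) = level w + 1` contribute. -/
def u (w : Fld B) : Alg B :=
  ∑ r, ∑ᶠ Λ : MIdx B, gen (.ghost r, Λ) * eta (T.D r w) Λ

/-- The summands `u^{(k)}` of the gauge operator: `u^{(0)} = u = u^A ∂/∂s^A` is the gauge symmetry,
and the `k`-stage gauge symmetry `u^{(k)}` acts on `(k-1)`-stage ghosts. -/
def uStage (k : ℕ) : Alg B → Alg B :=
  leftDer fun w => if level w = k then T.u w else 0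

/-- The operator `𝐛 = 𝐮 + γ`, where `γ = ∑ γ^r ∂/∂c^r` acts on ghosts. -/
def brst (γ : Fin B.q → Alg B) : Alg B → Alg B :=
  leftDer (Sum.elim (fun A => T.u (.inl A)) fun r => T.u (.inr r) + γ r)

/-- `𝐛 = 𝐮 + γ` is a nilpotent (BRST) extension of the gauge operator: it is odd of ghost number
`1`, `γ` consists of antifield-free terms of polynomial degree at least two in ghosts (by ghost
number, a term acting on `(k-1)`-stage ghosts then only contains ghosts of stages `< k`), and
`𝐛 (𝐛 f) = 0` for all antifield-free `f`. -/
structure IsBRSTExtension (γ : Fin B.q → Alg B) : Prop where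
  antifieldFree : ∀ r, AntifieldFree (γ r)
  degree : ∀ r α, (γ r).raw α ≠ 0 → 2 ≤ weight ghostDeg α
  ghostNumber : ∀ r, HasWeight ghostNum (B.stage r + 2) (γ r)
  parity : ∀ r, HasWeight GKind.par (fldPar (.inr r) + 1) (γ r)
  nilpotent : ∀ f, AntifieldFree f → T.brst γ (T.brst γ f) = 0

end PreTheory

/-- An `N`-stage reducible Lagrangian field theory over a coordinate domain, with the nilpotent
Koszul–Tate operator. Nilpotency says that the Noether and higher-stage Noether identities hold. -/
structure Theory (B : LocalBasis) extends PreTheory B where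
  nilpotent : ∀ f, GhostFree f → toPreTheory.deltaKT (toPreTheory.deltaKT f) = 0

namespace PreTheory

variable (T : PreTheory B)

/-- The homology condition for cycles that vanish outside of `Z`: for all `-1 ≤ k < N`, any
`δ_k`-cycle of antifield number `k + 3` with antifields of stages at most `k` is a
`δ_{k+1}`-boundary. (`j = k + 1`; `k = -1` refers to `δ_{-1} = δ̄` and the antifields `s̄_A`.) -/
def HomologyCondition (Z : Set ((Fin B.n → ℝ) × (Fin B.m → ℝ))) : Prop :=
  ∀ j ≤ B.N, ∀ φ : Alg B, IsChain j (j + 2) φ → VanishesOver Zᶜ φ → T.deltaKT φ = 0 →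
    ∃ ψ : Alg B, IsChain (j + 1) (j + 3) ψ ∧ T.deltaKT ψ = φ

/-- Over `Z`, each `Δ_r` reduces to its part linear in antifields after a change of basis
antifields `c̄'_r = c̄_r - ψ_r`, where `ψ_r` is of the same parity and antifield number as `c̄_r`
and only contains antifields of lower stages (and `s̄_A`): then `δ_KT c̄'_r = ∑ D_r^{w,Λ} d_Λ w̄'`
with `w̄' = s̄_A` for the stage `0` and `w̄' = c̄'_{r'}` for higher stages. -/
def ReducesOver (Z : Set ((Fin B.n → ℝ) × (Fin B.m → ℝ))) : Prop :=
  ∃ ψ : Fin B.q → Alg B, (∀ r, B.stage r = 0 → ψ r = 0) ∧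
    (∀ r, IsChain (B.stage r) (B.stage r + 2) (ψ r) ∧ HasWeight GKind.par (B.par r) (ψ r)) ∧
    ∀ r, VanishesOver Z (T.deltaKT (gen (.anti (.inr r), 0) - ψ r) -
      T.linOp r (Sum.elim (fun A => gen (.anti (.inl A), 0))
        fun r' => gen (.anti (.inr r'), 0) - ψ r'))

end PreTheory

end GaugeTheory

end

noncomputable section

namespace GaugeTheory

open scoped ContDiff

variable {B : LocalBasis}

/-! ### Partial and total derivatives of smooth functions -/

/-! The proof is a degree count followed by an integration by parts, and then an obstruction
argument stage by stage.

Evaluate `𝐛 (𝐛 f) = 0` on the coordinate function `f` of a field or ghost `w`, so that `𝐛 f = u^w +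
γ^w`. Count polynomial degree in ghosts. The component `u^w` is linear in ghosts. Replacing a ghost
by its `𝐮`-component keeps the degree, while the action on fields, the action of `γ`, and anything
done to `γ^w` lead to degree at least two. The linear part of the identity therefore says that the
ghost part of `𝐮` annihilates `u^w`, which is the gauge symmetry condition (`uStage_u_eq_zero`).

By the definition of `η`, the component `u^w` is the sum over `r` of the formal adjoint of the
operator with coefficients `D_r^w`, applied to `c^r` (`u_eq`, `adjOp_eq_sum`). The condition thus
says that a composite of adjoints vanishes. To pass back to the operators themselves, multiply by a
ghost-free test element `φ` and take the variational derivative with respect to `c^r`. This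
derivative kills total derivatives (`euler_total`), so adjoints move onto the other factor
(`euler_adjOp_mul`), and it extracts the coefficient of `c^r` (`euler_gen_mul`). The result is
`linOp_linOp_eq_zero`: the composite of consecutive linear operators is zero off-shell. With the
antifields as `φ` this is the first Noether identity.

Now `δ_KT Δ_r = 0` loses its linear composite and becomes `linOp_h_add_deltaKT_h`. Only `δ̄` lowers
the degree in antifields, so the part of degree one of this equation is `δ̄ h⁽²⁾ = 0`
(`deltaBar_antiPart_h`).

For the reduction one needs `δ_KT ψ_r = h_r + ∑ D_r^{r',Λ} d_Λ ψ_{r'}`, whose right side is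
`defect`. By the vanishing of composites, `δ_KT` of the defect is the linear operator applied to the
errors of the preceding stage (`deltaKT_defect`). Once these errors vanish the defect is a cycle,
and the homology condition provides `ψ_r`. If only cycles over compact sets may be used, the defect
is first multiplied by a cutoff function, with which `δ_KT` commutes; each stage then holds over a
smaller open neighbourhood of the given compact set (`exists_reduction`). -/

open Classical in
/-- The coordinate direction of `c` in the space of the coordinates `S`. -/
def coordDir (S : Finset (Coord B)) (c : Coord B) : S → ℝ := fun s => if s.1 = c then 1 else 0

theorem exists_rep (f : Coef B) : ∃ (S : Finset (Coord B)) (g : (S → ℝ) → ℝ),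
    (∀ z : Jet B, f.1 z = g (S.restrict z.1)) ∧
      ContDiffOn ℝ ∞ g {w | ∃ z : Jet B, S.restrict z.1 = w} := f.2

/-- A common finite set of coordinates turns sum and product rules on the jet space into the rules
for `fderiv` in finite dimension. -/
theorem exists_rep₂ (f₁ f₂ : Coef B) : ∃ (S : Finset (Coord B)) (g₁ g₂ : (S → ℝ) → ℝ),
    (∀ z : Jet B, f₁.1 z = g₁ (S.restrict z.1)) ∧ (∀ z : Jet B, f₂.1 z = g₂ (S.restrict z.1)) ∧
      ContDiffOn ℝ ∞ g₁ {w | ∃ z : Jet B, S.restrict z.1 = w} ∧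
      ContDiffOn ℝ ∞ g₂ {w | ∃ z : Jet B, S.restrict z.1 = w} := by
  classical
  obtain ⟨S₁, g₁, e₁, c₁⟩ := exists_rep f₁
  obtain ⟨S₂, g₂, e₂, c₂⟩ := exists_rep f₂
  obtain ⟨g₁', e₁', c₁'⟩ := IsSmooth.mono (Finset.subset_union_left (s₁ := S₁) (s₂ := S₂)) e₁ c₁
  obtain ⟨g₂', e₂', c₂'⟩ := IsSmooth.mono (Finset.subset_union_right (s₁ := S₁) (s₂ := S₂)) e₂ c₂
  exact ⟨_, g₁', g₂', e₁', e₂', c₁', c₂'⟩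

theorem differentiableAt_rep {S : Finset (Coord B)} {g : (S → ℝ) → ℝ}
    (hg : ContDiffOn ℝ ∞ g {w | ∃ z : Jet B, S.restrict z.1 = w}) (z : Jet B) :
    DifferentiableAt ℝ g (S.restrict z.1) :=
  (hg.contDiffAt ((isOpen_proj S).mem_nhds ⟨z, rfl⟩)).differentiableAt (by simp)

theorem pdCoef_apply (c : Coord B) {f : Coef B} {S : Finset (Coord B)} {g : (S → ℝ) → ℝ}
    (hf : ∀ z : Jet B, f.1 z = g (S.restrict z.1))
    (hg : ContDiffOn ℝ ∞ g {w | ∃ z : Jet B, S.restrict z.1 = w}) (z : Jet B) :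
    (pdCoef c f).1 z = fderiv ℝ g (S.restrict z.1) (coordDir S c) :=
  pdFun_eq c hf hg z

theorem pdCoef_add (c : Coord B) (f₁ f₂ : Coef B) :
    pdCoef c (f₁ + f₂) = pdCoef c f₁ + pdCoef c f₂ := by
  obtain ⟨S, g₁, g₂, e₁, e₂, c₁, c₂⟩ := exists_rep₂ f₁ f₂
  refine Subtype.ext (funext fun z => ?_)
  have e : ∀ z : Jet B, (f₁ + f₂).1 z = (g₁ + g₂) (S.restrict z.1) := fun z => by
    simp [← e₁, ← e₂]
  rw [pdCoef_apply c e (c₁.add c₂), fderiv_add (differentiableAt_rep c₁ z)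
    (differentiableAt_rep c₂ z)]
  simp [pdCoef_apply c e₁ c₁, pdCoef_apply c e₂ c₂]

theorem pdCoef_mul (c : Coord B) (f₁ f₂ : Coef B) :
    pdCoef c (f₁ * f₂) = f₁ * pdCoef c f₂ + f₂ * pdCoef c f₁ := by
  obtain ⟨S, g₁, g₂, e₁, e₂, c₁, c₂⟩ := exists_rep₂ f₁ f₂
  refine Subtype.ext (funext fun z => ?_)
  have e : ∀ z : Jet B, (f₁ * f₂).1 z = (g₁ * g₂) (S.restrict z.1) := fun z => by
    simp [← e₁, ← e₂]
  rw [pdCoef_apply c e (c₁.mul c₂), fderiv_mul (differentiableAt_rep c₁ z)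
    (differentiableAt_rep c₂ z)]
  simp [pdCoef_apply c e₁ c₁, pdCoef_apply c e₂ c₂, e₁, e₂]

theorem pdCoef_algebraMap (c : Coord B) (r : ℝ) : pdCoef c (algebraMap ℝ (Coef B) r) = 0 := by
  refine Subtype.ext (funext fun z => ?_)
  rw [pdCoef_apply (S := ∅) (g := fun _ => r) c (fun _ => rfl) contDiffOn_const]
  simp

/-- The partial derivatives are derivations. -/
def pdDer (c : Coord B) : Derivation ℝ (Coef B) (Coef B) where
  toFun := pdCoef c
  map_add' := pdCoef_add c
  map_smul' r f := by
    simp [Algebra.smul_def, pdCoef_mul, pdCoef_algebraMap]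
  map_one_eq_zero' := by
    have := pdCoef_algebraMap (B := B) c 1
    rwa [map_one] at this
  leibniz' f₁ f₂ := by simp [pdCoef_mul]

/-- Coordinates outside a representing set give the zero direction. This makes the formally infinite
sums over jets finite. -/
theorem finite_pdCoef (f : Coef B) : {c | pdCoef c f ≠ 0}.Finite := by
  classical
  obtain ⟨S, g, e, h⟩ := exists_rep f
  refine S.finite_toSet.subset fun c hc => ?_
  by_contra hS
  refine hc (Subtype.ext (funext fun z => ?_))
  have : coordDir S c = 0 := by
    funext s
    simp only [coordDir, Pi.zero_apply, ite_eq_right_iff, one_ne_zero, imp_false]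
    rintro rfl
    exact hS s.2
  rw [pdCoef_apply c e h, this]
  simp

theorem pdCoef_comm (c c' : Coord B) (f : Coef B) :
    pdCoef c (pdCoef c' f) = pdCoef c' (pdCoef c f) := by
  obtain ⟨S, g, e, h⟩ := exists_rep f
  have hd (c : Coord B) : ContDiffOn ℝ ∞ (fun w => fderiv ℝ g w (coordDir S c))
      {w | ∃ z : Jet B, S.restrict z.1 = w} :=
    (h.fderiv_of_isOpen (isOpen_proj S) (by simp)).clm_apply contDiffOn_const
  refine Subtype.ext (funext fun z => ?_)
  have hz := (h.contDiffAt ((isOpen_proj S).mem_nhds ⟨z, rfl⟩))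
  have hs := hz.isSymmSndFDerivAt (by rw [minSmoothness_of_isRCLikeNormedField]; exact WithTop.coe_le_coe.2 le_top)
  have hdz : DifferentiableAt ℝ (fderiv ℝ g) (S.restrict z.1) :=
    (hz.fderiv_right (m := 1) (by norm_cast)).differentiableAt (by simp)
  rw [pdCoef_apply c (pdCoef_apply c' e h) (hd c'), pdCoef_apply c' (pdCoef_apply c e h) (hd c),
    fderiv_clm_apply hdz (differentiableAt_const _),
    fderiv_clm_apply hdz (differentiableAt_const _)]
  simpa using hs (coordDir S c) (coordDir S c')

open Classical in
theorem pdCoef_coordFun (c c' : Coord B) :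
    pdCoef c (coordFun c') = if c' = c then 1 else 0 := by
  refine Subtype.ext (funext fun z => ?_)
  let L : (({c'} : Finset (Coord B)) → ℝ) →L[ℝ] ℝ := ContinuousLinearMap.proj ⟨c', by simp⟩
  have e : ∀ z : Jet B, (coordFun c').1 z = L (Finset.restrict {c'} z.1) := fun z => rfl
  rw [pdCoef_apply c e L.contDiff.contDiffOn, L.fderiv]
  simp only [L, ContinuousLinearMap.proj_apply, coordDir]
  split_ifs <;> rfl

/-- Since `U` is open, a small change of one coordinate stays over `U`, so the function
differentiated is zero near the point. -/
theorem pdCoef_apply_eq_zero (c : Coord B) {f : Coef B}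
    {U : Set ((Fin B.n → ℝ) × (Fin B.m → ℝ))} (hU : IsOpen U)
    (hf : ∀ z : Jet B, base B z.1 ∈ U → f.1 z = 0) (z : Jet B) (hz : base B z.1 ∈ U) :
    (pdCoef c f).1 z = 0 := by
  classical
  have hu : Continuous fun t : ℝ => base B (Function.update z.1 c t) :=
    continuous_base.comp (continuous_const.update c continuous_id)
  have h1 := (B.V.isOpen.preimage hu).mem_nhds (x := z.1 c) (by simpa using z.2)
  have h2 := (hU.preimage hu).mem_nhds (x := z.1 c) (by simpa using hz)
  have hev : (fun t => Function.extend Subtype.val f.1 0 (Function.update z.1 c t))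
      =ᶠ[nhds (z.1 c)] fun _ => 0 := by
    filter_upwards [h1, h2] with t ht ht'
    rw [Subtype.val_injective.extend_apply f.1 0 (⟨Function.update z.1 c t, ht⟩ : Jet B)]
    exact hf _ ht'
  change deriv _ _ = 0
  rw [hev.deriv_eq]
  simp

theorem finite_totalCoef (l : Fin B.n) (f : Coef B) :
    (Function.support fun c : Fin B.m × MIdx B =>
      coordFun (.inr (c.1, c.2 + Finsupp.single l 1)) * pdCoef (.inr c) f).Finite := by
  refine ((finite_pdCoef f).preimage (f := Sum.inr) Sum.inr_injective.injOn).subset fun c hc => ?_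
  exact right_ne_zero_of_mul hc

theorem totalCoef_add (l : Fin B.n) (f₁ f₂ : Coef B) :
    totalCoef l (f₁ + f₂) = totalCoef l f₁ + totalCoef l f₂ := by
  simp only [totalCoef, pdCoef_add, mul_add]
  rw [finsum_add_distrib (finite_totalCoef l f₁) (finite_totalCoef l f₂)]
  ring

theorem totalCoef_eq_sum (l : Fin B.n) (f : Coef B) {s : Finset (Fin B.m × MIdx B)}
    (hs : ∀ c, pdCoef (.inr c) f ≠ 0 → c ∈ s) : totalCoef l f = pdCoef (.inl l) f +
      ∑ c ∈ s, coordFun (.inr (c.1, c.2 + Finsupp.single l 1)) * pdCoef (.inr c) f := by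
  rw [totalCoef, finsum_eq_sum_of_support_subset]
  exact fun c hc => hs c (right_ne_zero_of_mul hc)

theorem exists_finset_pdCoef (f : Coef B) : ∃ s : Finset (Fin B.m × MIdx B),
    ∀ c, pdCoef (.inr c) f ≠ 0 → c ∈ s := by
  have := (finite_pdCoef f).preimage (f := Sum.inr) Sum.inr_injective.injOn
  exact ⟨this.toFinset, fun c hc => by simpa using hc⟩

theorem totalCoef_mul (l : Fin B.n) (f₁ f₂ : Coef B) :
    totalCoef l (f₁ * f₂) = f₁ * totalCoef l f₂ + f₂ * totalCoef l f₁ := by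
  classical
  obtain ⟨s₁, h₁⟩ := exists_finset_pdCoef f₁
  obtain ⟨s₂, h₂⟩ := exists_finset_pdCoef f₂
  obtain ⟨s₃, h₃⟩ := exists_finset_pdCoef (f₁ * f₂)
  rw [totalCoef_eq_sum (s := s₁ ∪ s₂ ∪ s₃) l f₁ fun c hc => by simp [h₁ c hc],
    totalCoef_eq_sum (s := s₁ ∪ s₂ ∪ s₃) l f₂ fun c hc => by simp [h₂ c hc],
    totalCoef_eq_sum (s := s₁ ∪ s₂ ∪ s₃) l (f₁ * f₂) fun c hc => by simp [h₃ c hc]]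
  simp only [pdCoef_mul, mul_add, Finset.mul_sum, Finset.sum_add_distrib, mul_left_comm]
  ring

theorem totalCoef_algebraMap (l : Fin B.n) (r : ℝ) :
    totalCoef l (algebraMap ℝ (Coef B) r) = 0 := by
  simp [totalCoef, pdCoef_algebraMap]

/-- The total derivatives of smooth functions are derivations. -/
def totalDer (l : Fin B.n) : Derivation ℝ (Coef B) (Coef B) where
  toFun := totalCoef l
  map_add' := totalCoef_add l
  map_smul' r f := by
    simp [Algebra.smul_def, totalCoef_mul, totalCoef_algebraMap]
  map_one_eq_zero' := by
    have := totalCoef_algebraMap (B := B) l 1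
    rwa [map_one] at this
  leibniz' f₁ f₂ := by simp [totalCoef_mul]

theorem totalCoef_coordFun (l : Fin B.n) (c : Fin B.m × MIdx B) :
    totalCoef l (coordFun (.inr c)) = coordFun (.inr (c.1, c.2 + Finsupp.single l 1)) := by
  classical
  rw [totalCoef_eq_sum (s := {c})]
  · simp [pdCoef_coordFun]
  · intro c' hc'
    by_contra h
    rw [Finset.mem_singleton] at h
    exact hc' (by rw [pdCoef_coordFun, if_neg fun e => h (Sum.inr_injective e).symm])

theorem totalCoef_comm (l m : Fin B.n) (f : Coef B) :
    totalCoef l (totalCoef m f) = totalCoef m (totalCoef l f) := by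
  obtain ⟨s, hs⟩ := exists_finset_pdCoef f
  have key (l m : Fin B.n) : totalCoef l (totalCoef m f) =
      pdCoef (.inl l) (pdCoef (.inl m) f) +
      ∑ c ∈ s, coordFun (.inr (c.1, c.2 + Finsupp.single l 1)) *
        pdCoef (.inl m) (pdCoef (.inr c) f) +
      ∑ c ∈ s, coordFun (.inr (c.1, c.2 + Finsupp.single m 1)) *
        pdCoef (.inl l) (pdCoef (.inr c) f) +
      ∑ c ∈ s, coordFun (.inr (c.1, c.2 + Finsupp.single m 1 + Finsupp.single l 1)) *
        pdCoef (.inr c) f +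
      ∑ c ∈ s, ∑ c' ∈ s, coordFun (.inr (c.1, c.2 + Finsupp.single m 1)) *
        coordFun (.inr (c'.1, c'.2 + Finsupp.single l 1)) *
          pdCoef (.inr c') (pdCoef (.inr c) f) := by
    -- A coordinate on which `f` does not depend is also absent from its derivatives, so the one
    -- finite set `s` serves all sums.
    have h0 (c d : Coord B) (h : pdCoef c f = 0) : pdCoef c (pdCoef d f) = 0 := by
      rw [pdCoef_comm, h]; exact (pdDer d).map_zero
    rw [totalCoef_eq_sum m f hs]
    change totalDer l _ = _
    rw [map_add, map_sum]
    simp only [Derivation.leibniz, smul_eq_mul]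
    change totalCoef l _ + ∑ c ∈ s, (_ * totalCoef l _ + _ * totalCoef l _) = _
    simp only [totalCoef_coordFun]
    rw [totalCoef_eq_sum (s := s) l (pdCoef (.inl m) f) fun c hc => hs c fun h => hc (h0 _ _ h)]
    have h1 (c : Fin B.m × MIdx B) := totalCoef_eq_sum (s := s) l (pdCoef (.inr c) f)
      fun c' hc => hs c' fun h => hc (h0 _ _ h)
    simp only [h1, mul_add, Finset.sum_add_distrib, Finset.mul_sum, mul_assoc]
    simp only [pdCoef_comm (.inl m), mul_comm (pdCoef _ f)]
    abel
  rw [key l m, key m l, Finset.sum_comm (s := s) (t := s), pdCoef_comm (.inl l)]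
  simp only [pdCoef_comm (.inr _) (.inr _)]
  have h2 : ∀ c : Fin B.m × MIdx B, c.2 + Finsupp.single m 1 + Finsupp.single l 1 =
      c.2 + Finsupp.single l 1 + Finsupp.single m 1 := fun c => add_right_comm _ _ _
  simp only [h2]
  rw [add_right_comm (pdCoef (.inl m) (pdCoef (.inl l) f))]
  congr 1
  refine Finset.sum_congr rfl fun c _ => Finset.sum_congr rfl fun c' _ => ?_
  rw [pdCoef_comm (.inr c)]; ring

theorem totalCoef_apply_eq_zero (l : Fin B.n) {f : Coef B}
    {U : Set ((Fin B.n → ℝ) × (Fin B.m → ℝ))} (hU : IsOpen U)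
    (hf : ∀ z : Jet B, base B z.1 ∈ U → f.1 z = 0) (z : Jet B) (hz : base B z.1 ∈ U) :
    (totalCoef l f).1 z = 0 := by
  obtain ⟨s, hs⟩ := exists_finset_pdCoef f
  rw [totalCoef_eq_sum l f hs]
  have h : ∀ c, (pdCoef c f : Jet B → ℝ) z = 0 :=
    fun c => pdCoef_apply_eq_zero c hU hf z hz
  simp [h]

/-! ### The graded algebra -/

theorem term_zero (α : Gen B →₀ ℕ) : term α (0 : Coef B) = 0 := rawTerm_zero α

theorem term_add (α : Gen B →₀ ℕ) (a b : Coef B) : term α (a + b) = term α a + term α b :=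
  rawTerm_add α a b

theorem term_eq_zero {α : Gen B →₀ ℕ} (h : ¬ ∀ g, IsOddGen g → α g ≤ 1) (a : Coef B) :
    term α a = 0 := rawTerm_eq_zero h a

/-- `term α` as an additive map. -/
def termHom (α : Gen B →₀ ℕ) : Coef B →+ Alg B where
  toFun := term α
  map_zero' := term_zero α
  map_add' := term_add α

theorem raw_term (α : Mon B) (a : Coef B) : (term α.1 a).raw = Finsupp.single α a :=
  rawTerm_mon α a

theorem term_mul (α β : Gen B →₀ ℕ) (a b : Coef B) : term α a * term β b =
    term (α + β) ((-1) ^ inversions α β * (a * b)) := rawMul_term α β a b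

theorem term_induction {P : Alg B → Prop} (f : Alg B) (h0 : P 0)
    (hadd : ∀ f g, P f → P g → P (f + g))
    (hterm : ∀ (α : Mon B) (a : Coef B), P (term α.1 a)) : P f :=
  raw_induction f h0 hadd hterm

/-- The inclusion of the smooth functions. -/
def coef (a : Coef B) : Alg B := term 0 a

theorem inversions_zero_left (β : Gen B →₀ ℕ) : inversions 0 β = 0 := by simp [inversions]

theorem inversions_zero_right (α : Gen B →₀ ℕ) : inversions α 0 = 0 := by simp [inversions]

theorem coef_mul_term (a : Coef B) (β : Gen B →₀ ℕ) (b : Coef B) :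
    coef a * term β b = term β (a * b) := by
  simp [coef, term_mul, inversions_zero_left]

theorem term_mul_coef (a : Coef B) (β : Gen B →₀ ℕ) (b : Coef B) :
    term β b * coef a = term β (a * b) := by
  simp [coef, term_mul, inversions_zero_right, mul_comm]

theorem coef_comm (a : Coef B) (f : Alg B) : coef a * f = f * coef a := by
  induction f using term_induction with
  | h0 => simp
  | hadd f g hf hg => simp [mul_add, add_mul, hf, hg]
  | hterm α a => rw [coef_mul_term, term_mul_coef]

theorem gen_mul_term (g : Gen B) (β : Gen B →₀ ℕ) (b : Coef B) : gen g * term β b =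
    term (Finsupp.single g 1 + β) ((-1) ^ inversions (Finsupp.single g 1) β * b) := by
  simp [gen, term_mul]

theorem gen_mul_gen_eq_term (g h : Gen B) : gen g * gen h =
    term (Finsupp.single g 1 + Finsupp.single h 1)
      ((-1) ^ inversions (Finsupp.single g 1) (Finsupp.single h 1) * 1) := gen_mul_term g _ 1

theorem term_mul_gen (g : Gen B) (β : Gen B →₀ ℕ) (b : Coef B) : term β b * gen g =
    term (β + Finsupp.single g 1) ((-1) ^ inversions β (Finsupp.single g 1) * b) := by
  simp [gen, term_mul]

theorem neg_one_pow_mul_self (n : ℕ) (a : Coef B) : (-1) ^ n * ((-1) ^ n * a) = a := by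
  rcases neg_one_pow_eq_or (Coef B) n with h | h <;> rw [h] <;> ring

/-- Every graded function is obtained from smooth functions by sums and left multiplication by
generators. -/
theorem gen_induction {P : Alg B → Prop} (f : Alg B) (hadd : ∀ f g, P f → P g → P (f + g))
    (hcoef : ∀ a, P (coef a)) (hgen : ∀ g f, P f → P (gen g * f)) : P f := by
  have key : ∀ (n : ℕ) (α : Gen B →₀ ℕ), α.degree = n → ∀ a, P (term α a) := by
    intro n
    induction n with
    | zero =>
      intro α hα a
      rw [Finsupp.degree_eq_zero_iff] at hα
      exact hα ▸ hcoef a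
    | succ n ih =>
      intro α hα a
      have h0 : α ≠ 0 := by rintro rfl; simp at hα
      obtain ⟨g, hg⟩ := Finsupp.ne_iff.1 h0
      have h1 : Finsupp.single g 1 ≤ α := by
        rw [Finsupp.single_le_iff]; exact Nat.one_le_iff_ne_zero.2 hg
      have h2 : Finsupp.single g 1 + (α - Finsupp.single g 1) = α := add_tsub_cancel_of_le h1
      have h3 : (α - Finsupp.single g 1).degree = n := by
        rw [← h2, map_add, Finsupp.degree_single] at hα; omega
      -- The sign of moving `g` into its ordered place is put into the coefficient and cancels in
      -- the product.
      have := hgen g _ (ih _ h3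
        ((-1) ^ inversions (Finsupp.single g 1) (α - Finsupp.single g 1) * a))
      rwa [gen_mul_term, h2, neg_one_pow_mul_self] at this
  have h0 : P 0 := by simpa [coef, term_zero] using hcoef 0
  exact term_induction f h0 hadd fun α a => key _ α.1 rfl a

/-- Every graded function is obtained from smooth functions by sums and right multiplication by
generators. -/
theorem gen_induction_right {P : Alg B → Prop} (f : Alg B)
    (hadd : ∀ f g, P f → P g → P (f + g))
    (hcoef : ∀ a, P (coef a)) (hgen : ∀ g f, P f → P (f * gen g)) : P f := by
  have key : ∀ (n : ℕ) (α : Gen B →₀ ℕ), α.degree = n → ∀ a, P (term α a) := by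
    intro n
    induction n with
    | zero =>
      intro α hα a
      rw [Finsupp.degree_eq_zero_iff] at hα
      exact hα ▸ hcoef a
    | succ n ih =>
      intro α hα a
      have h0 : α ≠ 0 := by rintro rfl; simp at hα
      obtain ⟨g, hg⟩ := Finsupp.ne_iff.1 h0
      have h1 : Finsupp.single g 1 ≤ α := by
        rw [Finsupp.single_le_iff]; exact Nat.one_le_iff_ne_zero.2 hg
      have h2 : (α - Finsupp.single g 1) + Finsupp.single g 1 = α := tsub_add_cancel_of_le h1
      have h3 : (α - Finsupp.single g 1).degree = n := by
        rw [← h2, map_add, Finsupp.degree_single] at hα; omega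
      have := hgen g _ (ih _ h3
        ((-1) ^ inversions (α - Finsupp.single g 1) (Finsupp.single g 1) * a))
      rwa [term_mul_gen, h2, neg_one_pow_mul_self] at this
  have h0 : P 0 := by simpa [coef, term_zero] using hcoef 0
  exact term_induction f h0 hadd fun α a => key _ α.1 rfl a

open Classical in
/-- The sign of the transposition of two generators. -/
def swapSign (g h : Gen B) : ℤ := if IsOddGen g ∧ IsOddGen h then -1 else 1

theorem swapSign_comm (g h : Gen B) : swapSign g h = swapSign h g := by
  by_cases hg : IsOddGen g <;> by_cases hh : IsOddGen h <;> simp [swapSign, hg, hh]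

theorem swapSign_mul_self (g h : Gen B) : swapSign g h * swapSign g h = 1 := by
  unfold swapSign; split_ifs <;> rfl

/-- Of the two orders of two distinct odd generators exactly one is an inversion. -/
theorem neg_one_pow_inversions {g h : Gen B} (hgh : g ≠ h) :
    (-1 : Coef B) ^ inversions (Finsupp.single g 1) (Finsupp.single h 1) =
      (swapSign g h : Coef B) *
        (-1) ^ inversions (Finsupp.single h 1) (Finsupp.single g 1) := by
  classical
  have e (g h : Gen B) : inversions (Finsupp.single g 1) (Finsupp.single h 1) =
      if IsOddGen g ∧ IsOddGen h ∧ WellOrderingRel h g then 1 else 0 := by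
    simp [inversions]
  rw [e, e]
  unfold swapSign
  by_cases hg : IsOddGen g <;> by_cases hh : IsOddGen h <;> simp only [hg, hh, true_and,
    false_and, and_false, and_true, and_self, if_true, if_false]
  · rcases trichotomous_of (WellOrderingRel (α := Gen B)) g h with h1 | h1 | h1
    · have h2 := asymm_of WellOrderingRel h1
      rw [if_neg h2, if_pos h1]; norm_num
    · exact absurd h1 hgh
    · have h2 := asymm_of WellOrderingRel h1
      rw [if_neg h2, if_pos h1]; norm_num
  all_goals simp

theorem term_intCast_mul (α : Gen B →₀ ℕ) (k : ℤ) (a : Coef B) :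
    term α ((k : Coef B) * a) = k • term α a := by
  rw [← zsmul_eq_mul]; exact (termHom α).map_zsmul k a

theorem gen_mul_gen (g h : Gen B) : gen g * gen h = swapSign g h • (gen h * gen g) := by
  by_cases hgh : g = h
  · subst hgh
    by_cases hg : IsOddGen g
    · have : gen g * gen g = 0 := by
        rw [gen_mul_gen_eq_term, term_eq_zero]
        intro H
        have := H g hg
        simp at this
      simp [this]
    · simp [swapSign, hg]
  · rw [gen_mul_gen_eq_term, gen_mul_gen_eq_term, neg_one_pow_inversions hgh,
      mul_assoc, term_intCast_mul, add_comm]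

/-! ### Derivatives with respect to generators -/

/-- `pdL` as an additive map. -/
def pdLHom (g : Gen B) : Alg B →+ Alg B where
  toFun := pdL g
  map_zero' := by simp [pdL]
  map_add' f h := by
    unfold pdL
    rw [map_add]
    refine Finsupp.sum_add_index' (fun α => by simp [term_zero]) fun α a b => ?_
    rw [← term_add]; congr 1; ring

/-- `pdR` as an additive map. -/
def pdRHom (g : Gen B) : Alg B →+ Alg B where
  toFun := pdR g
  map_zero' := by simp [pdR]
  map_add' f h := by
    unfold pdR
    rw [map_add]
    refine Finsupp.sum_add_index' (fun α => by simp [term_zero]) fun α a b => ?_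
    rw [← term_add]; congr 1; ring

theorem pdL_add (g : Gen B) (f h : Alg B) : pdL g (f + h) = pdL g f + pdL g h :=
  (pdLHom g).map_add f h

theorem pdR_add (g : Gen B) (f h : Alg B) : pdR g (f + h) = pdR g f + pdR g h :=
  (pdRHom g).map_add f h

theorem pdL_zero (g : Gen B) : pdL g (0 : Alg B) = 0 := (pdLHom g).map_zero

theorem pdR_zero (g : Gen B) : pdR g (0 : Alg B) = 0 := (pdRHom g).map_zero

theorem pdL_term (g : Gen B) {α : Gen B →₀ ℕ} (h : ∀ g, IsOddGen g → α g ≤ 1) (a : Coef B) :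
    pdL g (term α a) = term (α - Finsupp.single g 1) ((α g : Coef B) *
      ((-1) ^ inversions (Finsupp.single g 1) (α - Finsupp.single g 1) * a)) := by
  have := raw_term ⟨α, h⟩ a
  simp only at this
  rw [pdL, this, Finsupp.sum_single_index]
  simp [term_zero]

theorem pdR_term (g : Gen B) {α : Gen B →₀ ℕ} (h : ∀ g, IsOddGen g → α g ≤ 1) (a : Coef B) :
    pdR g (term α a) = term (α - Finsupp.single g 1) ((α g : Coef B) *
      ((-1) ^ inversions (α - Finsupp.single g 1) (Finsupp.single g 1) * a)) := by
  have := raw_term ⟨α, h⟩ a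
  simp only at this
  rw [pdR, this, Finsupp.sum_single_index]
  simp [term_zero]

theorem pdL_coef (g : Gen B) (a : Coef B) : pdL g (coef a) = 0 := by
  rw [coef, pdL_term g (by simp)]; simp [term_zero]

theorem pdR_coef (g : Gen B) (a : Coef B) : pdR g (coef a) = 0 := by
  rw [coef, pdR_term g (by simp)]; simp [term_zero]

theorem single_add_admissible {h : Gen B} {β : Gen B →₀ ℕ} (hβ : ∀ g, IsOddGen g → β g ≤ 1) :
    (∀ g, IsOddGen g → (Finsupp.single h 1 + β : Gen B →₀ ℕ) g ≤ 1) ↔ (IsOddGen h → β h = 0) := by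
  classical
  constructor
  · intro H hh
    have := H h hh
    simp at this; omega
  · intro H g hg
    by_cases e : h = g
    · subst e; simp [H hg]
    · simpa [Finsupp.single_apply, e] using hβ g hg

open Classical in
-- This graded Leibniz rule for one generator is the only place where the signs of monomials have to
-- be matched for left derivatives; with `gen_induction` it yields the commutation rules.
theorem pdL_gen_mul (g h : Gen B) (f : Alg B) : pdL g (gen h * f) =
    (if g = h then f else 0) + swapSign g h • (gen h * pdL g f) := by
  induction f using term_induction with
  | h0 => simp [pdL_zero]
  | hadd f f' hf hf' =>
    rw [mul_add, pdL_add, hf, hf', pdL_add, mul_add, smul_add]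
    split_ifs <;> abel
  | hterm β b =>
    obtain ⟨β, hβ⟩ := β
    simp only
    rw [pdL_term g hβ, gen_mul_term, gen_mul_term]
    by_cases H : IsOddGen h → β h = 0
    · rw [pdL_term g ((single_add_admissible hβ).2 H)]
      by_cases e : g = h
      · subst e
        rw [if_pos rfl, add_tsub_cancel_left, neg_one_pow_mul_self]
        by_cases hg : β g = 0
        · simp [hg, term_zero]
        · have ho : ¬ IsOddGen g := fun ho => hg (H ho)
          have hl : Finsupp.single g 1 ≤ β := by
            rw [Finsupp.single_le_iff]; exact Nat.one_le_iff_ne_zero.2 hg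
          have : swapSign g g = 1 := by simp [swapSign, ho]
          rw [this, one_smul, add_tsub_cancel_of_le hl, mul_left_comm ((-1) ^ _) (β g : Coef B),
            neg_one_pow_mul_self, ← term_add]
          congr 1
          simp [add_mul]
      · rw [if_neg e, zero_add]
        have hc : (Finsupp.single h 1 + β : Gen B →₀ ℕ) g = β g := by simp [Finsupp.single_apply, Ne.symm e]
        rw [hc]
        by_cases hg : β g = 0
        · simp [hg, term_zero]
        · have hl : Finsupp.single g 1 ≤ β := by
            rw [Finsupp.single_le_iff]; exact Nat.one_le_iff_ne_zero.2 hg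
          rw [add_tsub_assoc_of_le hl, ← term_intCast_mul]
          congr 1
          have h2 : inversions (Finsupp.single h 1) β =
              inversions (Finsupp.single h 1) (β - Finsupp.single g 1) +
              inversions (Finsupp.single h 1) (Finsupp.single g 1) := by
            rw [← inversions_add_right, tsub_add_cancel_of_le hl]
          rw [h2, inversions_add_right, pow_add, pow_add, neg_one_pow_inversions e]
          have h3 := neg_one_pow_mul_self (B := B)
            (inversions (Finsupp.single h 1) (Finsupp.single g 1)) 1
          linear_combination (β g : Coef B) * (swapSign g h : Coef B) *
            (-1) ^ inversions (Finsupp.single g 1) (β - Finsupp.single g 1) *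
            (-1) ^ inversions (Finsupp.single h 1) (β - Finsupp.single g 1) * b * h3
    -- The odd generator `h` already occurs, so the product is zero. On the right, the two terms
    -- cancel if `g = h`; otherwise the remaining term still repeats `h`.
    · rw [term_eq_zero (fun h' => H ((single_add_admissible hβ).1 h')), pdL_zero]
      push Not at H
      obtain ⟨ho, hh⟩ := H
      have h1 : β h = 1 := le_antisymm (hβ h ho) (Nat.one_le_iff_ne_zero.2 hh)
      by_cases e : g = h
      · subst e
        have hl : Finsupp.single g 1 ≤ β := by
          rw [Finsupp.single_le_iff]; exact h1.ge
        rw [if_pos rfl, add_tsub_cancel_of_le hl, h1, Nat.cast_one, one_mul,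
          neg_one_pow_mul_self]
        simp [swapSign, ho]
      · rw [if_neg e, term_eq_zero, smul_zero, zero_add]
        intro H
        have := H h ho
        simp [h1, Finsupp.single_apply, e] at this

open Classical in
theorem pdR_mul_gen (g h : Gen B) (f : Alg B) : pdR g (f * gen h) =
    (if g = h then f else 0) + swapSign g h • (pdR g f * gen h) := by
  induction f using term_induction with
  | h0 => simp [pdR_zero]
  | hadd f f' hf hf' =>
    rw [add_mul, pdR_add, hf, hf', pdR_add, add_mul, smul_add]
    split_ifs <;> abel
  | hterm β b =>
    obtain ⟨β, hβ⟩ := β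
    simp only
    rw [pdR_term g hβ, term_mul_gen, term_mul_gen, add_comm β]
    by_cases H : IsOddGen h → β h = 0
    · rw [pdR_term g ((single_add_admissible hβ).2 H)]
      by_cases e : g = h
      · subst e
        rw [if_pos rfl, add_tsub_cancel_left, neg_one_pow_mul_self]
        by_cases hg : β g = 0
        · simp [hg, term_zero]
        · have ho : ¬ IsOddGen g := fun ho => hg (H ho)
          have hl : Finsupp.single g 1 ≤ β := by
            rw [Finsupp.single_le_iff]; exact Nat.one_le_iff_ne_zero.2 hg
          have : swapSign g g = 1 := by simp [swapSign, ho]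
          rw [this, one_smul, tsub_add_cancel_of_le hl, mul_left_comm ((-1) ^ _) (β g : Coef B),
            neg_one_pow_mul_self, ← term_add]
          congr 1
          simp [add_mul]
      · rw [if_neg e, zero_add]
        have hc : (Finsupp.single h 1 + β : Gen B →₀ ℕ) g = β g := by simp [Finsupp.single_apply, Ne.symm e]
        rw [hc]
        by_cases hg : β g = 0
        · simp [hg, term_zero]
        · have hl : Finsupp.single g 1 ≤ β := by
            rw [Finsupp.single_le_iff]; exact Nat.one_le_iff_ne_zero.2 hg
          rw [add_tsub_assoc_of_le hl, ← term_intCast_mul, add_comm (Finsupp.single h 1)]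
          congr 1
          have h2 : inversions β (Finsupp.single h 1) =
              inversions (β - Finsupp.single g 1) (Finsupp.single h 1) +
              inversions (Finsupp.single g 1) (Finsupp.single h 1) := by
            rw [← inversions_add_left, tsub_add_cancel_of_le hl]
          rw [h2, inversions_add_left, pow_add, pow_add, neg_one_pow_inversions e]
          have h3 := neg_one_pow_mul_self (B := B)
            (inversions (Finsupp.single h 1) (Finsupp.single g 1)) 1
          linear_combination (β g : Coef B) * (swapSign g h : Coef B) *
            (-1) ^ inversions (β - Finsupp.single g 1) (Finsupp.single g 1) *
            (-1) ^ inversions (β - Finsupp.single g 1) (Finsupp.single h 1) * b * h3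
    · rw [term_eq_zero (fun h' => H ((single_add_admissible hβ).1 h')), pdR_zero]
      push Not at H
      obtain ⟨ho, hh⟩ := H
      have h1 : β h = 1 := le_antisymm (hβ h ho) (Nat.one_le_iff_ne_zero.2 hh)
      by_cases e : g = h
      · subst e
        have hl : Finsupp.single g 1 ≤ β := by
          rw [Finsupp.single_le_iff]; exact h1.ge
        rw [if_pos rfl, tsub_add_cancel_of_le hl, h1, Nat.cast_one, one_mul,
          neg_one_pow_mul_self]
        simp [swapSign, ho]
      · rw [if_neg e, term_eq_zero, smul_zero, zero_add]
        intro H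
        have := H h ho
        simp [h1, Finsupp.single_apply, e] at this

theorem pdL_coef_mul (g : Gen B) (a : Coef B) (f : Alg B) :
    pdL g (coef a * f) = coef a * pdL g f := by
  induction f using term_induction with
  | h0 => simp [pdL_zero]
  | hadd f f' hf hf' => simp only [mul_add, pdL_add, hf, hf']
  | hterm β b =>
    rw [coef_mul_term, pdL_term g β.2, pdL_term g β.2, coef_mul_term]
    congr 1; ring

/-- A right derivative meets the right factor first, so the surviving term has no sign, whatever the
parity of `a`. This is why `δ_KT` is linear over functions of the fields placed on the left. -/
theorem pdR_mul_of_eq_zero {g : Gen B} {a : Alg B} (ha : pdR g a = 0) (f : Alg B) :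
    pdR g (a * f) = a * pdR g f := by
  classical
  induction f using gen_induction_right with
  | hadd f f' hf hf' => simp only [mul_add, pdR_add, hf, hf']
  | hcoef b =>
    have : ∀ (a : Alg B), pdR g (a * coef b) = pdR g a * coef b := by
      intro a
      induction a using term_induction with
      | h0 => simp [pdR_zero]
      | hadd f f' hf hf' => simp only [add_mul, pdR_add, hf, hf']
      | hterm β c =>
        rw [term_mul_coef, pdR_term g β.2, pdR_term g β.2, term_mul_coef]
        congr 1; ring
    rw [this, ha, pdR_coef]; simp
  | hgen h f hf =>
    rw [← mul_assoc, pdR_mul_gen, hf, pdR_mul_gen, mul_add, mul_smul_comm, mul_assoc]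
    split_ifs <;> simp

theorem finite_pdL (f : Alg B) : {g | pdL g f ≠ 0}.Finite := by
  induction f using term_induction with
  | h0 => simp [pdL_zero]
  | hadd f f' hf hf' =>
    refine (hf.union hf').subset fun g hg => ?_
    by_contra h
    simp only [Set.mem_union, Set.mem_ofPred_eq, not_or, not_not] at h
    exact hg (by rw [pdL_add, h.1, h.2, add_zero])
  | hterm α a =>
    refine α.1.support.finite_toSet.subset fun g hg => ?_
    by_contra h
    have : α.1 g = 0 := by simpa using h
    exact hg (by simp [pdL_term g α.2, this, term_zero])

theorem finite_pdR (f : Alg B) : {g | pdR g f ≠ 0}.Finite := by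
  induction f using term_induction with
  | h0 => simp [pdR_zero]
  | hadd f f' hf hf' =>
    refine (hf.union hf').subset fun g hg => ?_
    by_contra h
    simp only [Set.mem_union, Set.mem_ofPred_eq, not_or, not_not] at h
    exact hg (by rw [pdR_add, h.1, h.2, add_zero])
  | hterm α a =>
    refine α.1.support.finite_toSet.subset fun g hg => ?_
    by_contra h
    have : α.1 g = 0 := by simpa using h
    exact hg (by simp [pdR_term g α.2, this, term_zero])

/-! ### Total derivatives -/

/-- The multi-index `l`. -/
abbrev unitIdx (l : Fin B.n) : MIdx B := Finsupp.single l 1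

/-- The total derivative of a generator. -/
abbrev shiftGen (l : Fin B.n) (g : Gen B) : Gen B := (g.1, g.2 + Finsupp.single l 1)

theorem swapSign_shiftGen (l : Fin B.n) (g h : Gen B) :
    swapSign (shiftGen l g) h = swapSign g h := by
  by_cases hg : IsOddGen g <;> by_cases hh : IsOddGen h <;> rfl

/-- The total derivative of the coefficients. -/
def totalBase (l : Fin B.n) : Alg B →+ Alg B where
  toFun f := f.raw.sum fun α a => term α.1 (totalCoef l a)
  map_zero' := by simp
  map_add' f h := by
    rw [map_add]
    refine Finsupp.sum_add_index' (fun α => ?_) fun α a b => ?_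
    · rw [show totalCoef l (0 : Coef B) = 0 from (totalDer l).map_zero, term_zero]
    · rw [totalCoef_add, term_add]

theorem totalBase_term (l : Fin B.n) (α : Mon B) (a : Coef B) :
    totalBase l (term α.1 a) = term α.1 (totalCoef l a) := by
  change (term α.1 a).raw.sum (fun α a => term α.1 (totalCoef l a)) = _
  rw [raw_term, Finsupp.sum_single_index]
  rw [show totalCoef l (0 : Coef B) = 0 from (totalDer l).map_zero, term_zero]

theorem totalBase_term' (l : Fin B.n) (α : Gen B →₀ ℕ) (a : Coef B) :
    totalBase l (term α a) = term α (totalCoef l a) := by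
  by_cases h : ∀ g, IsOddGen g → α g ≤ 1
  · exact totalBase_term l ⟨α, h⟩ a
  · rw [term_eq_zero h, term_eq_zero h, map_zero]

theorem totalBase_gen_mul (l : Fin B.n) (g : Gen B) (f : Alg B) :
    totalBase l (gen g * f) = gen g * totalBase l f := by
  induction f using term_induction with
  | h0 => simp
  | hadd f f' hf hf' => simp only [mul_add, map_add, hf, hf']
  | hterm α a =>
    rw [gen_mul_term, totalBase_term', totalBase_term, gen_mul_term]
    congr 1
    rcases neg_one_pow_eq_or (Coef B) (inversions (Finsupp.single g 1) α.1) with h | h <;> rw [h]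
    · simp
    · rw [neg_one_mul, neg_one_mul]; exact (totalDer l).map_neg a

theorem totalBase_coef_mul (l : Fin B.n) (b : Coef B) (f : Alg B) :
    totalBase l (coef b * f) = coef (totalCoef l b) * f + coef b * totalBase l f := by
  induction f using term_induction with
  | h0 => simp
  | hadd f f' hf hf' => simp only [mul_add, map_add, hf, hf']; abel
  | hterm α a =>
    rw [coef_mul_term, totalBase_term, totalBase_term, coef_mul_term, coef_mul_term, ← term_add,
      totalCoef_mul]
    congr 1; ring

theorem finite_shift_pdL (l : Fin B.n) (f : Alg B) :
    (Function.support fun g : Gen B => gen (shiftGen l g) * pdL g f).Finite :=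
  (finite_pdL f).subset fun _ hg => right_ne_zero_of_mul hg

theorem eq_sum_term (f : Alg B) : f = f.raw.sum fun α a => term α.1 a := by
  have h : ∀ (α : Mon B) (a : Coef B), Finsupp.single α a = (term α.1 a).raw :=
    fun α a => (raw_term α a).symm
  have := (Finsupp.sum_single f.raw).symm
  simp only [Finsupp.sum, h] at this
  rw [← map_sum] at this
  exact Alg.raw.injective this

/-- The sum over the support of each monomial may be taken over all generators at once, since
derivatives with respect to absent generators vanish. In this form additivity and the Leibniz rule
can be read off. -/
theorem total_eq (l : Fin B.n) (f : Alg B) :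
    total l f = totalBase l f + ∑ᶠ g, gen (shiftGen l g) * pdL g f := by
  have h1 : total l f = totalBase l f + f.raw.sum fun α a =>
      ∑ g ∈ α.1.support, gen (shiftGen l g) * pdL g (term α.1 a) := Finsupp.sum_add
  have h2 (α : Mon B) (a : Coef B) :
      ∑ g ∈ α.1.support, gen (shiftGen l g) * pdL g (term α.1 a) =
        ∑ᶠ g, gen (shiftGen l g) * pdL g (term α.1 a) := by
    rw [finsum_eq_sum_of_support_subset]
    intro g hg
    by_contra h
    have : α.1 g = 0 := by simpa using h
    exact hg (by simp [pdL_term g α.2, this, term_zero])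
  have h3 := eq_sum_term f
  rw [h1]
  congr 1
  simp only [h2]
  conv_rhs => rw [h3]
  rw [Finsupp.sum, Finsupp.sum, ← finsum_sum_comm _ _ fun α _ => finite_shift_pdL l _]
  refine finsum_congr fun g => ?_
  rw [← Finset.mul_sum]
  exact congrArg _ (map_sum (pdLHom g) _ _).symm

/-- `total` as an additive map. -/
def totalHom (l : Fin B.n) : Alg B →+ Alg B where
  toFun := total l
  map_zero' := by simp [total]
  map_add' f h := by
    simp only [total_eq, map_add, pdL_add, mul_add]
    rw [finsum_add_distrib (finite_shift_pdL l f) (finite_shift_pdL l h)]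
    abel

theorem total_add (l : Fin B.n) (f h : Alg B) : total l (f + h) = total l f + total l h :=
  (totalHom l).map_add f h

theorem total_zero (l : Fin B.n) : total l (0 : Alg B) = 0 := (totalHom l).map_zero

theorem total_zsmul (l : Fin B.n) (k : ℤ) (f : Alg B) : total l (k • f) = k • total l f :=
  (totalHom l).map_zsmul k f

theorem total_coef (l : Fin B.n) (a : Coef B) : total l (coef a) = coef (totalCoef l a) := by
  rw [total_eq, coef, totalBase_term', ← coef, ← coef]
  simp [pdL_coef]

theorem total_gen_mul (l : Fin B.n) (h : Gen B) (f : Alg B) :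
    total l (gen h * f) = gen (shiftGen l h) * f + gen h * total l f := by
  classical
  have e (g : Gen B) : gen (shiftGen l g) * pdL g (gen h * f) =
      (if g = h then gen (shiftGen l h) * f else 0) +
        gen h * (gen (shiftGen l g) * pdL g f) := by
    rw [pdL_gen_mul, mul_add]
    congr 1
    · split_ifs with e
      · rw [e]
      · simp
    -- Moving the derivative past `h` and moving the shifted generator past `h` cost the same sign,
    -- because a jet shift keeps the parity. The total derivative is hence an even derivation.
    · rw [mul_smul_comm, ← mul_assoc, ← mul_assoc, gen_mul_gen, swapSign_shiftGen,
        smul_mul_assoc, smul_smul, swapSign_mul_self, one_smul]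
  rw [total_eq, total_eq, totalBase_gen_mul, finsum_congr e, finsum_add_distrib, finsum_eq_single
    _ h, if_pos rfl, ← mul_finsum' _ _ (finite_shift_pdL l f), mul_add]
  · abel
  · exact fun g hg => if_neg hg
  · exact (Set.finite_singleton h).subset fun g hg => by
      by_contra hne
      exact hg (if_neg hne)
  · exact (finite_shift_pdL l f).subset fun g hg => right_ne_zero_of_mul hg

theorem total_coef_mul (l : Fin B.n) (a : Coef B) (f : Alg B) :
    total l (coef a * f) = coef (totalCoef l a) * f + coef a * total l f := by
  have e (g : Gen B) : gen (shiftGen l g) * pdL g (coef a * f) =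
      coef a * (gen (shiftGen l g) * pdL g f) := by
    rw [pdL_coef_mul, ← mul_assoc, ← coef_comm, mul_assoc]
  rw [total_eq, total_eq, totalBase_coef_mul, finsum_congr e,
    ← mul_finsum' _ _ (finite_shift_pdL l f), mul_add]
  abel

theorem total_mul (l : Fin B.n) (f h : Alg B) :
    total l (f * h) = total l f * h + f * total l h := by
  induction f using gen_induction with
  | hadd f f' hf hf' => simp only [add_mul, total_add, hf, hf']; abel
  | hcoef a => rw [total_coef_mul, total_coef]
  | hgen g f hf =>
    rw [mul_assoc, total_gen_mul, total_gen_mul, hf, add_mul, mul_add]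
    simp only [mul_assoc]; abel

theorem gen_eq_mul_one (g : Gen B) : gen g = gen g * coef 1 := by
  rw [← coef_comm, gen, coef_mul_term, one_mul]

theorem total_gen (l : Fin B.n) (g : Gen B) : total l (gen g) = gen (shiftGen l g) := by
  have h : totalCoef l (1 : Coef B) = 0 := (totalDer l).map_one_eq_zero
  rw [gen_eq_mul_one, total_gen_mul, total_coef, h, show coef (0 : Coef B) = 0 from term_zero 0, mul_zero, add_zero,
    ← gen_eq_mul_one]

theorem total_comm (l m : Fin B.n) (f : Alg B) : total l (total m f) = total m (total l f) := by
  induction f using gen_induction with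
  | hadd f f' hf hf' => simp only [total_add, hf, hf']
  | hcoef a => simp only [total_coef, totalCoef_comm l m]
  | hgen g f hf =>
    have : shiftGen l (shiftGen m g) = shiftGen m (shiftGen l g) := by
      simp only [shiftGen, add_right_comm]
    simp only [total_gen_mul, total_add, hf, this]; abel

open Classical in
-- The extra term comes from `g_{Λ-l}`, whose total derivative is `g_Λ`. This commutator is what
-- makes the variational derivative kill total derivatives.
theorem pdL_total (l : Fin B.n) (k : GKind B) (Λ : MIdx B) (f : Alg B) :
    pdL (k, Λ) (total l f) = total l (pdL (k, Λ) f) +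
      if unitIdx l ≤ Λ then pdL (k, Λ - unitIdx l) f else 0 := by
  induction f using gen_induction with
  | hadd f f' hf hf' => simp only [total_add, pdL_add, hf, hf']; split_ifs <;> abel
  | hcoef a => simp [total_coef, pdL_coef, total_zero]
  | hgen h f hf =>
    have s1 : swapSign (k, Λ) (shiftGen l h) = swapSign (k, Λ) h := by
      rw [swapSign_comm, swapSign_shiftGen, swapSign_comm]
    have s2 : swapSign (k, Λ - unitIdx l) h = swapSign (k, Λ) h := by
      by_cases hg : IsOddGen (k, Λ) <;> by_cases hh : IsOddGen h <;> rfl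
    have e : (if (k, Λ) = shiftGen l h then f else 0) =
        if unitIdx l ≤ Λ then (if (k, Λ - unitIdx l) = h then f else 0) else 0 := by
      obtain ⟨k', Λ'⟩ := h
      by_cases hl : unitIdx l ≤ Λ
      · rw [if_pos hl]
        congr 1
        simp only [Prod.mk.injEq, eq_iff_iff]
        rw [tsub_eq_iff_eq_add_of_le hl]
      · rw [if_neg hl, if_neg]
        simp only [Prod.mk.injEq, not_and]
        rintro - rfl
        exact hl le_add_self
    rw [total_gen_mul, pdL_add, pdL_gen_mul, pdL_gen_mul, pdL_gen_mul, pdL_gen_mul, hf, s1, s2,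
      total_add, total_zsmul, total_gen_mul, apply_ite (total l), total_zero, e]
    split_ifs <;> simp only [mul_add, smul_add, mul_zero, smul_zero, add_zero] <;> abel

theorem total_mul_gen (l : Fin B.n) (h : Gen B) (f : Alg B) :
    total l (f * gen h) = total l f * gen h + f * gen (shiftGen l h) := by
  rw [total_mul, total_gen]

open Classical in
-- The right-handed commutator, from which prolonged right derivations are seen to commute with
-- total derivatives.
theorem pdR_total (l : Fin B.n) (k : GKind B) (Λ : MIdx B) (f : Alg B) :
    pdR (k, Λ) (total l f) = total l (pdR (k, Λ) f) +
      if unitIdx l ≤ Λ then pdR (k, Λ - unitIdx l) f else 0 := by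
  induction f using gen_induction_right with
  | hadd f f' hf hf' => simp only [total_add, pdR_add, hf, hf']; split_ifs <;> abel
  | hcoef a => simp [total_coef, pdR_coef, total_zero]
  | hgen h f hf =>
    have s1 : swapSign (k, Λ) (shiftGen l h) = swapSign (k, Λ) h := by
      rw [swapSign_comm, swapSign_shiftGen, swapSign_comm]
    have s2 : swapSign (k, Λ - unitIdx l) h = swapSign (k, Λ) h := by
      by_cases hg : IsOddGen (k, Λ) <;> by_cases hh : IsOddGen h <;> rfl
    have e : (if (k, Λ) = shiftGen l h then f else 0) =
        if unitIdx l ≤ Λ then (if (k, Λ - unitIdx l) = h then f else 0) else 0 := by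
      obtain ⟨k', Λ'⟩ := h
      by_cases hl : unitIdx l ≤ Λ
      · rw [if_pos hl]
        congr 1
        simp only [Prod.mk.injEq, eq_iff_iff]
        rw [tsub_eq_iff_eq_add_of_le hl]
      · rw [if_neg hl, if_neg]
        simp only [Prod.mk.injEq, not_and]
        rintro - rfl
        exact hl le_add_self
    rw [total_mul_gen, pdR_add, pdR_mul_gen, pdR_mul_gen, pdR_mul_gen, pdR_mul_gen, hf, s1, s2,
      total_add, total_zsmul, total_mul_gen, apply_ite (total l), total_zero, e]
    split_ifs <;> simp only [add_mul, smul_add, zero_mul, smul_zero, add_zero] <;> abel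

/-! ### Multiple total derivatives -/

theorem foldr_total_comm (L : List (Fin B.n)) (Λ : MIdx B) (m : Fin B.n) (f : Alg B) :
    L.foldr (fun l h => (total l)^[Λ l] h) (total m f) =
      total m (L.foldr (fun l h => (total l)^[Λ l] h) f) := by
  induction L with
  | nil => rfl
  | cons l L ih =>
    simp only [List.foldr_cons, ih]
    exact Function.Commute.iterate_left (fun f => total_comm l m f) _ _

/-- Each index occurs at most once in `L`, so the extra derivative enters at one position and
commutes to the front. -/
theorem foldr_total_add (L : List (Fin B.n)) (hL : L.Nodup) (Λ : MIdx B) (m : Fin B.n)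
    (f : Alg B) : L.foldr (fun l h => (total l)^[(Λ + unitIdx m : MIdx B) l] h) f =
      if m ∈ L then total m (L.foldr (fun l h => (total l)^[Λ l] h) f)
      else L.foldr (fun l h => (total l)^[Λ l] h) f := by
  induction L with
  | nil => rfl
  | cons l L ih =>
    rw [List.nodup_cons] at hL
    simp only [List.foldr_cons, ih hL.2, List.mem_cons]
    by_cases h : m = l
    · subst h
      simp [hL.1, Function.iterate_succ_apply']
    · have : (Λ + unitIdx m : MIdx B) l = Λ l := by simp [Finsupp.single_apply, h]
      rw [this]
      simp only [h, false_or]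
      split_ifs
      · exact Function.Commute.iterate_left (fun f => total_comm l m f) _ _
      · rfl

theorem dMulti_zero_idx (f : Alg B) : dMulti 0 f = f := by
  unfold dMulti
  induction List.finRange B.n with
  | nil => rfl
  | cons l L ih => simpa using ih

theorem dMulti_add_unit (Λ : MIdx B) (l : Fin B.n) (f : Alg B) :
    dMulti (Λ + unitIdx l) f = total l (dMulti Λ f) := by
  unfold dMulti
  rw [foldr_total_add _ (List.nodup_finRange _), if_pos (List.mem_finRange l)]

theorem dMulti_total (Λ : MIdx B) (l : Fin B.n) (f : Alg B) :
    dMulti Λ (total l f) = total l (dMulti Λ f) := foldr_total_comm _ Λ l f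

theorem midx_induction {P : MIdx B → Prop} (Λ : MIdx B) (h0 : P 0)
    (h1 : ∀ Λ l, P Λ → P (Λ + unitIdx l)) : P Λ := by
  induction Λ using Finsupp.induction with
  | zero => exact h0
  | single_add l n Λ _ _ ih =>
    clear * - ih h1
    induction n with
    | zero => simpa using ih
    | succ n ihn =>
      have : Finsupp.single l (n + 1) + Λ = (Finsupp.single l n + Λ) + unitIdx l := by
        rw [Finsupp.single_add]; abel
      rw [this]
      exact h1 _ _ ihn

theorem dMulti_add (Λ : MIdx B) (f h : Alg B) :
    dMulti Λ (f + h) = dMulti Λ f + dMulti Λ h := by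
  induction Λ using midx_induction with
  | h0 => simp only [dMulti_zero_idx]
  | h1 Λ l ih => simp only [dMulti_add_unit, ih, total_add]

/-- `dMulti` as an additive map. -/
def dMultiHom (Λ : MIdx B) : Alg B →+ Alg B := AddMonoidHom.mk' (dMulti Λ) (dMulti_add Λ)

theorem dMulti_zero (Λ : MIdx B) : dMulti Λ (0 : Alg B) = 0 := (dMultiHom Λ).map_zero

theorem dMulti_gen (k : GKind B) (Λ : MIdx B) : dMulti Λ (gen (k, 0)) = gen (k, Λ) := by
  induction Λ using midx_induction with
  | h0 => rw [dMulti_zero_idx]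
  | h1 Λ l ih => rw [dMulti_add_unit, ih, total_gen]

/-! ### Monomials and coefficients that occur in graded functions -/

section Weights

variable {R : Type} [Semiring R]

/-- The weight of a possibly inadmissible monomial. -/
def preWeight (wt : GKind B → R) (α : Gen B →₀ ℕ) : R := α.sum fun g k => (k : R) * wt g.1

theorem preWeight_add (wt : GKind B → R) (α β : Gen B →₀ ℕ) :
    preWeight wt (α + β) = preWeight wt α + preWeight wt β :=
  Finsupp.sum_add_index' (by simp) (by simp [add_mul])

theorem preWeight_single (wt : GKind B → R) (g : Gen B) :
    preWeight wt (Finsupp.single g 1) = wt g.1 := by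
  simp [preWeight]

/-- The graded functions whose terms have weights in `P`. -/
def weightsIn (wt : GKind B → R) (P : Set R) : AddSubgroup (Alg B) where
  carrier := {f | ∀ α, f.raw α ≠ 0 → weight wt α ∈ P}
  zero_mem' := fun α h => absurd rfl h
  add_mem' := by
    intro f g hf hg α h
    by_cases hα : f.raw α = 0
    · refine hg α fun h' => h ?_
      rw [map_add, Finsupp.add_apply, hα, h', add_zero]
    · exact hf α hα
  neg_mem' := by
    intro f hf α h
    refine hf α fun h' => h ?_
    rw [map_neg, Finsupp.neg_apply, h', neg_zero]

variable {wt : GKind B → R} {P Q S : Set R} {f g : Alg B}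

theorem weightsIn_mono (h : P ⊆ Q) (hf : f ∈ weightsIn wt P) : f ∈ weightsIn wt Q :=
  fun α hα => h (hf α hα)

theorem term_mem_weightsIn {α : Gen B →₀ ℕ} (h : preWeight wt α ∈ P) (a : Coef B) :
    term α a ∈ weightsIn wt P := by
  by_cases hα : ∀ g, IsOddGen g → α g ≤ 1
  · intro β hβ
    have : β = ⟨α, hα⟩ := by
      by_contra hne
      refine hβ ?_
      have := raw_term ⟨α, hα⟩ a
      simp only at this
      rw [this, Finsupp.single_eq_of_ne hne]
    subst this
    exact h
  · rw [term_eq_zero hα]; exact zero_mem _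

theorem map_mem_of_weightsIn (φ : Alg B →+ Alg B) (hf : f ∈ weightsIn wt P)
    (A : AddSubgroup (Alg B))
    (h : ∀ (α : Mon B) (a : Coef B), preWeight wt α.1 ∈ P → φ (term α.1 a) ∈ A) : φ f ∈ A := by
  rw [eq_sum_term f, Finsupp.sum, map_sum]
  exact sum_mem fun α hα => h α _ (hf α (Finsupp.mem_support_iff.1 hα))

theorem mul_mem_weightsIn (hf : f ∈ weightsIn wt P) (hg : g ∈ weightsIn wt Q)
    (h : ∀ x ∈ P, ∀ y ∈ Q, x + y ∈ S) : f * g ∈ weightsIn wt S := by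
  refine map_mem_of_weightsIn (AddMonoidHom.mulRight g) hf _ fun α a hα => ?_
  refine map_mem_of_weightsIn (AddMonoidHom.mulLeft (term α.1 a)) hg _ fun β b hβ => ?_
  rw [AddMonoidHom.coe_mulLeft, term_mul]
  refine term_mem_weightsIn ?_ _
  rw [preWeight_add]
  exact h _ hα _ hβ

theorem gen_mem_weightsIn {x : Gen B} (h : wt x.1 ∈ P) : gen x ∈ weightsIn wt P :=
  term_mem_weightsIn (by rwa [preWeight_single]) _

theorem coef_mem_weightsIn (h : (0 : R) ∈ P) (a : Coef B) : coef a ∈ weightsIn wt P :=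
  term_mem_weightsIn (by simpa [preWeight] using h) _

theorem preWeight_sub {x : Gen B} {α : Gen B →₀ ℕ} (h : α x ≠ 0) :
    preWeight wt (α - Finsupp.single x 1) + wt x.1 = preWeight wt α := by
  rw [← preWeight_single wt x, ← preWeight_add, tsub_add_cancel_of_le]
  rw [Finsupp.single_le_iff]; exact Nat.one_le_iff_ne_zero.2 h

theorem pdL_mem_weightsIn {x : Gen B} (hf : f ∈ weightsIn wt P)
    (h : ∀ d, d + wt x.1 ∈ P → d ∈ Q) : pdL x f ∈ weightsIn wt Q := by
  refine map_mem_of_weightsIn (pdLHom x) hf _ fun α a hα => ?_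
  change pdL x _ ∈ _
  by_cases hx : α.1 x = 0
  · simp [pdL_term x α.2, hx, term_zero]
  · rw [pdL_term x α.2]
    exact term_mem_weightsIn (h _ (by rwa [preWeight_sub hx])) _

theorem pdR_mem_weightsIn {x : Gen B} (hf : f ∈ weightsIn wt P)
    (h : ∀ d, d + wt x.1 ∈ P → d ∈ Q) : pdR x f ∈ weightsIn wt Q := by
  refine map_mem_of_weightsIn (pdRHom x) hf _ fun α a hα => ?_
  change pdR x _ ∈ _
  by_cases hx : α.1 x = 0
  · simp [pdR_term x α.2, hx, term_zero]
  · rw [pdR_term x α.2]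
    exact term_mem_weightsIn (h _ (by rwa [preWeight_sub hx])) _

theorem total_term (l : Fin B.n) (α : Mon B) (a : Coef B) :
    total l (term α.1 a) = term α.1 (totalCoef l a) +
      ∑ g ∈ α.1.support, gen (shiftGen l g) * pdL g (term α.1 a) := by
  have h0 : totalCoef l (0 : Coef B) = 0 := (totalDer l).map_zero
  rw [total, raw_term, Finsupp.sum_single_index]
  simp [h0, term_zero, pdL_zero]

/-- Weights depend on the kind of a generator only, not on its jet index. -/
theorem total_mem_weightsIn (l : Fin B.n) (hf : f ∈ weightsIn wt P) :
    total l f ∈ weightsIn wt P := by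
  refine map_mem_of_weightsIn (totalHom l) hf _ fun α a hα => ?_
  change total l _ ∈ _
  rw [total_term]
  refine add_mem (term_mem_weightsIn hα _) (sum_mem fun x hx => ?_)
  rw [Finsupp.mem_support_iff] at hx
  rw [pdL_term x α.2, gen_mul_term]
  refine term_mem_weightsIn ?_ _
  rw [add_comm, preWeight_add, preWeight_single]
  exact (preWeight_sub (wt := wt) hx).symm ▸ hα

theorem dMulti_mem_weightsIn (Λ : MIdx B) (hf : f ∈ weightsIn wt P) :
    dMulti Λ f ∈ weightsIn wt P := by
  induction Λ using midx_induction with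
  | h0 => rwa [dMulti_zero_idx]
  | h1 Λ l ih => rw [dMulti_add_unit]; exact total_mem_weightsIn l ih

/-- The weight of a field or ghost. -/
def fldWeight (wt : GKind B → R) : Fld B → R
  | .inl (.inl _) => 0
  | .inl (.inr a) => wt (.odd a)
  | .inr r => wt (.ghost r)

end Weights

/-! ### Derivatives with respect to fields and ghosts, and their finiteness -/

/-- The partial derivative of the coefficients. -/
def pdBase (c : Coord B) : Alg B →+ Alg B where
  toFun f := f.raw.sum fun α a => term α.1 (pdCoef c a)
  map_zero' := by simp
  map_add' f h := by
    rw [map_add]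
    refine Finsupp.sum_add_index' (fun α => ?_) fun α a b => ?_
    · rw [show pdCoef c (0 : Coef B) = 0 from (pdDer c).map_zero, term_zero]
    · rw [pdCoef_add, term_add]

theorem pdBase_term (c : Coord B) (α : Mon B) (a : Coef B) :
    pdBase c (term α.1 a) = term α.1 (pdCoef c a) := by
  change (term α.1 a).raw.sum (fun α a => term α.1 (pdCoef c a)) = _
  rw [raw_term, Finsupp.sum_single_index]
  rw [show pdCoef c (0 : Coef B) = 0 from (pdDer c).map_zero, term_zero]

theorem finite_pdBase (f : Alg B) : {c | pdBase c f ≠ 0}.Finite := by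
  induction f using term_induction with
  | h0 => simp
  | hadd f f' hf hf' =>
    refine (hf.union hf').subset fun g hg => ?_
    by_contra h
    simp only [Set.mem_union, Set.mem_ofPred_eq, not_or, not_not] at h
    exact hg (by rw [map_add, h.1, h.2, add_zero])
  | hterm α a =>
    refine (finite_pdCoef a).subset fun c hc h => hc ?_
    rw [pdBase_term, h, term_zero]

theorem pdFld_add (w : Fld B) (Λ : MIdx B) (f h : Alg B) :
    pdFld w Λ (f + h) = pdFld w Λ f + pdFld w Λ h := by
  rcases w with (i | a) | r
  · exact (pdBase (.inr (i, Λ))).map_add f h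
  · exact pdL_add _ f h
  · exact pdL_add _ f h

theorem pdFld_mem_weightsIn {R : Type} [Semiring R] {wt : GKind B → R} {P Q : Set R} {f : Alg B}
    {w : Fld B} (Λ : MIdx B) (hf : f ∈ weightsIn wt P)
    (h : ∀ d, d + fldWeight wt w ∈ P → d ∈ Q) : pdFld w Λ f ∈ weightsIn wt Q := by
  rcases w with (i | a) | r
  · refine map_mem_of_weightsIn (pdBase (.inr (i, Λ))) hf _ fun α a hα => ?_
    rw [pdBase_term]
    exact term_mem_weightsIn (h _ (by simpa [fldWeight] using hα)) _
  · exact pdL_mem_weightsIn hf h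
  · exact pdL_mem_weightsIn hf h

theorem finite_pdFld (f : Alg B) : {x : Fld B × MIdx B | pdFld x.1 x.2 f ≠ 0}.Finite := by
  have h1 : ((fun c : Fin B.m × MIdx B => ((.inl (.inl c.1), c.2) : Fld B × MIdx B)) ''
      {c | pdBase (.inr c) f ≠ 0}).Finite :=
    ((finite_pdBase f).preimage (f := Sum.inr) Sum.inr_injective.injOn).image _
  have h2 : ({x : Fld B × MIdx B | ∃ a, x.1 = .inl (.inr a) ∧ pdL (.odd a, x.2) f ≠ 0}).Finite := by
    refine Set.Finite.of_surjOn (s := {g | pdL g f ≠ 0})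
      (fun g => match g.1 with
        | .odd a => (.inl (.inr a), g.2)
        | .ghost r => (.inr r, g.2)
        | .anti w => (w, g.2)) ?_ (finite_pdL f)
    rintro ⟨w, Λ⟩ ⟨a, rfl, h⟩
    exact ⟨(.odd a, Λ), h, rfl⟩
  have h3 : ({x : Fld B × MIdx B | ∃ r, x.1 = .inr r ∧ pdL (.ghost r, x.2) f ≠ 0}).Finite := by
    refine Set.Finite.of_surjOn (s := {g | pdL g f ≠ 0})
      (fun g => match g.1 with
        | .odd a => (.inl (.inr a), g.2)
        | .ghost r => (.inr r, g.2)
        | .anti w => (w, g.2)) ?_ (finite_pdL f)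
    rintro ⟨w, Λ⟩ ⟨a, rfl, h⟩
    exact ⟨(.ghost a, Λ), h, rfl⟩
  refine ((h1.union h2).union h3).subset ?_
  rintro ⟨(i | a) | r, Λ⟩ h
  · exact Or.inl (Or.inl ⟨(i, Λ), h, rfl⟩)
  · exact Or.inl (Or.inr ⟨a, rfl, h⟩)
  · exact Or.inr ⟨r, rfl, h⟩

/-! ### Graded functions vanishing over a set -/

/-- The smooth functions that vanish over `Z`. -/
def vanishCoef (Z : Set ((Fin B.n → ℝ) × (Fin B.m → ℝ))) : Ideal (Coef B) where
  carrier := {a | ∀ z : Jet B, base B z.1 ∈ Z → a.1 z = 0}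
  zero_mem' := fun _ _ => rfl
  add_mem' := fun {a b} ha hb z hz => by
    change a.1 z + b.1 z = 0
    rw [ha z hz, hb z hz, add_zero]
  smul_mem' := fun c a ha z hz => by
    change c.1 z * a.1 z = 0
    rw [ha z hz, mul_zero]

/-- The graded functions that vanish over `Z`. -/
def vanishing (Z : Set ((Fin B.n → ℝ) × (Fin B.m → ℝ))) : AddSubgroup (Alg B) where
  carrier := {f | VanishesOver Z f}
  zero_mem' := fun _ _ _ => rfl
  add_mem' := fun {f g} hf hg α => (vanishCoef Z).add_mem (hf α) (hg α)
  neg_mem' := fun {f} hf α => (vanishCoef Z).neg_mem (hf α)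

section Vanishing

variable {Z : Set ((Fin B.n → ℝ) × (Fin B.m → ℝ))} {f g : Alg B}

theorem term_mem_vanishing (α : Gen B →₀ ℕ) {a : Coef B} (ha : a ∈ vanishCoef Z) :
    term α a ∈ vanishing Z := by
  by_cases hα : ∀ g, IsOddGen g → α g ≤ 1
  · intro β
    have := raw_term ⟨α, hα⟩ a
    simp only at this
    rw [this]
    by_cases hβ : β = ⟨α, hα⟩
    · subst hβ; rw [Finsupp.single_eq_same]; exact ha
    · rw [Finsupp.single_eq_of_ne hβ]; exact (vanishCoef Z).zero_mem
  · rw [term_eq_zero hα]; exact zero_mem _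

theorem map_mem_of_vanishing (φ : Alg B →+ Alg B) (hf : f ∈ vanishing Z)
    (A : AddSubgroup (Alg B))
    (h : ∀ (α : Mon B) (a : Coef B), a ∈ vanishCoef Z → φ (term α.1 a) ∈ A) : φ f ∈ A := by
  rw [eq_sum_term f, Finsupp.sum, map_sum]
  exact sum_mem fun α _ => h α _ (hf α)

theorem mul_mem_vanishing_left (hf : f ∈ vanishing Z) (g : Alg B) : f * g ∈ vanishing Z := by
  refine map_mem_of_vanishing (AddMonoidHom.mulRight g) hf _ fun α a ha => ?_
  change term α.1 a * g ∈ _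
  induction g using term_induction with
  | h0 => simp
  | hadd g g' hg hg' => rw [mul_add]; exact add_mem hg hg'
  | hterm β b =>
    rw [term_mul]
    exact term_mem_vanishing _ (Ideal.mul_mem_left _ _ (Ideal.mul_mem_right _ _ ha))

theorem mul_mem_vanishing_right (f : Alg B) (hg : g ∈ vanishing Z) : f * g ∈ vanishing Z := by
  refine map_mem_of_vanishing (AddMonoidHom.mulLeft f) hg _ fun α a ha => ?_
  change f * term α.1 a ∈ _
  induction f using term_induction with
  | h0 => simp
  | hadd g g' hg hg' => rw [add_mul]; exact add_mem hg hg'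
  | hterm β b =>
    rw [term_mul]
    exact term_mem_vanishing _ (Ideal.mul_mem_left _ _ (Ideal.mul_mem_left _ _ ha))

theorem pdL_mem_vanishing (x : Gen B) (hf : f ∈ vanishing Z) : pdL x f ∈ vanishing Z := by
  refine map_mem_of_vanishing (pdLHom x) hf _ fun α a ha => ?_
  change pdL x _ ∈ _
  rw [pdL_term x α.2]
  exact term_mem_vanishing _ (Ideal.mul_mem_left _ _ (Ideal.mul_mem_left _ _ ha))

/-- Openness is essential here: it is the reason why the reduction works with open neighbourhoods
rather than with the compact set itself. -/
theorem total_mem_vanishing (hZ : IsOpen Z) (l : Fin B.n) (hf : f ∈ vanishing Z) :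
    total l f ∈ vanishing Z := by
  refine map_mem_of_vanishing (totalHom l) hf _ fun α a ha => ?_
  change total l _ ∈ _
  rw [total_term]
  refine add_mem (term_mem_vanishing _ fun z hz => totalCoef_apply_eq_zero l hZ ha z hz)
    (sum_mem fun x _ => mul_mem_vanishing_right _ (pdL_mem_vanishing x (term_mem_vanishing _ ha)))

theorem dMulti_mem_vanishing (hZ : IsOpen Z) (Λ : MIdx B) (hf : f ∈ vanishing Z) :
    dMulti Λ f ∈ vanishing Z := by
  induction Λ using midx_induction with
  | h0 => rwa [dMulti_zero_idx]
  | h1 Λ l ih => rw [dMulti_add_unit]; exact total_mem_vanishing hZ l ih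

end Vanishing

/-! ### Prolonged derivations -/

/-- Used for the injective shift `Λ ↦ Λ + l`, outside whose range the commutator terms vanish. -/
theorem finsum_eq_finsum_comp {X Y M : Type*} [AddCommMonoid M] {e : X → Y}
    (he : Function.Injective e) (F : Y → M) (h : ∀ y, y ∉ Set.range e → F y = 0) :
    ∑ᶠ y, F y = ∑ᶠ x, F (e x) := by
  classical
  rw [← finsum_mem_range he]
  refine finsum_congr fun y => ?_
  rw [finsum_eq_if]
  split_ifs with hy
  · rfl
  · exact h y hy

theorem finite_pdR_anti (f : Alg B) :
    {x : Fld B × MIdx B | pdR (.anti x.1, x.2) f ≠ 0}.Finite := by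
  have hinj : Function.Injective fun x : Fld B × MIdx B => ((.anti x.1, x.2) : Gen B) := by
    rintro ⟨w, Λ⟩ ⟨w', Λ'⟩ h
    simpa using h
  exact (finite_pdR f).preimage hinj.injOn

theorem finite_rightDer (v : Fld B → Alg B) (f : Alg B) :
    (Function.support fun x : Fld B × MIdx B =>
      pdR (.anti x.1, x.2) f * dMulti x.2 (v x.1)).Finite :=
  (finite_pdR_anti f).subset fun _ hx => left_ne_zero_of_mul hx

theorem finite_leftDer (v : Fld B → Alg B) (f : Alg B) :
    (Function.support fun x : Fld B × MIdx B =>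
      dMulti x.2 (v x.1) * pdFld x.1 x.2 f).Finite :=
  (finite_pdFld f).subset fun _ hx => right_ne_zero_of_mul hx

/-- `rightDer v` as an additive map. -/
def rightDerHom (v : Fld B → Alg B) : Alg B →+ Alg B := AddMonoidHom.mk' (rightDer v) <| by
  intro f h
  simp only [rightDer, pdR_add, add_mul]
  exact finsum_add_distrib (finite_rightDer v f) (finite_rightDer v h)

theorem rightDer_zero (v : Fld B → Alg B) : rightDer v 0 = 0 := (rightDerHom v).map_zero

theorem rightDer_add (v : Fld B → Alg B) (f h : Alg B) :
    rightDer v (f + h) = rightDer v f + rightDer v h := (rightDerHom v).map_add f h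

theorem rightDer_sub (v : Fld B → Alg B) (f h : Alg B) :
    rightDer v (f - h) = rightDer v f - rightDer v h := (rightDerHom v).map_sub f h

/-- `leftDer v` as an additive map. -/
def leftDerHom (v : Fld B → Alg B) : Alg B →+ Alg B := AddMonoidHom.mk' (leftDer v) <| by
  intro f h
  simp only [leftDer, pdFld_add, mul_add]
  exact finsum_add_distrib (finite_leftDer v f) (finite_leftDer v h)

theorem leftDer_add (v : Fld B → Alg B) (f h : Alg B) :
    leftDer v (f + h) = leftDer v f + leftDer v h := (leftDerHom v).map_add f h

theorem leftDer_add_left (v v' : Fld B → Alg B) (f : Alg B) :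
    leftDer (fun w => v w + v' w) f = leftDer v f + leftDer v' f := by
  simp only [leftDer, dMulti_add, add_mul]
  exact finsum_add_distrib (finite_leftDer v f) (finite_leftDer v' f)

theorem rightDer_mul_of_eq_zero (v : Fld B → Alg B) {a : Alg B}
    (ha : ∀ w Λ, pdR (.anti w, Λ) a = 0) (f : Alg B) :
    rightDer v (a * f) = a * rightDer v f := by
  simp only [rightDer]
  rw [mul_finsum' _ _ (finite_rightDer v f)]
  refine finsum_congr fun x => ?_
  rw [pdR_mul_of_eq_zero (ha _ _), mul_assoc]

/-- After the shift `Λ ↦ Λ + l`, the commutator terms of `pdR_total` are exactly those in which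
`d_l` hits the factor `d_Λ v_w`. -/
theorem rightDer_total (v : Fld B → Alg B) (l : Fin B.n) (f : Alg B) :
    rightDer v (total l f) = total l (rightDer v f) := by
  classical
  have hinj : Function.Injective fun x : Fld B × MIdx B => (x.1, x.2 + unitIdx l) := by
    rintro ⟨w, Λ⟩ ⟨w', Λ'⟩ h
    simpa using h
  let F : Fld B × MIdx B → Alg B := fun x => if unitIdx l ≤ x.2 then
    pdR (.anti x.1, x.2 - unitIdx l) f * dMulti x.2 (v x.1) else 0
  let G : Fld B × MIdx B → Alg B := fun x => total l (pdR (.anti x.1, x.2) f) * dMulti x.2 (v x.1)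
  have hF (x : Fld B × MIdx B) : F (x.1, x.2 + unitIdx l) =
      pdR (.anti x.1, x.2) f * total l (dMulti x.2 (v x.1)) := by
    simp only [F, if_pos (le_add_self (a := unitIdx l)), add_tsub_cancel_right, dMulti_add_unit]
  have hFs : (Function.support F).Finite := by
    refine ((finite_pdR_anti f).image fun x => (x.1, x.2 + unitIdx l)).subset fun x hx => ?_
    have hl : unitIdx l ≤ x.2 := by
      by_contra h
      exact hx (if_neg h)
    refine ⟨(x.1, x.2 - unitIdx l), fun h => hx ?_, by simp [tsub_add_cancel_of_le hl]⟩
    simp only at h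
    simp only [F, h, zero_mul, ite_self]
  have hGs : (Function.support G).Finite :=
    (finite_pdR_anti f).subset fun x hx h => left_ne_zero_of_mul hx (by rw [h, total_zero])
  have h1 : rightDer v (total l f) = ∑ᶠ x, (G x + F x) := by
    refine finsum_congr fun x => ?_
    simp only [pdR_total, add_mul, G, F]
    split_ifs <;> simp
  have h2 : total l (rightDer v f) = ∑ᶠ x : Fld B × MIdx B,
      (G x + pdR (.anti x.1, x.2) f * total l (dMulti x.2 (v x.1))) := by
    rw [rightDer]
    refine ((totalHom l).map_finsum (finite_rightDer v f)).trans (finsum_congr fun x => ?_)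
    exact total_mul l _ _
  have hR : (Function.support fun x : Fld B × MIdx B =>
      pdR (.anti x.1, x.2) f * total l (dMulti x.2 (v x.1))).Finite :=
    (finite_pdR_anti f).subset fun x hx => left_ne_zero_of_mul hx
  rw [h1, h2, finsum_add_distrib hGs hFs, finsum_add_distrib hGs hR,
    finsum_eq_finsum_comp hinj F, finsum_congr hF]
  intro x hx
  refine if_neg fun hl => hx ⟨(x.1, x.2 - unitIdx l), ?_⟩
  simp [tsub_add_cancel_of_le hl]

theorem rightDer_dMulti (v : Fld B → Alg B) (Λ : MIdx B) (f : Alg B) :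
    rightDer v (dMulti Λ f) = dMulti Λ (rightDer v f) := by
  induction Λ using midx_induction with
  | h0 => simp only [dMulti_zero_idx]
  | h1 Λ l ih => simp only [dMulti_add_unit, rightDer_total, ih]

open Classical in
theorem pdR_gen (g h : Gen B) : pdR g (gen h) = if g = h then 1 else 0 := by
  have := pdR_mul_gen g h 1
  rwa [one_mul, show pdR g (1 : Alg B) = 0 from pdR_coef g 1, zero_mul, smul_zero, add_zero] at this

open Classical in
theorem pdL_gen (g h : Gen B) : pdL g (gen h) = if g = h then 1 else 0 := by
  have := pdL_gen_mul g h 1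
  rwa [mul_one, show pdL g (1 : Alg B) = 0 from pdL_coef g 1, mul_zero, smul_zero, add_zero] at this

theorem rightDer_gen (v : Fld B → Alg B) (w : Fld B) :
    rightDer v (gen (.anti w, 0)) = v w := by
  rw [rightDer, finsum_eq_single _ (w, 0)]
  · rw [pdR_gen, if_pos rfl, one_mul, dMulti_zero_idx]
  · rintro ⟨w', Λ⟩ hne
    rw [pdR_gen, if_neg, zero_mul]
    intro h
    simp only [Prod.mk.injEq, GKind.anti.injEq] at h
    exact hne (by rw [h.1, h.2])

section Weights

variable {R : Type} [Semiring R] {wt : GKind B → R} {P Q : Set R} {f : Alg B}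

theorem rightDer_mem_weightsIn {v : Fld B → Alg B} {V : Fld B → Set R}
    (hf : f ∈ weightsIn wt P) (hv : ∀ w, v w ∈ weightsIn wt (V w))
    (h : ∀ w d, d + wt (.anti w) ∈ P → ∀ e ∈ V w, d + e ∈ Q) :
    rightDer v f ∈ weightsIn wt Q := by
  refine finsum_induction (· ∈ weightsIn wt Q) (zero_mem _) (fun _ _ => add_mem) fun x => ?_
  exact mul_mem_weightsIn (pdR_mem_weightsIn (Q := {d | d + wt (.anti x.1) ∈ P}) hf fun d hd => hd)
    (dMulti_mem_weightsIn x.2 (hv x.1)) fun d hd e he => h x.1 d hd e he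

/-- One generator is removed and a component of `v` is inserted. Taking `V w = ∅` records that the
component `v w` is zero, so that no condition is needed for it. -/
theorem leftDer_mem_weightsIn {v : Fld B → Alg B} {V : Fld B → Set R}
    (hf : f ∈ weightsIn wt P) (hv : ∀ w, v w ∈ weightsIn wt (V w))
    (h : ∀ w d, d + fldWeight wt w ∈ P → ∀ e ∈ V w, e + d ∈ Q) :
    leftDer v f ∈ weightsIn wt Q := by
  refine finsum_induction (· ∈ weightsIn wt Q) (zero_mem _) (fun _ _ => add_mem) fun x => ?_
  exact mul_mem_weightsIn (dMulti_mem_weightsIn x.2 (hv x.1))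
    (pdFld_mem_weightsIn (Q := {d | d + fldWeight wt x.1 ∈ P}) x.2 hf fun d hd => hd)
    fun e he d hd => h x.1 d hd e he

/-- The standard device for vanishing statements below: no weight is possible for any monomial. -/
theorem eq_zero_of_mem_weightsIn_empty (h : f ∈ weightsIn wt ∅) : f = 0 := by
  refine Alg.raw.injective (Finsupp.ext fun α => ?_)
  by_contra hα
  exact h α hα

theorem eq_zero_of_mem_weightsIn (hP : f ∈ weightsIn wt P) (hQ : f ∈ weightsIn wt Q)
    (h : Disjoint P Q) : f = 0 :=
  eq_zero_of_mem_weightsIn_empty (wt := wt) fun α hα => h.le_bot ⟨hP α hα, hQ α hα⟩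

end Weights

theorem AntifieldFree.pdR_eq_zero {f : Alg B} (hf : AntifieldFree f) (w : Fld B) (Λ : MIdx B) :
    pdR (.anti w, Λ) f = 0 := by
  refine eq_zero_of_mem_weightsIn_empty (wt := antiDeg)
    (pdR_mem_weightsIn (P := {0}) (Q := ∅) hf fun d hd => ?_)
  simp [antiDeg] at hd

theorem GhostFree.pdL_eq_zero {f : Alg B} (hf : GhostFree f) (r : Fin B.q) (Λ : MIdx B) :
    pdL (.ghost r, Λ) f = 0 := by
  refine eq_zero_of_mem_weightsIn_empty (wt := ghostDeg)
    (pdL_mem_weightsIn (P := {0}) (Q := ∅) hf fun d hd => ?_)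
  simp [ghostDeg] at hd

theorem GhostFree.pdL_gen_mul {f : Alg B} (hf : GhostFree f) (r r' : Fin B.q) (Λ Λ' : MIdx B) :
    pdL (.ghost r, Λ) (gen (.ghost r', Λ') * f) = if r = r' ∧ Λ = Λ' then f else 0 := by
  rw [GaugeTheory.pdL_gen_mul, hf.pdL_eq_zero, mul_zero, smul_zero, add_zero]
  simp

/-! ### The variational derivative with respect to a ghost -/

theorem finite_euler (r : Fin B.q) (f : Alg B) :
    {Λ : MIdx B | pdL (.ghost r, Λ) f ≠ 0}.Finite :=
  (finite_pdL f).preimage (f := fun Λ : MIdx B => ((.ghost r, Λ) : Gen B))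
    fun Λ _ Λ' _ h => by simpa using h

/-- The variational derivative with respect to a ghost. -/
def euler (r : Fin B.q) : Alg B →+ Alg B where
  toFun f := ∑ᶠ Λ : MIdx B, ((-1 : ℤ) ^ Λ.degree) • dMulti Λ (pdL (.ghost r, Λ) f)
  map_zero' := by simp [pdL_zero, dMulti_zero]
  map_add' f h := by
    have hs (f : Alg B) : (Function.support fun Λ : MIdx B =>
        ((-1 : ℤ) ^ Λ.degree) • dMulti Λ (pdL (.ghost r, Λ) f)).Finite :=
      (finite_euler r f).subset fun Λ hΛ h0 => hΛ (by simp only [h0, dMulti_zero, smul_zero])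
    simp only [pdL_add, dMulti_add, smul_add]
    exact finsum_add_distrib (hs f) (hs h)

theorem euler_apply (r : Fin B.q) (f : Alg B) : euler r f =
    ∑ᶠ Λ : MIdx B, ((-1 : ℤ) ^ Λ.degree) • dMulti Λ (pdL (.ghost r, Λ) f) := rfl

/-- By `pdL_total` there are two families of terms. Shifting the multi-index by `l` identifies them
and changes the sign `(-1)^{|Λ|}`, so they cancel. -/
theorem euler_total (r : Fin B.q) (l : Fin B.n) (f : Alg B) : euler r (total l f) = 0 := by
  classical
  let G : MIdx B → Alg B := fun Λ => ((-1 : ℤ) ^ Λ.degree) • total l (dMulti Λ (pdL (.ghost r, Λ) f))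
  let F : MIdx B → Alg B := fun Λ => if unitIdx l ≤ Λ then
    ((-1 : ℤ) ^ Λ.degree) • dMulti Λ (pdL (.ghost r, Λ - unitIdx l) f) else 0
  have hinj : Function.Injective fun Λ : MIdx B => Λ + unitIdx l := add_left_injective _
  have hG : (Function.support G).Finite :=
    (finite_euler r f).subset fun Λ hΛ h0 => hΛ (by
      simp only [G, h0, dMulti_zero, total_zero, smul_zero])
  have hF : (Function.support F).Finite := by
    refine ((finite_euler r f).image fun Λ : MIdx B => Λ + unitIdx l).subset fun Λ hΛ => ?_
    have hl : unitIdx l ≤ Λ := by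
      by_contra h
      exact hΛ (if_neg h)
    refine ⟨Λ - unitIdx l, fun h0 => hΛ ?_, tsub_add_cancel_of_le hl⟩
    simp only [F, h0, dMulti_zero, smul_zero, ite_self]
  have h1 : euler r (total l f) = ∑ᶠ Λ, (G Λ + F Λ) := by
    refine finsum_congr fun Λ => ?_
    simp only [pdL_total, dMulti_add, dMulti_total, smul_add, G, F]
    split_ifs <;> simp [dMulti_zero]
  have h2 (Λ : MIdx B) : F (Λ + unitIdx l) = -G Λ := by
    simp only [F, G, if_pos (le_add_self (a := unitIdx l)), add_tsub_cancel_right,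
      dMulti_add_unit, map_add, Finsupp.degree_single, pow_succ, mul_neg_one, neg_smul]
  rw [h1, finsum_add_distrib hG hF, finsum_eq_finsum_comp hinj F, finsum_congr h2,
    finsum_neg_distrib, add_neg_cancel]
  exact fun Λ hΛ => if_neg fun hl => hΛ ⟨Λ - unitIdx l, tsub_add_cancel_of_le hl⟩

/-- Integration by parts, one total derivative at a time. -/
theorem euler_dMulti_mul (r : Fin B.q) (Λ : MIdx B) (f h : Alg B) :
    euler r (dMulti Λ f * h) = ((-1 : ℤ) ^ Λ.degree) • euler r (f * dMulti Λ h) := by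
  induction Λ using midx_induction generalizing h with
  | h0 => simp [dMulti_zero_idx]
  | h1 Λ l ih =>
    have : dMulti (Λ + unitIdx l) f * h =
        total l (dMulti Λ f * h) - dMulti Λ f * total l h := by
      rw [total_mul, dMulti_add_unit]; abel
    rw [this, map_sub, euler_total, zero_sub, ih, dMulti_total, dMulti_add_unit, map_add,
      Finsupp.degree_single, pow_succ, mul_neg_one, neg_smul]

/-- The only ghost present is an undifferentiated one on the left, so no total derivative and no
sign remains. This recovers the coefficient of a ghost. -/
theorem euler_gen_mul (r r' : Fin B.q) {f : Alg B} (hf : GhostFree f) :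
    euler r (gen (.ghost r', 0) * f) = if r = r' then f else 0 := by
  rw [euler_apply, finsum_eq_single _ 0]
  · simp [hf.pdL_gen_mul, dMulti_zero_idx]
  · intro Λ hΛ
    simp [hf.pdL_gen_mul, hΛ, dMulti_zero]

/-! ### Linear differential operators and their formal adjoints -/

/-- The linear differential operator with the coefficients `f`. -/
def diffOp (f : MIdx B →₀ Alg B) : Alg B →+ Alg B where
  toFun ψ := f.sum fun Λ a => a * dMulti Λ ψ
  map_zero' := by simp [dMulti_zero]
  map_add' ψ ψ' := by simp only [dMulti_add, mul_add, Finsupp.sum_add]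

theorem diffOp_apply (f : MIdx B →₀ Alg B) (ψ : Alg B) :
    diffOp f ψ = f.sum fun Λ a => a * dMulti Λ ψ := rfl

/-- The formal adjoint of the linear differential operator with the coefficients `f`. -/
def adjOp (f : MIdx B →₀ Alg B) (φ : Alg B) : Alg B := ∑ᶠ Λ, dMulti Λ φ * eta f Λ

/-- The binomial coefficient of multi-indices. -/
def midxChoose (Ξ Λ : MIdx B) : ℕ := ∏ l, (Ξ l).choose (Λ l)

theorem midxChoose_eq_zero {Ξ Λ : MIdx B} (h : ¬ Λ ≤ Ξ) : midxChoose Ξ Λ = 0 := by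
  obtain ⟨l, hl⟩ := not_forall.1 fun H => h (Finsupp.le_def.2 H)
  exact Finset.prod_eq_zero (Finset.mem_univ l) (Nat.choose_eq_zero_of_lt (not_le.1 hl))

theorem finite_midxChoose (Ξ : MIdx B) : {Λ | midxChoose Ξ Λ ≠ 0}.Finite := by
  refine (Set.finite_Iic Ξ).subset fun Λ h => ?_
  by_contra h'
  exact h (midxChoose_eq_zero h')

open Classical in
-- Pascal's rule in the direction `l`; the other factors of the product do not change.
theorem midxChoose_add_unit (Ξ Λ : MIdx B) (l : Fin B.n) : midxChoose (Ξ + unitIdx l) Λ =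
    midxChoose Ξ Λ + if unitIdx l ≤ Λ then midxChoose Ξ (Λ - unitIdx l) else 0 := by
  have h1 : ∀ l' ∈ Finset.univ.erase l, ((Ξ + unitIdx l : MIdx B) l').choose (Λ l') =
      (Ξ l').choose (Λ l') := fun l' hl' => by
    have : l ≠ l' := (Finset.ne_of_mem_erase hl').symm
    simp [Finsupp.single_apply, this]
  have h2 : ∀ l' ∈ Finset.univ.erase l, (Ξ l').choose ((Λ - unitIdx l : MIdx B) l') =
      (Ξ l').choose (Λ l') := fun l' hl' => by
    have : l ≠ l' := (Finset.ne_of_mem_erase hl').symm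
    simp [Finsupp.single_apply, this]
  unfold midxChoose
  simp only [← Finset.mul_prod_erase Finset.univ _ (Finset.mem_univ l)]
  rw [Finset.prod_congr rfl h1, Finset.prod_congr rfl h2]
  simp only [Finsupp.add_apply, Finsupp.tsub_apply, Finsupp.single_eq_same,
    Finsupp.single_le_iff]
  rcases h : Λ l with _ | k
  · simp
  · simp [Nat.choose_succ_succ]; ring

theorem dMulti_mul (Ξ : MIdx B) (f h : Alg B) : dMulti Ξ (f * h) =
    ∑ᶠ Λ, midxChoose Ξ Λ • (dMulti Λ f * dMulti (Ξ - Λ) h) := by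
  classical
  induction Ξ using midx_induction with
  | h0 =>
    rw [finsum_eq_single _ 0]
    · simp [dMulti_zero_idx, midxChoose]
    · intro Λ hΛ
      rw [midxChoose_eq_zero, zero_smul]
      simpa using hΛ
  | h1 Ξ l ih =>
    let F : MIdx B → Alg B := fun Λ => dMulti Λ f * dMulti (Ξ + unitIdx l - Λ) h
    let G : MIdx B → Alg B := fun Λ => if unitIdx l ≤ Λ then
      midxChoose Ξ (Λ - unitIdx l) • F Λ else 0
    have hinj : Function.Injective fun Λ : MIdx B => Λ + unitIdx l := add_left_injective _
    have hs (F : MIdx B → Alg B) : (Function.support fun Λ => midxChoose Ξ Λ • F Λ).Finite :=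
      (finite_midxChoose Ξ).subset fun Λ hΛ h0 => hΛ (by simp only [h0, zero_smul])
    have hG (Λ : MIdx B) : G (Λ + unitIdx l) = midxChoose Ξ Λ • F (Λ + unitIdx l) := by
      simp only [G, if_pos (le_add_self (a := unitIdx l)), add_tsub_cancel_right]
    have hGs : (Function.support G).Finite := by
      refine ((hs fun Λ => F (Λ + unitIdx l)).image fun Λ => Λ + unitIdx l).subset fun Λ hΛ => ?_
      have hl : unitIdx l ≤ Λ := by
        by_contra h
        exact hΛ (if_neg h)
      refine ⟨Λ - unitIdx l, ?_, tsub_add_cancel_of_le hl⟩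
      rw [Function.mem_support, ← hG, tsub_add_cancel_of_le hl]
      exact hΛ
    have e1 (Λ : MIdx B) : midxChoose (Ξ + unitIdx l) Λ • F Λ =
        midxChoose Ξ Λ • F Λ + G Λ := by
      rw [midxChoose_add_unit, add_smul]
      simp only [G]
      split_ifs <;> simp
    have e2 (Λ : MIdx B) : total l (midxChoose Ξ Λ • (dMulti Λ f * dMulti (Ξ - Λ) h)) =
        midxChoose Ξ Λ • F Λ + midxChoose Ξ Λ • F (Λ + unitIdx l) := by
      refine ((totalHom l).map_nsmul _ _).trans ?_
      change _ • total l _ = _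
      -- Truncated subtraction commutes with adding `l` only for `Λ ≤ Ξ`; otherwise the binomial
      -- coefficient is zero.
      by_cases hΛ : Λ ≤ Ξ
      · simp only [F]
        rw [total_mul, ← dMulti_add_unit, ← dMulti_add_unit, add_tsub_add_eq_tsub_right,
          tsub_add_eq_add_tsub hΛ, smul_add, add_comm]
      · simp [midxChoose_eq_zero hΛ]
    rw [dMulti_add_unit, ih]
    refine ((totalHom l).map_finsum (hs _)).trans ?_
    refine (finsum_congr e2).trans ?_
    refine Eq.trans ?_ (finsum_congr e1).symm
    rw [finsum_add_distrib (hs _) (hs _), finsum_add_distrib (hs _) hGs,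
      finsum_eq_finsum_comp hinj G, finsum_congr hG]
    exact fun Λ hΛ => if_neg fun hl => hΛ ⟨Λ - unitIdx l, tsub_add_cancel_of_le hl⟩

theorem eta_eq_sum (f : MIdx B →₀ Alg B) (Λ : MIdx B) : eta f Λ =
    ∑ Ξ ∈ f.support, ((-1 : ℤ) ^ Ξ.degree) • midxChoose Ξ Λ • dMulti (Ξ - Λ) (f Ξ) := by
  refine Finset.sum_congr rfl fun Ξ _ => ?_
  dsimp only
  split_ifs with h
  · rw [mul_smul, natCast_zsmul]; rfl
  · rw [midxChoose_eq_zero h, zero_smul, smul_zero]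

theorem finite_eta (f : MIdx B →₀ Alg B) : {Λ | eta f Λ ≠ 0}.Finite := by
  refine (f.support.finite_toSet.biUnion fun Ξ _ => finite_midxChoose Ξ).subset fun Λ hΛ => ?_
  by_contra h
  simp only [Set.mem_iUnion, not_exists, Set.mem_ofPred_eq, not_not] at h
  refine hΛ ?_
  rw [eta_eq_sum]
  exact Finset.sum_eq_zero fun Ξ hΞ => by rw [h Ξ hΞ, zero_smul, smul_zero]

/-- The binomial coefficients in `eta` are those of the Leibniz expansion of `d_Ξ(φ f^Ξ)`. This
identifies `adjOp` as a formal adjoint. -/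
theorem adjOp_eq_sum (f : MIdx B →₀ Alg B) (φ : Alg B) : adjOp f φ =
    f.sum fun Ξ a => ((-1 : ℤ) ^ Ξ.degree) • dMulti Ξ (φ * a) := by
  have hs (Ξ : MIdx B) : (Function.support fun Λ =>
      midxChoose Ξ Λ • (dMulti Λ φ * dMulti (Ξ - Λ) (f Ξ))).Finite :=
    (finite_midxChoose Ξ).subset fun Λ hΛ h0 => hΛ (by simp only [h0, zero_smul])
  have hs' (Ξ : MIdx B) : (Function.support fun Λ => ((-1 : ℤ) ^ Ξ.degree) •
      (midxChoose Ξ Λ • (dMulti Λ φ * dMulti (Ξ - Λ) (f Ξ)))).Finite :=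
    (hs Ξ).subset fun Λ hΛ h0 => hΛ (by simp only [h0, smul_zero])
  simp only [adjOp, eta_eq_sum, Finset.mul_sum, mul_smul_comm]
  rw [finsum_sum_comm _ _ fun Ξ _ => hs' Ξ]
  refine Finset.sum_congr rfl fun Ξ _ => ?_
  dsimp only
  rw [dMulti_mul, smul_finsum' _ (hs Ξ)]

/-- The order `φ`, coefficient, `ψ` is the same on both sides, so no parity sign appears; the signs
`(-1)^{|Ξ|}` of the adjoint and of the integration by parts cancel. -/
theorem euler_adjOp_mul (r : Fin B.q) (f : MIdx B →₀ Alg B) (φ ψ : Alg B) :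
    euler r (adjOp f φ * ψ) = euler r (φ * diffOp f ψ) := by
  rw [adjOp_eq_sum, diffOp_apply, Finsupp.sum, Finsupp.sum, Finset.sum_mul, Finset.mul_sum,
    map_sum, map_sum]
  refine Finset.sum_congr rfl fun Ξ _ => ?_
  rw [smul_mul_assoc, map_zsmul, euler_dMulti_mul, smul_smul, ← mul_pow, mul_assoc]
  simp

theorem diffOp_mem_weightsIn {R : Type} [Semiring R] {wt : GKind B → R} {P Q S : Set R}
    {f : MIdx B →₀ Alg B} {ψ : Alg B} (hf : ∀ Λ, f Λ ∈ weightsIn wt P)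
    (hψ : ψ ∈ weightsIn wt Q) (h : ∀ x ∈ P, ∀ y ∈ Q, x + y ∈ S) :
    diffOp f ψ ∈ weightsIn wt S :=
  sum_mem fun Λ _ => mul_mem_weightsIn (hf Λ) (dMulti_mem_weightsIn Λ hψ) h

theorem eta_mem_weightsIn {R : Type} [Semiring R] {wt : GKind B → R} {P : Set R}
    {f : MIdx B →₀ Alg B} (hf : ∀ Λ, f Λ ∈ weightsIn wt P) (Λ : MIdx B) :
    eta f Λ ∈ weightsIn wt P := by
  rw [eta_eq_sum]
  exact sum_mem fun Ξ _ => zsmul_mem (nsmul_mem (dMulti_mem_weightsIn _ (hf Ξ)) _) _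

theorem rightDer_diffOp (v : Fld B → Alg B) {f : MIdx B →₀ Alg B}
    (hf : ∀ Λ, AntifieldFree (f Λ)) (ψ : Alg B) :
    rightDer v (diffOp f ψ) = diffOp f (rightDer v ψ) := by
  rw [diffOp_apply, diffOp_apply, Finsupp.sum, Finsupp.sum]
  refine (map_sum (rightDerHom v) _ _).trans (Finset.sum_congr rfl fun Λ _ => ?_)
  refine (rightDer_mul_of_eq_zero v (hf Λ).pdR_eq_zero _).trans ?_
  rw [rightDer_dMulti]

/-! ### Gradings of the theory -/

/-- The polynomial degree in antifields of level above `j`. -/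
def highDeg (j : ℕ) : GKind B → ℕ
  | .anti w => if level w ≤ j then 0 else 1
  | _ => 0

theorem ghostFree_iff {f : Alg B} : GhostFree f ↔ f ∈ weightsIn ghostDeg {0} := Iff.rfl

theorem antifieldFree_iff {f : Alg B} : AntifieldFree f ↔ f ∈ weightsIn antiDeg {0} := Iff.rfl

theorem preWeight_eq_zero_iff {wt : GKind B → ℕ} {α : Gen B →₀ ℕ} :
    preWeight wt α = 0 ↔ ∀ g, α g ≠ 0 → wt g.1 = 0 := by
  simp only [preWeight, Finsupp.sum, Finset.sum_eq_zero_iff, Finsupp.mem_support_iff, Nat.cast_id,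
    mul_eq_zero]
  exact ⟨fun h g hg => (h g hg).resolve_left hg, fun h g hg => Or.inr (h g hg)⟩

/-- All conditions become weights, so that chains can be handled by the general rules for products
and derivations. -/
theorem isChain_iff {j d : ℕ} {f : Alg B} : IsChain j d f ↔ f ∈ weightsIn ghostDeg {0} ∧
    f ∈ weightsIn antiNum {d} ∧ f ∈ weightsIn (highDeg j) {0} := by
  refine and_congr Iff.rfl (and_congr Iff.rfl (forall₂_congr fun α hα => ?_))
  refine Iff.trans ?_ (preWeight_eq_zero_iff (wt := highDeg j) (α := α.1)).symm
  constructor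
  · rintro h ⟨a | r | w, Λ⟩ hg
    · rfl
    · rfl
    · exact if_pos (h w Λ hg)
  · intro h w Λ hw
    have := h _ hw
    simpa [highDeg] using this

theorem AntifieldFree.mem_weightsIn {f : Alg B} (hf : AntifieldFree f) {wt : GKind B → ℕ}
    (h : ∀ k, antiDeg k = 0 → wt k = 0) : f ∈ weightsIn wt {0} := fun α hα =>
  preWeight_eq_zero_iff.2 fun g hg =>
    h _ (preWeight_eq_zero_iff.1 (hf α hα : preWeight antiDeg α.1 = 0) g hg)

theorem AntifieldFree.antiNum {f : Alg B} (hf : AntifieldFree f) :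
    f ∈ weightsIn antiNum {0} := hf.mem_weightsIn fun k hk => by
  rcases k with a | r | w
  · rfl
  · rfl
  · exact absurd hk one_ne_zero

theorem AntifieldFree.highDeg {f : Alg B} (hf : AntifieldFree f) (j : ℕ) :
    f ∈ weightsIn (highDeg j) {0} := hf.mem_weightsIn fun k hk => by
  rcases k with a | r | w
  · rfl
  · rfl
  · exact absurd hk one_ne_zero

theorem preWeight_le {wt wt' : GKind B → ℕ} (h : ∀ k, wt k ≤ wt' k) (α : Gen B →₀ ℕ) :
    preWeight wt α ≤ preWeight wt' α :=
  Finset.sum_le_sum fun g _ => Nat.mul_le_mul_left _ (h g.1)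

theorem antiDeg_le_antiNum (k : GKind B) : antiDeg k ≤ antiNum k := by
  rcases k with a | r | w
  · exact le_rfl
  · exact le_rfl
  · exact Nat.le_add_left _ _

/-! ### The linear operators of the Noether identities -/

namespace PreTheory

variable (T : PreTheory B)

theorem D_eq_zero {r : Fin B.q} {w : Fld B} (h : level w ≠ B.stage r) : T.D r w = 0 := by
  by_contra h'
  exact h (T.D_level r w h')

theorem linOp_eq (r : Fin B.q) (φ : Fld B → Alg B) :
    T.linOp r φ = ∑ w, diffOp (T.D r w) (φ w) := rfl

theorem linOp_congr {r : Fin B.q} {φ φ' : Fld B → Alg B}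
    (h : ∀ w, level w = B.stage r → φ w = φ' w) : T.linOp r φ = T.linOp r φ' := by
  rw [linOp_eq, linOp_eq]
  refine Finset.sum_congr rfl fun w _ => ?_
  by_cases hw : level w = B.stage r
  · rw [h w hw]
  · rw [T.D_eq_zero hw, diffOp_apply, diffOp_apply, Finsupp.sum_zero_index,
      Finsupp.sum_zero_index]

theorem linOp_add (r : Fin B.q) (φ φ' : Fld B → Alg B) :
    T.linOp r (φ + φ') = T.linOp r φ + T.linOp r φ' := by
  simp only [linOp_eq, Pi.add_apply, map_add, Finset.sum_add_distrib]

theorem linOp_sub (r : Fin B.q) (φ φ' : Fld B → Alg B) :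
    T.linOp r (φ - φ') = T.linOp r φ - T.linOp r φ' := by
  simp only [linOp_eq, Pi.sub_apply, map_sub, Finset.sum_sub_distrib]

theorem linOp_zero (r : Fin B.q) : T.linOp r 0 = 0 := by
  simp only [linOp_eq, Pi.zero_apply, map_zero, Finset.sum_const_zero]

theorem lin_eq (r : Fin B.q) : T.lin r = T.linOp r fun w => gen (.anti w, 0) := by
  simp only [lin, linOp, dMulti_gen]

theorem rightDer_linOp (v : Fld B → Alg B) (r : Fin B.q) (φ : Fld B → Alg B) :
    rightDer v (T.linOp r φ) = T.linOp r fun w => rightDer v (φ w) := by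
  rw [linOp_eq, linOp_eq]
  refine (map_sum (rightDerHom v) _ _).trans (Finset.sum_congr rfl fun w _ => ?_)
  exact rightDer_diffOp v (T.D_antifieldFree r w) _

theorem linOp_mem_weightsIn {R : Type} [Semiring R] {wt : GKind B → R} {r : Fin B.q}
    {φ : Fld B → Alg B} {P Q : Fld B → Set R} {S : Set R}
    (hD : ∀ w Λ, T.D r w Λ ∈ weightsIn wt (P w))
    (hφ : ∀ w, level w = B.stage r → φ w ∈ weightsIn wt (Q w))
    (h : ∀ w, level w = B.stage r → ∀ x ∈ P w, ∀ y ∈ Q w, x + y ∈ S) :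
    T.linOp r φ ∈ weightsIn wt S := by
  rw [linOp_eq]
  refine sum_mem fun w _ => ?_
  by_cases hw : level w = B.stage r
  · exact diffOp_mem_weightsIn (hD w) (hφ w hw) (h w hw)
  · rw [T.D_eq_zero hw, diffOp_apply, Finsupp.sum_zero_index]
    exact zero_mem _

theorem linOp_mem_vanishing {r : Fin B.q} {φ : Fld B → Alg B}
    {Z : Set ((Fin B.n → ℝ) × (Fin B.m → ℝ))} (hZ : IsOpen Z)
    (h : ∀ w, level w = B.stage r → φ w ∈ vanishing Z) : T.linOp r φ ∈ vanishing Z := by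
  rw [linOp_eq]
  refine sum_mem fun w _ => ?_
  by_cases hw : level w = B.stage r
  · exact sum_mem fun Λ _ => mul_mem_vanishing_right _ (dMulti_mem_vanishing hZ Λ (h w hw))
  · rw [T.D_eq_zero hw, diffOp_apply, Finsupp.sum_zero_index]
    exact zero_mem _

/-! ### The gauge operator in terms of formal adjoints -/

theorem eta_D_ghostFree (r : Fin B.q) (w : Fld B) (Λ : MIdx B) :
    GhostFree (eta (T.D r w) Λ) :=
  ghostFree_iff.2 (eta_mem_weightsIn (fun Λ => ghostFree_iff.1 (T.D_ghostFree r w Λ)) Λ)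

theorem u_eq (w : Fld B) : T.u w = ∑ r, adjOp (T.D r w) (gen (.ghost r, 0)) := by
  simp only [u, adjOp, dMulti_gen]

theorem u_mem_weightsIn {R : Type} [Semiring R] {wt : GKind B → R} {w : Fld B}
    {P : Fin B.q → Set R} {S : Set R} (hD : ∀ r Λ, T.D r w Λ ∈ weightsIn wt (P r))
    (h : ∀ r, ∀ x ∈ P r, wt (.ghost r) + x ∈ S) : T.u w ∈ weightsIn wt S := by
  refine sum_mem fun r _ => ?_
  refine finsum_induction (· ∈ weightsIn wt S) (zero_mem _) (fun _ _ => add_mem) fun Λ => ?_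
  refine mul_mem_weightsIn (gen_mem_weightsIn (P := {wt (.ghost r)}) rfl)
    (eta_mem_weightsIn (hD r) Λ) ?_
  rintro _ rfl x hx
  exact h r x hx

theorem finite_gen_mul_eta (r : Fin B.q) (w : Fld B) : (Function.support fun Λ : MIdx B =>
    gen (.ghost r, Λ) * eta (T.D r w) Λ).Finite :=
  (finite_eta _).subset fun _ h => right_ne_zero_of_mul h

theorem pdL_u (r : Fin B.q) (Λ : MIdx B) (w : Fld B) :
    pdL (.ghost r, Λ) (T.u w) = eta (T.D r w) Λ := by
  rw [u]
  refine (map_sum (pdLHom (.ghost r, Λ)) _ _).trans ?_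
  have h (r' : Fin B.q) : pdLHom (.ghost r, Λ)
      (∑ᶠ Λ', gen (.ghost r', Λ') * eta (T.D r' w) Λ') =
      if r = r' then eta (T.D r' w) Λ else 0 := by
    refine ((pdLHom (.ghost r, Λ)).map_finsum (T.finite_gen_mul_eta r' w)).trans ?_
    have e (Λ' : MIdx B) : pdLHom (.ghost r, Λ) (gen (.ghost r', Λ') * eta (T.D r' w) Λ') =
        if r = r' ∧ Λ = Λ' then eta (T.D r' w) Λ' else 0 :=
      (T.eta_D_ghostFree r' w Λ').pdL_gen_mul r r' Λ Λ'
    rw [finsum_congr e, finsum_eq_single _ Λ]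
    · simp
    · intro Λ' hΛ
      rw [if_neg fun h => hΛ h.2.symm]
  rw [Finset.sum_congr rfl fun r' _ => h r']
  simp

/-- The part of the gauge operator that acts on ghosts. -/
theorem leftDer_ghosts_u (v : Fin B.q → Alg B) (w : Fld B) :
    leftDer (Sum.elim (fun _ => 0) v) (T.u w) = ∑ r, adjOp (T.D r w) (v r) := by
  rw [leftDer, finsum_curry _ (finite_leftDer _ _), finsum_eq_sum_of_fintype,
    Fintype.sum_sum_type]
  simp only [Sum.elim_inl, dMulti_zero, zero_mul, finsum_zero, Finset.sum_const_zero, zero_add,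
    Sum.elim_inr]
  refine Finset.sum_congr rfl fun r _ => finsum_congr fun Λ => ?_
  rw [← T.pdL_u]; rfl

/-- Only ghosts one level above `w` occur in `u^w`, as `D_r^w` vanishes for the other `r`. The stage
operator therefore acts like the whole ghost part of the gauge operator. -/
theorem uStage_u (w : Fld B) :
    T.uStage (level w + 1) (T.u w) = ∑ r, adjOp (T.D r w) (T.u (.inr r)) := by
  rw [← leftDer_ghosts_u, uStage, leftDer, leftDer]
  refine finsum_congr fun x => ?_
  obtain ⟨A | r, Λ⟩ := x
  · simp [level, dMulti_zero]
  · simp only [Sum.elim_inr]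
    split_ifs with h
    · rfl
    · rw [show pdFld (.inr r) Λ (T.u w) = pdL (.ghost r, Λ) (T.u w) from rfl, T.pdL_u,
        T.D_eq_zero fun h' => h (congrArg (· + 1) h'.symm)]
      simp [eta]

/-! ### Gauge symmetries -/

/-- The witness is the coordinate function or generator `y^i`, `c^a` or `c^r`. Nilpotency, which is
stated for antifield-free elements, can thus be tested on components. -/
theorem leftDer_coordinate (w : Fld B) : ∃ f : Alg B, AntifieldFree f ∧
    ∀ v : Fld B → Alg B, leftDer v f = v w := by
  classical
  have key (f : Alg B)
      (h : ∀ x : Fld B × MIdx B, pdFld x.1 x.2 f = if x = (w, 0) then 1 else 0)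
      (v : Fld B → Alg B) : leftDer v f = v w := by
    rw [leftDer, finsum_eq_single _ (w, 0)]
    · rw [h, if_pos rfl, mul_one, dMulti_zero_idx]
    · intro x hx
      rw [h, if_neg hx, mul_zero]
  have hbase (i : Fin B.m) (Λ : MIdx B) (g : Gen B) : pdFld (.inl (.inl i)) Λ (gen g) = 0 := by
    have := pdBase_term (B := B) (.inr (i, Λ)) ⟨Finsupp.single g 1, fun h _ => by
      rw [Finsupp.single_apply]; split_ifs <;> simp⟩ 1
    rw [show pdCoef (.inr (i, Λ)) (1 : Coef B) = 0 from (pdDer _).map_one_eq_zero,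
      term_zero] at this
    exact this
  rcases w with (i | a) | r
  · refine ⟨coef (coordFun (.inr (i, 0))), antifieldFree_iff.2 (coef_mem_weightsIn (Set.mem_singleton _) _), key _ ?_⟩
    rintro ⟨(i' | a) | r, Λ⟩
    · have := pdBase_term (B := B) (.inr (i', Λ)) ⟨0, by simp⟩ (coordFun (.inr (i, 0)))
      refine this.trans ?_
      rw [pdCoef_coordFun]
      by_cases e : i = i' ∧ 0 = Λ
      · obtain ⟨rfl, rfl⟩ := e
        rw [if_pos rfl, if_pos rfl]; rfl
      · rw [if_neg (by simpa using e), if_neg, term_zero]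
        simpa [eq_comm] using e
    · exact (pdL_coef _ _).trans (by simp)
    · exact (pdL_coef _ _).trans (by simp)
  · refine ⟨gen (.odd a, 0), antifieldFree_iff.2 (gen_mem_weightsIn rfl), key _ ?_⟩
    rintro ⟨(i' | a') | r, Λ⟩
    · exact (hbase _ _ _).trans (by simp)
    · exact (pdL_gen _ _).trans (by simp)
    · exact (pdL_gen _ _).trans (by simp)
  · refine ⟨gen (.ghost r, 0), antifieldFree_iff.2 (gen_mem_weightsIn rfl), key _ ?_⟩
    rintro ⟨(i' | a') | r', Λ⟩
    · exact (hbase _ _ _).trans (by simp)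
    · exact (pdL_gen _ _).trans (by simp)
    · exact (pdL_gen _ _).trans (by simp)

theorem u_ghostDeg (w : Fld B) : T.u w ∈ weightsIn ghostDeg {1} :=
  T.u_mem_weightsIn (P := fun _ => {0}) (fun r => T.D_ghostFree r w) fun r x hx => by
    rw [Set.mem_singleton_iff] at hx
    subst hx
    rfl

theorem uStage_u_eq_zero {γ : Fin B.q → Alg B} (hγ : T.IsBRSTExtension γ) (w : Fld B) :
    T.uStage (level w + 1) (T.u w) = 0 := by
  -- The BRST operator is split into three parts with different effect on the ghost degree: `𝐮` on
  -- fields, `𝐮` on ghosts, and `γ`.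
  let uF : Fld B → Alg B := Sum.elim (fun A => T.u (.inl A)) fun _ => 0
  let uG : Fld B → Alg B := Sum.elim (fun _ => 0) fun r => T.u (.inr r)
  let γ' : Fld B → Alg B := Sum.elim (fun _ => 0) γ
  let v : Fld B → Alg B := fun w => uG w + (uF w + γ' w)
  have hv : (Sum.elim (fun A => T.u (.inl A)) fun r => T.u (.inr r) + γ r) = v := by
    funext w
    rcases w with A | r <;> simp [v, uG, uF, γ']
  have hw : v w = T.u w + γ' w := by
    rcases w with A | r <;> simp [v, uG, uF, γ']
  obtain ⟨f, hf, hfv⟩ := leftDer_coordinate w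
  have h0 := hγ.nilpotent f hf
  rw [brst, hv, hfv, hw, leftDer_add] at h0
  rw [leftDer_add_left, leftDer_add_left (v := uF)] at h0
  have hγ' (w : Fld B) : γ' w ∈ weightsIn ghostDeg {x | 2 ≤ x} := by
    rcases w with A | r
    · exact zero_mem _
    · exact hγ.degree r
  -- The empty set encodes that `uG` does not act on fields. The same is done for `uF` on ghosts and
  -- for `γ'` on fields.
  have huG (w : Fld B) : uG w ∈ weightsIn ghostDeg (Sum.elim (fun _ => ∅) (fun _ => {1}) w) := by
    rcases w with A | r
    · exact zero_mem _
    · exact T.u_ghostDeg _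
  have huF (w : Fld B) : uF w ∈ weightsIn ghostDeg {1} := by
    rcases w with A | r
    · exact T.u_ghostDeg _
    · exact zero_mem _
  -- A ghost is replaced by an expression linear in ghosts: the degree stays one.
  have h1 : leftDer uG (T.u w) ∈ weightsIn ghostDeg {1} := by
    refine leftDer_mem_weightsIn (T.u_ghostDeg w) huG ?_
    rintro (A | r) d hd e he
    · exact he.elim
    · simp only [fldWeight, ghostDeg, Set.mem_singleton_iff, Sum.elim_inr] at *
      omega
  have huF' (w : Fld B) : uF w ∈ weightsIn ghostDeg (Sum.elim (fun _ => {1}) (fun _ => ∅) w) := by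
    rcases w with A | r
    · exact T.u_ghostDeg _
    · exact zero_mem _
  have hγ'' (w : Fld B) :
      γ' w ∈ weightsIn ghostDeg (Sum.elim (fun _ => ∅) (fun _ => {x | 2 ≤ x}) w) := by
    rcases w with A | r
    · exact zero_mem _
    · exact hγ.degree r
  -- A function of the fields is differentiated and the ghost of `u^w` is kept, so the component
  -- adds one degree.
  have h2 : leftDer uF (T.u w) ∈ weightsIn ghostDeg {x | 2 ≤ x} := by
    refine leftDer_mem_weightsIn (T.u_ghostDeg w) huF' ?_
    rintro ((i | a) | r) d hd e he
    · simp only [fldWeight, Set.mem_singleton_iff, Sum.elim_inl, Set.mem_ofPred_eq] at *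
      omega
    · simp only [fldWeight, ghostDeg, Set.mem_singleton_iff, Sum.elim_inl,
        Set.mem_ofPred_eq] at *
      omega
    · exact he.elim
  have h3 : leftDer γ' (T.u w) ∈ weightsIn ghostDeg {x | 2 ≤ x} := by
    refine leftDer_mem_weightsIn (T.u_ghostDeg w) hγ'' ?_
    rintro (A | r) d hd e he
    · exact he.elim
    · simp only [Sum.elim_inr, Set.mem_ofPred_eq] at *
      omega
  have hv' (w : Fld B) : v w ∈ weightsIn ghostDeg {x | 1 ≤ x} := by
    refine add_mem ?_ (add_mem ?_ (weightsIn_mono (fun (x : ℕ) (hx : 2 ≤ x) => one_le_two.trans hx)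
      (hγ' w)))
    · refine weightsIn_mono ?_ (huG w)
      rcases w with A | r
      · exact Set.empty_subset _
      · rintro _ rfl; exact le_refl 1
    · refine weightsIn_mono ?_ (huF w)
      rintro _ rfl; exact le_refl 1
  -- No component of `v` has ghost degree zero, so `v` cannot lower the degree of `γ`.
  have h4 : leftDer v (γ' w) ∈ weightsIn ghostDeg {x | 2 ≤ x} := by
    refine leftDer_mem_weightsIn (hγ' w) hv' ?_
    rintro ((i | a) | r) d hd e he <;>
    · simp only [fldWeight, ghostDeg, Set.mem_ofPred_eq] at *
      omega
  rw [uStage_u, ← leftDer_ghosts_u]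
  refine eq_zero_of_mem_weightsIn h1 (Q := {x | 2 ≤ x}) ?_ ?_
  · have : leftDer uG (T.u w) = -(leftDer uF (T.u w) + leftDer γ' (T.u w) + leftDer v (γ' w)) := by
      rw [eq_neg_iff_add_eq_zero, ← h0]; abel
    rw [this]
    exact neg_mem (add_mem (add_mem h2 h3) h4)
  · rw [Set.disjoint_singleton_left]
    simp

/-! ### Noether identities -/

theorem linOp_linOp_eq_zero (hu : ∀ w, T.uStage (level w + 1) (T.u w) = 0) (r : Fin B.q)
    {φ : Fld B → Alg B} (hφ : ∀ w, GhostFree (φ w)) :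
    T.linOp r (Sum.elim (fun _ => 0) fun r' => T.linOp r' φ) = 0 := by
  have h1 : T.linOp r (Sum.elim (fun _ => 0) fun r' => T.linOp r' φ) =
      ∑ w, ∑ r', diffOp (T.D r (.inr r')) (diffOp (T.D r' w) (φ w)) := by
    rw [linOp_eq, Fintype.sum_sum_type]
    simp only [Sum.elim_inl, map_zero, Finset.sum_const_zero, zero_add, Sum.elim_inr, linOp_eq,
      map_sum]
    exact Finset.sum_comm
  rw [h1]
  refine Finset.sum_eq_zero fun w _ => ?_
  have hD (r r' : Fin B.q) : GhostFree (diffOp (T.D r (.inr r')) (diffOp (T.D r' w) (φ w))) := by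
    refine ghostFree_iff.2 <| diffOp_mem_weightsIn (P := {0}) (Q := {0}) (T.D_ghostFree r (.inr r'))
      (diffOp_mem_weightsIn (P := {0}) (Q := {0}) (T.D_ghostFree r' w) (hφ w) ?_) ?_ <;>
    · rintro _ rfl _ rfl; rfl
  have h2 (r'' : Fin B.q) :
      GhostFree (∑ r', diffOp (T.D r'' (.inr r')) (diffOp (T.D r' w) (φ w))) :=
    sum_mem (S := weightsIn ghostDeg {0}) fun r' _ => hD r'' r'
  -- The gauge symmetry condition is paired with the test element `φ w`.
  have h3 : euler r (T.uStage (level w + 1) (T.u w) * φ w) = 0 := by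
    rw [hu, zero_mul, map_zero]
  rw [uStage_u, Finset.sum_mul, map_sum] at h3
  -- Both adjoints are moved to the right, the outer one first. This reverses the composition and
  -- leaves an undifferentiated ghost on the left.
  simp only [euler_adjOp_mul, u_eq, Finset.sum_mul, map_sum] at h3
  rw [Finset.sum_comm] at h3
  have h4 (r'' : Fin B.q) : ∑ r', euler r (gen (.ghost r'', 0) *
      diffOp (T.D r'' (.inr r')) (diffOp (T.D r' w) (φ w))) = euler r (gen (.ghost r'', 0) *
        ∑ r', diffOp (T.D r'' (.inr r')) (diffOp (T.D r' w) (φ w))) := by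
    rw [← map_sum, Finset.mul_sum]
  simp only [h4] at h3
  simpa only [euler_gen_mul r _ (h2 _), Finset.sum_ite_eq, Finset.mem_univ, if_true] using h3

end PreTheory

/-! ### The Koszul–Tate operator -/

theorem forall_add_mem_singleton {R : Type} [Semiring R] {x y z : R}
    (h : x + y = z) : ∀ x' ∈ ({x} : Set R), ∀ y' ∈ ({y} : Set R), x' + y' ∈ ({z} : Set R) := by
  rintro _ rfl _ rfl
  exact h

theorem rightDer_add_left (v v' : Fld B → Alg B) (f : Alg B) :
    rightDer (fun w => v w + v' w) f = rightDer v f + rightDer v' f := by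
  simp only [rightDer, dMulti_add, mul_add]
  exact finsum_add_distrib (finite_rightDer v f) (finite_rightDer v' f)

theorem zmod_two_add_self (a : ZMod 2) : a + a = 0 := CharTwo.add_self_eq_zero a

theorem fldWeight_par (w : Fld B) : fldWeight GKind.par w = fldPar w := by
  rcases w with (i | a) | r <;> rfl

namespace PreTheory

variable (T : PreTheory B)

theorem EL_mem_weightsIn {R : Type} [Semiring R] {wt : GKind B → R} {A : SIdx B}
    {P Q : Set R} (hL : T.L ∈ weightsIn wt P) (h : ∀ d, d + fldWeight wt (.inl A) ∈ P → d ∈ Q) :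
    T.EL A ∈ weightsIn wt Q :=
  finsum_induction (· ∈ weightsIn wt Q) (zero_mem _) (fun _ _ => add_mem) fun Λ =>
    zsmul_mem (dMulti_mem_weightsIn Λ (pdFld_mem_weightsIn Λ hL h)) _

theorem EL_antifieldFree (A : SIdx B) : AntifieldFree (T.EL A) :=
  antifieldFree_iff.2 <| T.EL_mem_weightsIn (P := {0}) T.L_antifieldFree fun d hd => by
    rcases A with i | a <;> simpa [fldWeight, antiDeg] using hd

theorem EL_par (A : SIdx B) : T.EL A ∈ weightsIn GKind.par {fldPar (.inl A)} :=
  T.EL_mem_weightsIn (P := {0}) T.L_even fun d hd => by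
    rw [fldWeight_par, Set.mem_singleton_iff] at hd
    rw [Set.mem_singleton_iff, ← CharTwo.sub_eq_add] at *
    exact sub_eq_zero.1 hd

theorem lin_mem_weightsIn {R : Type} [Semiring R] {wt : GKind B → R} {r : Fin B.q}
    {P : Fld B → Set R} {S : Set R} (hD : ∀ w Λ, T.D r w Λ ∈ weightsIn wt (P w))
    (h : ∀ w, level w = B.stage r → ∀ x ∈ P w, x + wt (.anti w) ∈ S) :
    T.lin r ∈ weightsIn wt S := by
  rw [lin_eq]
  refine T.linOp_mem_weightsIn (Q := fun w => {wt (.anti w)}) hD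
    (fun w _ => gen_mem_weightsIn rfl) fun w hw x hx y hy => ?_
  rw [Set.mem_singleton_iff] at hy
  subst hy
  exact h w hw x hx

theorem lin_antiDeg (r : Fin B.q) : T.lin r ∈ weightsIn antiDeg {1} :=
  T.lin_mem_weightsIn (P := fun _ => {0}) (T.D_antifieldFree r) fun w _ x hx => by
    rw [Set.mem_singleton_iff] at hx
    subst hx
    rfl

theorem h_antiDeg (r : Fin B.q) : T.h r ∈ weightsIn antiDeg {x | 2 ≤ x} := T.h_degree r

theorem Del_antiDeg (r : Fin B.q) : T.Del r ∈ weightsIn antiDeg {x | 1 ≤ x} :=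
  add_mem (weightsIn_mono (by rintro _ rfl; exact le_refl 1) (T.lin_antiDeg r))
    (weightsIn_mono (fun (x : ℕ) (hx : 2 ≤ x) => one_le_two.trans hx) (T.h_antiDeg r))

theorem Del_par (r : Fin B.q) : T.Del r ∈ weightsIn GKind.par {B.par r + 1} := by
  refine add_mem ?_ (T.h_par r)
  refine T.lin_mem_weightsIn (P := fun w => {(B.par r + 1) + (fldPar w + 1)}) (T.D_par r)
    fun w _ x hx => ?_
  rw [Set.mem_singleton_iff] at hx
  subst hx
  rw [Set.mem_singleton_iff, GKind.par, add_assoc, zmod_two_add_self, add_zero]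

theorem deltaKT_par {f : Alg B} {e : ZMod 2} (hf : f ∈ weightsIn GKind.par {e}) :
    T.deltaKT f ∈ weightsIn GKind.par {e + 1} := by
  refine rightDer_mem_weightsIn (V := fun w => {fldPar w}) hf ?_ ?_
  · rintro (A | r)
    · exact T.EL_par A
    · exact T.Del_par r
  · rintro w d hd _ rfl
    rw [Set.mem_singleton_iff, GKind.par] at hd
    rw [Set.mem_singleton_iff, ← hd, add_assoc, add_assoc, zmod_two_add_self, add_zero]

theorem deltaKT_linOp {r : Fin B.q} (φ : Fld B → Alg B) :
    T.deltaKT (T.linOp r φ) = T.linOp r fun w => T.deltaKT (φ w) := T.rightDer_linOp _ r φ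

theorem deltaKT_gen (r : Fin B.q) : T.deltaKT (gen (.anti (.inr r), 0)) = T.Del r :=
  rightDer_gen _ _

/-- For positive stage the antifields `s̄_A` do not occur in the linear part, so `E_A` does not
enter. -/
theorem deltaKT_lin {r : Fin B.q} (hr : B.stage r ≠ 0) :
    T.deltaKT (T.lin r) = T.linOp r (Sum.elim (fun _ => 0) T.Del) := by
  rw [lin_eq, deltaKT_linOp]
  refine T.linOp_congr ?_
  rintro (A | r') hw
  · exact absurd hw.symm hr
  · exact T.deltaKT_gen r'

theorem ghostFree_gen_anti (w : Fld B) : GhostFree (gen (.anti w, 0) : Alg B) :=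
  ghostFree_iff.2 (gen_mem_weightsIn rfl)

/-- The test elements are the antifields themselves, which are ghost-free. -/
theorem linOp_lin_eq_zero (hu : ∀ w, T.uStage (level w + 1) (T.u w) = 0) (r : Fin B.q) :
    T.linOp r (Sum.elim (fun _ => 0) T.lin) = 0 := by
  have : T.lin = fun r' => T.linOp r' fun w => gen (.anti w, 0) := funext T.lin_eq
  rw [this]
  exact T.linOp_linOp_eq_zero hu r ghostFree_gen_anti

theorem linOp_Del (hu : ∀ w, T.uStage (level w + 1) (T.u w) = 0) (r : Fin B.q) :
    T.linOp r (Sum.elim (fun _ => 0) T.Del) = T.linOp r (Sum.elim (fun _ => 0) T.h) := by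
  have : (Sum.elim (fun _ => 0) T.Del : Fld B → Alg B) =
      Sum.elim (fun _ => 0) T.lin + Sum.elim (fun _ => 0) T.h := by
    funext w
    rcases w with A | r
    · simp
    · rfl
  rw [this, linOp_add, T.linOp_lin_eq_zero hu, zero_add]

/-- The cycle condition for `Δ_r` in terms of its part of higher degree in antifields. -/
theorem linOp_h_add_deltaKT_h (hT : ∀ f, GhostFree f → T.deltaKT (T.deltaKT f) = 0)
    (hu : ∀ w, T.uStage (level w + 1) (T.u w) = 0) {r : Fin B.q} (hr : B.stage r ≠ 0) :
    T.linOp r (Sum.elim (fun _ => 0) T.h) + T.deltaKT (T.h r) = 0 := by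
  have := hT _ (ghostFree_gen_anti (.inr r))
  rw [deltaKT_gen, Del] at this
  rw [← T.linOp_Del hu, ← T.deltaKT_lin hr, ← this]
  exact (rightDer_add _ _ _).symm

theorem antiPart_two_h (r : Fin B.q) : ∃ h₃ ∈ weightsIn antiDeg {x | 3 ≤ x},
    T.h r = antiPart 2 (T.h r) + h₃ := by
  classical
  refine ⟨Alg.raw.symm ((T.h r).raw.filter fun α => ¬ weight antiDeg α = 2), ?_, ?_⟩
  · intro α hα
    have h1 : ¬ weight antiDeg α = 2 := by
      by_contra h
      exact hα (Finsupp.filter_apply_neg _ _ (by simpa using h))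
    have h2 : (T.h r).raw α ≠ 0 := fun h => hα (by
      refine (Finsupp.filter_apply_pos (fun α => ¬ weight antiDeg α = 2) _ h1).trans h)
    have := T.h_degree r α h2
    change 3 ≤ _
    omega
  · exact Alg.raw.injective (Finsupp.filter_add_filter_not (T.h r).raw _).symm

theorem antiPart_antiDeg (d : ℕ) (f : Alg B) : antiPart d f ∈ weightsIn antiDeg {d} := by
  classical
  intro α hα
  by_contra h
  exact hα (Finsupp.filter_apply_neg _ _ h)

/-- The parts of `δ_KT` that act by `Δ` do not lower the degree in antifields, whereas `δ̄` lowers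
it by one. In the cycle condition only `δ̄` of the quadratic part has degree one. -/
theorem deltaBar_antiPart_h (hT : ∀ f, GhostFree f → T.deltaKT (T.deltaKT f) = 0)
    (hu : ∀ w, T.uStage (level w + 1) (T.u w) = 0) {r : Fin B.q} (hr : B.stage r ≠ 0) :
    T.deltaBar (antiPart 2 (T.h r)) = 0 := by
  obtain ⟨h₃, hh₃, e⟩ := T.antiPart_two_h r
  set h₂ := antiPart 2 (T.h r) with h₂_def
  have hh₂ : h₂ ∈ weightsIn antiDeg {2} := antiPart_antiDeg 2 _
  let vE : Fld B → Alg B := Sum.elim T.EL fun _ => 0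
  let vD : Fld B → Alg B := Sum.elim (fun _ => 0) T.Del
  have hv : (Sum.elim T.EL T.Del : Fld B → Alg B) = fun w => vE w + vD w := by
    funext w
    rcases w with A | r <;> simp [vE, vD]
  have h0 := T.linOp_h_add_deltaKT_h hT hu hr
  rw [e, deltaKT, hv, rightDer_add, rightDer_add_left vE vD h₂] at h0
  have hvE (w : Fld B) : vE w ∈ weightsIn antiDeg {0} := by
    rcases w with A | r
    · exact antifieldFree_iff.1 (T.EL_antifieldFree A)
    · exact zero_mem _
  have hvD (w : Fld B) : vD w ∈ weightsIn antiDeg {x | 1 ≤ x} := by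
    rcases w with A | r
    · exact zero_mem _
    · exact T.Del_antiDeg r
  have a1 : T.linOp r (Sum.elim (fun _ => 0) T.h) ∈ weightsIn antiDeg {x | 2 ≤ x} := by
    refine T.linOp_mem_weightsIn (P := fun _ => {0}) (Q := fun _ => {x | 2 ≤ x})
      (T.D_antifieldFree r) ?_ ?_
    · rintro (A | r') -
      · exact zero_mem _
      · exact T.h_antiDeg r'
    · rintro w - _ rfl y hy
      rwa [zero_add]
  have a2 : rightDer vE h₂ ∈ weightsIn antiDeg {1} := by
    refine rightDer_mem_weightsIn hh₂ hvE fun w d hd e he => ?_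
    simp only [antiDeg, Set.mem_singleton_iff] at *
    omega
  have a3 : rightDer vD h₂ ∈ weightsIn antiDeg {x | 2 ≤ x} := by
    refine rightDer_mem_weightsIn hh₂ hvD fun w d hd e he => ?_
    simp only [antiDeg, Set.mem_singleton_iff, Set.mem_ofPred_eq] at *
    omega
  -- Terms of degree at least three lose at most one antifield, so nothing about the inserted
  -- components is needed.
  have a4 : rightDer (fun w => vE w + vD w) h₃ ∈ weightsIn antiDeg {x | 2 ≤ x} := by
    refine rightDer_mem_weightsIn (V := fun _ => Set.univ) hh₃ (fun w α _ => trivial)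
      fun w d hd e he => ?_
    simp only [antiDeg, Set.mem_ofPred_eq] at *
    omega
  refine eq_zero_of_mem_weightsIn (f := T.deltaBar h₂) a2 (Q := {x | 2 ≤ x}) ?_ ?_
  · have : T.deltaBar h₂ = -(T.linOp r (Sum.elim (fun _ => 0) T.h) + rightDer vD h₂ +
        rightDer (fun w => vE w + vD w) h₃) := by
      rw [eq_neg_iff_add_eq_zero]
      refine Eq.trans ?_ h0
      change rightDer vE h₂ + _ = _
      abel
    rw [this]
    exact neg_mem (add_mem (add_mem a1 a3) a4)
  · rw [Set.disjoint_singleton_left]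
    simp

end PreTheory

/-! ### Cutoff functions -/

theorem coef_mul_mem_vanishing {Z : Set ((Fin B.n → ℝ) × (Fin B.m → ℝ))} {χ : Coef B}
    (hχ : χ ∈ vanishCoef Z) (f : Alg B) : coef χ * f ∈ vanishing Z :=
  mul_mem_vanishing_left (term_mem_vanishing 0 hχ) f

theorem mem_vanishing_univ {f : Alg B} : f ∈ vanishing Set.univ ↔ f = 0 := by
  refine ⟨fun h => Alg.raw.injective (Finsupp.ext fun α => Subtype.ext (funext fun z => ?_)),
    fun h => h ▸ zero_mem _⟩
  exact h α z trivial

theorem coef_mul_eq_zero {Z : Set ((Fin B.n → ℝ) × (Fin B.m → ℝ))} {χ : Coef B}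
    (hχ : χ ∈ vanishCoef Zᶜ) {f : Alg B} (hf : f ∈ vanishing Z) : coef χ * f = 0 := by
  rw [← mem_vanishing_univ]
  intro α z _
  by_cases hz : base B z.1 ∈ Z
  · exact mul_mem_vanishing_right (coef χ) hf α z hz
  · exact coef_mul_mem_vanishing hχ f α z hz

/-- A smooth function on the coordinate domain as a function on the jet space. -/
def baseFun (g : (Fin B.n → ℝ) × (Fin B.m → ℝ) → ℝ) (hg : ContDiff ℝ ∞ g) : Coef B :=
  ⟨fun z => g (base B z.1), by
    classical
    let S : Finset (Coord B) := Finset.univ.image Sum.inl ∪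
      Finset.univ.image fun i => Sum.inr (i, 0)
    have h1 (l : Fin B.n) : (Sum.inl l : Coord B) ∈ S := by simp [S]
    have h2 (i : Fin B.m) : (Sum.inr (i, 0) : Coord B) ∈ S := by simp [S]
    refine ⟨S, fun w => g (fun l => w ⟨_, h1 l⟩, fun i => w ⟨_, h2 i⟩), fun z => rfl, ?_⟩
    refine (hg.comp ?_).contDiffOn
    fun_prop⟩

theorem exists_smooth_cutoff {E : Type*} [NormedAddCommGroup E] [NormedSpace ℝ E]
    [FiniteDimensional ℝ E] {s t : Set E} (hs : IsClosed s) (h : s ⊆ interior t) :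
    ∃ g : E → ℝ, ContDiff ℝ ∞ g ∧ (∀ x ∈ s, g x = 1) ∧ ∀ x ∉ t, g x = 0 := by
  obtain ⟨f, h1, h2, -⟩ := exists_contMDiffMap_one_nhds_of_subset_interior
    (n := (⊤ : ℕ∞)) (modelWithCornersSelf ℝ E) hs h
  exact ⟨f, f.contMDiff.contDiff, fun x hx => (h1.self_of_nhdsSet) x hx, h2⟩

theorem IsChain.coef_mul {f : Alg B} {j d : ℕ} (hf : IsChain j d f) (χ : Coef B) :
    IsChain j d (coef χ * f) := by
  obtain ⟨h1, h2, h3⟩ := isChain_iff.1 hf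
  refine isChain_iff.2 ⟨?_, ?_, ?_⟩
  · exact mul_mem_weightsIn (coef_mem_weightsIn (P := {0}) rfl χ) h1
      (forall_add_mem_singleton (zero_add _))
  · exact mul_mem_weightsIn (coef_mem_weightsIn (P := {0}) rfl χ) h2
      (forall_add_mem_singleton (zero_add _))
  · exact mul_mem_weightsIn (coef_mem_weightsIn (P := {0}) rfl χ) h3
      (forall_add_mem_singleton (zero_add _))

/-- The homology condition does not prescribe the parity of the bounding element; this permits
projecting to the right parity without introducing new monomials. -/
theorem exists_parity_decomposition (f : Alg B) (e : ZMod 2) : ∃ f₀ f₁ : Alg B, f = f₀ + f₁ ∧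
    f₀ ∈ weightsIn GKind.par {e} ∧ f₁ ∈ weightsIn GKind.par {e + 1} ∧
    ∀ α, f₀.raw α ≠ 0 → f.raw α ≠ 0 := by
  classical
  refine ⟨Alg.raw.symm (f.raw.filter fun α => weight GKind.par α = e),
    Alg.raw.symm (f.raw.filter fun α => ¬ weight GKind.par α = e),
    Alg.raw.injective (Finsupp.filter_add_filter_not f.raw _).symm, ?_, ?_, ?_⟩
  · intro α hα
    by_contra h
    exact hα (Finsupp.filter_apply_neg _ _ h)
  · intro α hα
    have h1 : ¬ weight GKind.par α = e := by
      by_contra h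
      exact hα (Finsupp.filter_apply_neg _ _ (by simpa using h))
    have key : ∀ a b : ZMod 2, ¬ a = b → a = b + 1 := by decide
    exact key _ _ h1
  · intro α hα h
    refine hα ?_
    change f.raw.filter (fun α => weight GKind.par α = e) α = 0
    rw [Finsupp.filter_apply, h, ite_self]

/-! ### Reduction to the linear part -/

namespace PreTheory

variable (T : PreTheory B)

/-- Every cycle over `U` is a boundary over `U'`. -/
def SolvesOver (U U' : Set ((Fin B.n → ℝ) × (Fin B.m → ℝ))) : Prop :=
  ∀ j ≤ B.N, ∀ (φ : Alg B) (e : ZMod 2), IsChain j (j + 2) φ →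
    φ ∈ weightsIn GKind.par {e + 1} → T.deltaKT φ ∈ vanishing U →
    ∃ ψ : Alg B, IsChain (j + 1) (j + 3) ψ ∧ ψ ∈ weightsIn GKind.par {e} ∧
      T.deltaKT ψ - φ ∈ vanishing U'

theorem deltaKT_coef_mul (χ : Coef B) (f : Alg B) :
    T.deltaKT (coef χ * f) = coef χ * T.deltaKT f :=
  rightDer_mul_of_eq_zero _ (fun _ _ => pdR_coef _ _) f

/-- The product `χ φ` is a genuine cycle supported over `K`: where `δ_KT φ` may be nonzero, `χ` is
zero. Its bounding element solves the equation for `φ` wherever `χ = 1`. -/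
theorem HomologyCondition.solvesOver {K U U' : Set ((Fin B.n → ℝ) × (Fin B.m → ℝ))}
    (h : T.HomologyCondition K) (hKU : K ⊆ U) {χ : Coef B} (h0 : χ ∈ vanishCoef Kᶜ)
    (h1 : χ - 1 ∈ vanishCoef U') : T.SolvesOver U U' := by
  intro j hj φ e hφ hpar hcyc
  have h0' : χ ∈ vanishCoef Uᶜ := fun z hz => h0 z fun hz' => hz (hKU hz')
  obtain ⟨ψ, hψ, hδ⟩ := h j hj (coef χ * φ) (hφ.coef_mul χ)
    (coef_mul_mem_vanishing h0 φ) (by rw [deltaKT_coef_mul, coef_mul_eq_zero h0' hcyc])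
  obtain ⟨ψ₀, ψ₁, hadd, hp0, hp1, hsub⟩ := exists_parity_decomposition ψ e
  have hd : T.deltaKT ψ₀ + T.deltaKT ψ₁ = coef χ * φ := by
    rw [← hδ, hadd]; exact (rightDer_add _ _ _).symm
  have hχφ : coef χ * φ ∈ weightsIn GKind.par {e + 1} :=
    mul_mem_weightsIn (coef_mem_weightsIn (P := {0}) rfl χ) hpar
      (forall_add_mem_singleton (zero_add _))
  -- Its boundary has parity `e`, but it is also a difference of elements of parity `e + 1`.
  have h2 : T.deltaKT ψ₁ = 0 := by
    refine eq_zero_of_mem_weightsIn (T.deltaKT_par hp1) (Q := {e + 1}) ?_ ?_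
    · rw [eq_sub_of_add_eq' hd]
      exact sub_mem hχφ (T.deltaKT_par hp0)
    · rw [Set.disjoint_singleton]
      simp
  refine ⟨ψ₀, ?_, hp0, ?_⟩
  · exact ⟨fun α hα => hψ.1 α (hsub α hα), fun α hα => hψ.2.1 α (hsub α hα),
      fun α hα => hψ.2.2 α (hsub α hα)⟩
  · have h3 : T.deltaKT ψ₀ - φ = coef (χ - 1) * φ := by
      have : coef (χ - 1) = coef χ - 1 := (termHom 0).map_sub χ 1
      rw [this, sub_mul, one_mul, ← hd, h2, add_zero]
    rw [h3]
    exact coef_mul_mem_vanishing h1 φ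

/-- Every antifield has antifield number at least one, and the total is one, so two antifields do
not fit. -/
theorem h_eq_zero {r : Fin B.q} (hr : B.stage r = 0) : T.h r = 0 := by
  refine eq_zero_of_mem_weightsIn_empty (wt := antiDeg) fun α hα => ?_
  have h1 := T.h_degree r α hα
  have h2 : weight antiNum α = B.stage r + 1 := T.h_antiNum r α hα
  have h3 : weight antiDeg α ≤ weight antiNum α := preWeight_le antiDeg_le_antiNum α.1
  omega

/-- Each term has a second antifield, which uses up at least one of the total `k + 2`. Any antifield
that occurs thus has number at most `k + 1`, that is, level at most `k`. -/
theorem h_isChain {r : Fin B.q} {k : ℕ} (hr : B.stage r = k + 1) :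
    IsChain k (k + 2) (T.h r) := by
  refine ⟨T.h_ghostFree r, fun α hα => by rw [T.h_antiNum r α hα, hr], ?_⟩
  intro α hα w Λ hw
  have h1 : 2 ≤ preWeight antiDeg α.1 := T.h_degree r α hα
  have h2 : preWeight antiNum α.1 = B.stage r + 1 := T.h_antiNum r α hα
  rw [← preWeight_sub hw] at h1 h2
  have h3 := preWeight_le antiDeg_le_antiNum (α.1 - Finsupp.single (.anti w, Λ) 1)
  simp only [antiDeg, antiNum] at h1 h2
  omega

/-- The correction `h_r + ∑ D_r^{r',Λ} d_Λ ψ_{r'}` to be removed at the next stage. -/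
def defect (ψ : Fin B.q → Alg B) (r : Fin B.q) : Alg B :=
  T.h r + T.linOp r (Sum.elim (fun _ => 0) ψ)

theorem defect_of_stage_eq_zero (ψ : Fin B.q → Alg B) {r : Fin B.q} (hr : B.stage r = 0) :
    T.defect ψ r = 0 := by
  rw [defect, T.h_eq_zero hr, zero_add]
  refine (T.linOp_congr (φ' := 0) ?_).trans (T.linOp_zero r)
  rintro (A | r') hw
  · rfl
  · simp [level, hr] at hw

/-- Choosing `ψ` at one stage leaves the defects of that stage and of the lower ones unchanged, so
the induction does not spoil what is already solved. -/
theorem defect_congr {ψ ψ' : Fin B.q → Alg B} {r : Fin B.q}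
    (h : ∀ r', B.stage r' < B.stage r → ψ r' = ψ' r') : T.defect ψ r = T.defect ψ' r := by
  rw [defect, defect, T.linOp_congr]
  rintro (A | r') hw
  · rfl
  · exact h r' (by rw [← hw]; exact Nat.lt_succ_self _)

theorem defect_isChain {ψ : Fin B.q → Alg B}
    (hψ : ∀ r, IsChain (B.stage r) (B.stage r + 2) (ψ r)) {r : Fin B.q} {k : ℕ}
    (hr : B.stage r = k + 1) : IsChain k (k + 2) (T.defect ψ r) := by
  obtain ⟨h1, h2, h3⟩ := isChain_iff.1 (T.h_isChain hr)
  have hs (r' : Fin B.q) (hr' : level (.inr r') = B.stage r) : IsChain k (k + 2) (ψ r') := by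
    have : B.stage r' = k := by
      have : B.stage r' + 1 = B.stage r := hr'
      omega
    exact this ▸ hψ r'
  refine isChain_iff.2 ⟨add_mem h1 ?_, add_mem h2 ?_, add_mem h3 ?_⟩
  · refine T.linOp_mem_weightsIn (P := fun _ => {0}) (Q := fun _ => {0}) (T.D_ghostFree r) ?_
      fun w _ => forall_add_mem_singleton (zero_add _)
    rintro (A | r') hw
    · exact zero_mem _
    · exact (isChain_iff.1 (hs r' hw)).1
  · refine T.linOp_mem_weightsIn (P := fun _ => {0}) (Q := fun _ => {k + 2})
      (fun w Λ => (T.D_antifieldFree r w Λ).antiNum) ?_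
      fun w _ => forall_add_mem_singleton (zero_add _)
    rintro (A | r') hw
    · exact zero_mem _
    · exact (isChain_iff.1 (hs r' hw)).2.1
  · refine T.linOp_mem_weightsIn (P := fun _ => {0}) (Q := fun _ => {0})
      (fun w Λ => (T.D_antifieldFree r w Λ).highDeg k) ?_
      fun w _ => forall_add_mem_singleton (zero_add _)
    rintro (A | r') hw
    · exact zero_mem _
    · exact (isChain_iff.1 (hs r' hw)).2.2

theorem defect_par {ψ : Fin B.q → Alg B} (hψ : ∀ r, ψ r ∈ weightsIn GKind.par {B.par r})
    (r : Fin B.q) : T.defect ψ r ∈ weightsIn GKind.par {B.par r + 1} := by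
  refine add_mem (T.h_par r) ?_
  refine T.linOp_mem_weightsIn (P := fun w => {(B.par r + 1) + (fldPar w + 1)})
    (Q := fun w => {fldPar w + 1}) (T.D_par r) ?_ fun w _ => forall_add_mem_singleton ?_
  · rintro (A | r') hw
    · exact zero_mem _
    · have : fldPar (.inr r') + 1 = B.par r' := by
        rw [fldPar, add_assoc, zmod_two_add_self, add_zero]
      rw [this]
      exact hψ r'
  · rw [add_assoc, zmod_two_add_self, add_zero]

/-- `δ_KT` of the correction only involves the defects of the previous stages. -/
theorem deltaKT_defect (hT : ∀ f, GhostFree f → T.deltaKT (T.deltaKT f) = 0)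
    (hu : ∀ w, T.uStage (level w + 1) (T.u w) = 0) {ψ : Fin B.q → Alg B}
    (hψ : ∀ r, GhostFree (ψ r)) {r : Fin B.q} (hr : B.stage r ≠ 0) :
    T.deltaKT (T.defect ψ r) =
      T.linOp r (Sum.elim (fun _ => 0) fun r' => T.deltaKT (ψ r') - T.defect ψ r') := by
  have h1 : T.deltaKT (T.defect ψ r) = T.deltaKT (T.h r) +
      T.linOp r fun w => T.deltaKT (Sum.elim (fun _ => 0) ψ w) := by
    rw [← deltaKT_linOp]
    exact rightDer_add _ _ _
  have h2 : (Sum.elim (fun _ => 0) fun r' => T.deltaKT (ψ r') - T.defect ψ r' : Fld B → Alg B) =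
      (fun w => T.deltaKT (Sum.elim (fun _ => 0) ψ w)) - (Sum.elim (fun _ => 0) T.h +
        Sum.elim (fun _ => 0) fun r' => T.linOp r' (Sum.elim (fun _ => 0) ψ)) := by
    funext w
    rcases w with A | r'
    · simp only [Sum.elim_inl, Pi.sub_apply, Pi.add_apply, add_zero, sub_zero]
      exact (rightDer_zero _).symm
    · rfl
  have h3 : ∀ w, GhostFree ((Sum.elim (fun _ => 0) ψ : Fld B → Alg B) w) := by
    rintro (A | r')
    · exact ghostFree_iff.2 (zero_mem _)
    · exact hψ r'
  -- The composite `D D ψ` hidden in the lower defects vanishes, and the `h` terms match by the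
  -- cycle condition for `Δ_r`.
  rw [h1, h2, linOp_sub, linOp_add, T.linOp_linOp_eq_zero hu r h3, add_zero,
    eq_neg_of_add_eq_zero_right (T.linOp_h_add_deltaKT_h hT hu hr)]
  abel

/-- The antifields can be changed successively, each stage over a smaller set. -/
theorem exists_reduction (hT : ∀ f, GhostFree f → T.deltaKT (T.deltaKT f) = 0)
    (hu : ∀ w, T.uStage (level w + 1) (T.u w) = 0)
    {C : Set (Set ((Fin B.n → ℝ) × (Fin B.m → ℝ)))} (hC : C.Nonempty)
    (hopen : ∀ U ∈ C, IsOpen U)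
    (hstep : ∀ U ∈ C, ∃ U' ∈ C, U' ⊆ U ∧ T.SolvesOver U U') (k : ℕ) :
    ∃ U ∈ C, ∃ ψ : Fin B.q → Alg B, (∀ r, B.stage r = 0 → ψ r = 0) ∧
      (∀ r, IsChain (B.stage r) (B.stage r + 2) (ψ r)) ∧
      (∀ r, ψ r ∈ weightsIn GKind.par {B.par r}) ∧
      ∀ r, B.stage r ≤ k → T.deltaKT (ψ r) - T.defect ψ r ∈ vanishing U := by
  classical
  induction k with
  | zero =>
    obtain ⟨U, hU⟩ := hC
    refine ⟨U, hU, fun _ => 0, fun _ _ => rfl,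
      fun r => isChain_iff.2 ⟨zero_mem _, zero_mem _, zero_mem _⟩, fun r => zero_mem _,
      fun r hr => ?_⟩
    rw [T.defect_of_stage_eq_zero _ (Nat.le_zero.1 hr), sub_zero, deltaKT, rightDer_zero]
    exact zero_mem _
  | succ k ih =>
    obtain ⟨U, hU, ψ, h0, hchain, hpar, hδ⟩ := ih
    obtain ⟨U', hU', hsub, hsolve⟩ := hstep U hU
    have hnew (r : Fin B.q) : ∃ χ : Alg B, B.stage r = k + 1 → IsChain (k + 1) (k + 3) χ ∧
        χ ∈ weightsIn GKind.par {B.par r} ∧ T.deltaKT χ - T.defect ψ r ∈ vanishing U' := by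
      by_cases hr : B.stage r = k + 1
      · have hle : k ≤ B.N := by
          have := B.stage_le r
          omega
        -- The defect of stage `k + 1` has antifields of level at most `k` and is a cycle over the
        -- open set `U`, because the stage `k` errors vanish there together with their total
        -- derivatives.
        obtain ⟨χ, hχ⟩ := hsolve k hle (T.defect ψ r) (B.par r) (T.defect_isChain hchain hr)
          (T.defect_par hpar r) (by
            rw [T.deltaKT_defect hT hu (fun r => (hchain r).1) (by omega)]
            refine T.linOp_mem_vanishing (hopen U hU) ?_
            rintro (A | r') hw
            · exact zero_mem _
            · have : B.stage r' + 1 = B.stage r := hw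
              exact hδ r' (by omega))
        exact ⟨χ, fun _ => hχ⟩
      · exact ⟨0, fun h => absurd h hr⟩
    choose χ hχ using hnew
    -- Only the components of stage `k + 1` are replaced.
    let ψ' : Fin B.q → Alg B := fun r => if B.stage r = k + 1 then χ r else ψ r
    have hψ' (r : Fin B.q) (hr : B.stage r ≤ k + 1) : T.defect ψ' r = T.defect ψ r :=
      T.defect_congr fun r' hr' => if_neg (by omega)
    refine ⟨U', hU', ψ', fun r hr => ?_, fun r => ?_, fun r => ?_, fun r hr => ?_⟩
    · simp only [ψ']
      rw [if_neg (by omega), h0 r hr]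
    · by_cases hr : B.stage r = k + 1
      · simp only [ψ', if_pos hr, hr]
        exact (hχ r hr).1
      · simp only [ψ', if_neg hr]
        exact hchain r
    · by_cases hr : B.stage r = k + 1
      · simp only [ψ', if_pos hr]
        exact (hχ r hr).2.1
      · simp only [ψ', if_neg hr]
        exact hpar r
    · rw [hψ' r hr]
      by_cases hr' : B.stage r = k + 1
      · simp only [ψ', if_pos hr']
        exact (hχ r hr').2.2
      · simp only [ψ', if_neg hr']
        exact fun α z hz => hδ r (by omega) α z (hsub hz)

theorem reducesOver_of_solvesOver (hT : ∀ f, GhostFree f → T.deltaKT (T.deltaKT f) = 0)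
    (hu : ∀ w, T.uStage (level w + 1) (T.u w) = 0)
    {C : Set (Set ((Fin B.n → ℝ) × (Fin B.m → ℝ)))} (hC : C.Nonempty)
    (hopen : ∀ U ∈ C, IsOpen U)
    (hstep : ∀ U ∈ C, ∃ U' ∈ C, U' ⊆ U ∧ T.SolvesOver U U') :
    ∃ U ∈ C, T.ReducesOver U := by
  obtain ⟨U, hU, ψ, h0, hchain, hpar, hδ⟩ := T.exists_reduction hT hu hC hopen hstep B.N
  refine ⟨U, hU, ψ, h0, fun r => ⟨hchain r, hpar r⟩, fun r => ?_⟩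
  have e1 : T.deltaKT (gen (.anti (.inr r), 0) - ψ r) = T.lin r + T.h r - T.deltaKT (ψ r) := by
    refine (rightDer_sub _ _ _).trans ?_
    rw [rightDer_gen]; rfl
  have e2 : (Sum.elim (fun A => gen (.anti (.inl A), 0))
      fun r' => gen (.anti (.inr r'), 0) - ψ r' : Fld B → Alg B) =
      (fun w => gen (.anti w, 0)) - Sum.elim (fun _ => 0) ψ := by
    funext w
    rcases w with A | r' <;> simp
  rw [e1, e2, linOp_sub, ← lin_eq]
  -- The failure of the linear identity for the new antifields is precisely minus the unsolved part
  -- of the defect equation.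
  have e3 : T.lin r + T.h r - T.deltaKT (ψ r) -
      (T.lin r - T.linOp r (Sum.elim (fun _ => 0) ψ)) =
      -(T.deltaKT (ψ r) - T.defect ψ r) := by
    rw [defect]; abel
  rw [e3]
  exact (vanishing U).neg_mem (hδ r (B.stage_le r))

/-! ### The global and the compactly supported reductions -/

theorem ReducesOver.mono {Z Z' : Set ((Fin B.n → ℝ) × (Fin B.m → ℝ))} (h : Z ⊆ Z')
    (hZ : T.ReducesOver Z') : T.ReducesOver Z := by
  obtain ⟨ψ, h0, h1, h2⟩ := hZ
  exact ⟨ψ, h0, h1, fun r α z hz => h2 r α z (h hz)⟩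

theorem reducesOver_univ (hT : ∀ f, GhostFree f → T.deltaKT (T.deltaKT f) = 0)
    (hu : ∀ w, T.uStage (level w + 1) (T.u w) = 0) (h : T.HomologyCondition Set.univ) :
    T.ReducesOver Set.univ := by
  obtain ⟨U, rfl, hU⟩ := T.reducesOver_of_solvesOver hT hu (C := {Set.univ})
    (Set.singleton_nonempty _) (by rintro _ rfl; exact isOpen_univ) (by
      rintro _ rfl
      -- No cutoff is required over the whole space, so `χ = 1`.
      refine ⟨_, rfl, subset_rfl, HomologyCondition.solvesOver T h subset_rfl (χ := 1) ?_ ?_⟩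
      · exact fun z hz => absurd trivial hz
      · rw [sub_self]
        exact Submodule.zero_mem _)
  exact hU

theorem reducesOver_compact (hT : ∀ f, GhostFree f → T.deltaKT (T.deltaKT f) = 0)
    (hu : ∀ w, T.uStage (level w + 1) (T.u w) = 0)
    (h : ∀ K : Set ((Fin B.n → ℝ) × (Fin B.m → ℝ)), IsCompact K → K ⊆ B.V →
      T.HomologyCondition K) {K : Set ((Fin B.n → ℝ) × (Fin B.m → ℝ))} (hK : IsCompact K)
    (hKV : K ⊆ B.V) : T.ReducesOver K := by
  obtain ⟨U, hU, hred⟩ := T.reducesOver_of_solvesOver hT hu (C := {U | IsOpen U ∧ K ⊆ U})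
    ⟨Set.univ, isOpen_univ, Set.subset_univ _⟩ (fun U hU => hU.1) (by
      rintro U ⟨hUo, hKU⟩
      -- Two nested compact sets around `K` leave room for a cutoff equal to one on `L` and zero
      -- outside `L'`. The equations then hold over `interior L`, again an open neighbourhood of
      -- `K`, and the homology condition is applied for `L'`.
      obtain ⟨L, hL, hKL, hLU⟩ := exists_compact_between hK (hUo.inter B.V.isOpen)
        (Set.subset_inter hKU hKV)
      obtain ⟨L', hL', hLL', hLU'⟩ := exists_compact_between hL (hUo.inter B.V.isOpen) hLU
      obtain ⟨g, hg, hg1, hg0⟩ := exists_smooth_cutoff hL.isClosed hLL'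
      refine ⟨interior L, ⟨isOpen_interior, hKL⟩, interior_subset.trans
        (hLU.trans Set.inter_subset_left), ?_⟩
      refine HomologyCondition.solvesOver T (h L' hL' (hLU'.trans Set.inter_subset_right))
        (hLU'.trans Set.inter_subset_left) (χ := baseFun g hg) (fun z hz => hg0 _ hz)
        fun z hz => ?_
      change g (base B z.1) - 1 = 0
      rw [hg1 _ (interior_subset hz), sub_self])
  exact ReducesOver.mono T hU.2 hred

end PreTheory

end GaugeTheory

end

theorem proposition6 (B : GaugeTheory.LocalBasis) (T : GaugeTheory.Theory B)
    (hb : ∃ γ : Fin B.q → GaugeTheory.Alg B, T.IsBRSTExtension γ) :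
    -- the higher-stage gauge symmetry conditions hold off-shell: `u^{(k+1)}(u^{(k)}) = 0`
    (∀ k < B.N, ∀ w : GaugeTheory.Fld B, GaugeTheory.level w = k →
      T.uStage (k + 1) (T.u w) = 0) ∧
    -- the higher-stage Noether identities hold off-shell: both of their sides vanish
    (∀ r : Fin B.q, 1 ≤ B.stage r →
      T.linOp r (Sum.elim (fun _ => 0) T.lin) = 0 ∧
      T.deltaBar (GaugeTheory.antiPart 2 (T.h r)) = 0) ∧
    -- under the homology condition each `Δ_r` reduces to its part linear in antifields
    (T.HomologyCondition Set.univ → T.ReducesOver Set.univ) ∧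
    -- the same locally, if only cycles with compact support in the domain are boundaries
    ((∀ K : Set ((Fin B.n → ℝ) × (Fin B.m → ℝ)), IsCompact K → K ⊆ B.V →
        T.HomologyCondition K) →
      ∀ K : Set ((Fin B.n → ℝ) × (Fin B.m → ℝ)), IsCompact K → K ⊆ B.V →
        T.ReducesOver K) := by
  obtain ⟨γ, hγ⟩ := hb
  have hu := T.uStage_u_eq_zero hγ
  refine ⟨?_, fun r hr => ?_, T.reducesOver_univ T.nilpotent hu,
    fun h K hK hKV => T.reducesOver_compact T.nilpotent hu h hK hKV⟩
  · rintro _ - w rfl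
    exact hu w
  · exact ⟨T.linOp_lin_eq_zero hu r,
      T.deltaBar_antiPart_h T.nilpotent hu (Nat.one_le_iff_ne_zero.1 hr)⟩
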